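/- Let $P$ be a convex polygon in the plane, that is, the convex hull of finitely many points, with nonempty interior. Then there is a constant $\alpha\ge 1$, depending only on $P$, such that for every integer $k\ge 1$ every finite collection of translates $P+x_1,\dots,P+x_N$ of $P$ (repetitions allowed) can be partitioned into $\lceil k/\alpha\rceil$ sub-collections (some possibly empty), each of which covers every point of the plane that is covered by at least $k$ members of the original collection. Moreover, for fixed $P$ such a partition can be computed in polynomial time: there are a real-RAM program and a polynomial $p$, both depending only on $P$ and on an ordering of its vertices, such that for all $k\ge 1$, $N\ge 0$ and $x_1,\dots,x_N\in\mathbb R^2$ the program, given $N$, $k$, and the coordinates of the vertices of $P$ in this order and of the vectors $x_1,\dots,x_N$, halts after at most $p(N)$ steps and outputs, for each $j\le N$, the index of the sub-collection that contains $P+x_j$. Here a real RAM has memory cells for natural numbers and for real numbers, with indirect addressing; it performs addition and truncated subtraction of natural numbers, conversion of natural numbers to real numbers, addition, subtraction, multiplication and division of real numbers, and comparisons, each in unit time; it has no rounding operation, and its only built-in constants are natural numbers. -/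

import Mathlib

/-! ### Decompositions of collections of translates -/

/-- A (closed) convex polygon in the plane: the convex hull of finitely many points, with nonempty
interior. -/
def IsConvexPolygon (P : Set (EuclideanSpace ℝ (Fin 2))) : Prop :=
  (∃ S : Finset (EuclideanSpace ℝ (Fin 2)), P = convexHull ℝ (S : Set _)) ∧ (interior P).Nonempty

/-- `v 0, …, v (n - 1)` is a list, without repetitions and in any order, of the vertices of `P`. -/
def IsVertexList (P : Set (EuclideanSpace ℝ (Fin 2))) {n : ℕ}
    (v : Fin n → EuclideanSpace ℝ (Fin 2)) : Prop :=
  Function.Injective v ∧ Set.range v = P.extremePoints ℝ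

/-- The translate `x + P` of the planar set `P`. -/
def planeTranslate (P : Set (EuclideanSpace ℝ (Fin 2))) (x : EuclideanSpace ℝ (Fin 2)) :
    Set (EuclideanSpace ℝ (Fin 2)) :=
  {y | y - x ∈ P}

/-- The colouring `c` partitions the finite collection of translates `x j + P`, `j < N` (repetitions
allowed), into `m` sub-collections, each of which covers every point of the plane that lies in at
least `k` members of the whole collection. -/
def IsDecomposition (P : Set (EuclideanSpace ℝ (Fin 2))) {N : ℕ}
    (x : Fin N → EuclideanSpace ℝ (Fin 2)) (k : ℕ) {m : ℕ} (c : Fin N → Fin m) : Prop :=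
  ∀ y : EuclideanSpace ℝ (Fin 2), k ≤ {j : Fin N | y ∈ planeTranslate P (x j)}.ncard →
    ∀ i : Fin m, ∃ j : Fin N, c j = i ∧ y ∈ planeTranslate P (x j)

/-! ### A real random access machine

Programs of a small imperative language that work on arrays of natural numbers (used for counting
and addressing) and arrays of real numbers. One unit of time is charged for each arithmetic
operation, memory access, constant, comparison, Boolean connective, assignment and branching.
Natural numbers can be added and subtracted; on real numbers the four field operations and exact
comparison are available. There is no rounding, and all constants are natural numbers. -/

namespace RealRAM

/-- The memory: entry `i` of the `a`-th array of naturals, resp. of reals. -/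
structure State where
  nat : ℕ → ℕ → ℕ
  real : ℕ → ℕ → ℝ

/-- Assign `z` to entry `i` of the `a`-th array of naturals. -/
def State.setNat (s : State) (a i z : ℕ) : State :=
  { s with nat := Function.update s.nat a (Function.update (s.nat a) i z) }

/-- Assign `z` to entry `i` of the `a`-th array of reals. -/
noncomputable def State.setReal (s : State) (a i : ℕ) (z : ℝ) : State :=
  { s with real := Function.update s.real a (Function.update (s.real a) i z) }

/-- Expressions for natural numbers; `read a i` is entry `i` of the `a`-th array of naturals, so
that nested reads give indirect addressing. -/
inductive NatExpr where
  | lit (z : ℕ)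
  | read (a : ℕ) (i : NatExpr)
  | add (e₁ e₂ : NatExpr)
  | sub (e₁ e₂ : NatExpr)

/-- The value of an expression (subtraction is truncated at `0`). -/
def NatExpr.eval (s : State) : NatExpr → ℕ
  | lit z => z
  | read a i => s.nat a (i.eval s)
  | add e₁ e₂ => e₁.eval s + e₂.eval s
  | sub e₁ e₂ => e₁.eval s - e₂.eval s

/-- The number of steps needed to evaluate an expression. -/
def NatExpr.cost : NatExpr → ℕ
  | lit _ => 1
  | read _ i => i.cost + 1
  | add e₁ e₂ => e₁.cost + e₂.cost + 1
  | sub e₁ e₂ => e₁.cost + e₂.cost + 1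

/-- Expressions for real numbers. -/
inductive RealExpr where
  | ofNat (e : NatExpr)
  | read (a : ℕ) (i : NatExpr)
  | add (e₁ e₂ : RealExpr)
  | sub (e₁ e₂ : RealExpr)
  | mul (e₁ e₂ : RealExpr)
  | div (e₁ e₂ : RealExpr)

/-- The value of an expression (division by `0` returns `0`). -/
noncomputable def RealExpr.eval (s : State) : RealExpr → ℝ
  | ofNat e => (e.eval s : ℝ)
  | read a i => s.real a (i.eval s)
  | add e₁ e₂ => e₁.eval s + e₂.eval s
  | sub e₁ e₂ => e₁.eval s - e₂.eval s
  | mul e₁ e₂ => e₁.eval s * e₂.eval s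
  | div e₁ e₂ => e₁.eval s / e₂.eval s

/-- The number of steps needed to evaluate an expression. -/
def RealExpr.cost : RealExpr → ℕ
  | ofNat e => e.cost + 1
  | read _ i => i.cost + 1
  | add e₁ e₂ => e₁.cost + e₂.cost + 1
  | sub e₁ e₂ => e₁.cost + e₂.cost + 1
  | mul e₁ e₂ => e₁.cost + e₂.cost + 1
  | div e₁ e₂ => e₁.cost + e₂.cost + 1

/-- Tests. -/
inductive Test where
  | natLt (e₁ e₂ : NatExpr)
  | realLt (e₁ e₂ : RealExpr)
  | not (b : Test)
  | and (b₁ b₂ : Test)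

/-- The truth value of a test. -/
def Test.Holds (s : State) : Test → Prop
  | natLt e₁ e₂ => e₁.eval s < e₂.eval s
  | realLt e₁ e₂ => e₁.eval s < e₂.eval s
  | not b => ¬ b.Holds s
  | and b₁ b₂ => b₁.Holds s ∧ b₂.Holds s

/-- The number of steps needed to evaluate a test. -/
def Test.cost : Test → ℕ
  | natLt e₁ e₂ => e₁.cost + e₂.cost + 1
  | realLt e₁ e₂ => e₁.cost + e₂.cost + 1
  | not b => b.cost + 1
  | and b₁ b₂ => b₁.cost + b₂.cost + 1

/-- Programs; `setNat a i e` assigns the value of `e` to entry `i` of the `a`-th array of naturals,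
and similarly for `setReal`. -/
inductive Prog where
  | skip
  | setNat (a : ℕ) (i e : NatExpr)
  | setReal (a : ℕ) (i : NatExpr) (e : RealExpr)
  | seq (p q : Prog)
  | ite (b : Test) (p q : Prog)
  | loop (b : Test) (p : Prog)

/-- `Exec p s s' t`: started in the memory state `s`, the program `p` halts after exactly `t` steps
in the memory state `s'`. Here `loop b p` repeats `p` while the test `b` holds. -/
inductive Exec : Prog → State → State → ℕ → Prop where
  | skip (s : State) : Exec .skip s s 1
  | setNat (s : State) (a : ℕ) (i e : NatExpr) :
      Exec (.setNat a i e) s (s.setNat a (i.eval s) (e.eval s)) (i.cost + e.cost + 1)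
  | setReal (s : State) (a : ℕ) (i : NatExpr) (e : RealExpr) :
      Exec (.setReal a i e) s (s.setReal a (i.eval s) (e.eval s)) (i.cost + e.cost + 1)
  | seq {p q : Prog} {s s' s'' : State} {t t' : ℕ} :
      Exec p s s' t → Exec q s' s'' t' → Exec (.seq p q) s s'' (t + t')
  | ite_true {b : Test} {p q : Prog} {s s' : State} {t : ℕ} :
      b.Holds s → Exec p s s' t → Exec (.ite b p q) s s' (b.cost + t + 1)
  | ite_false {b : Test} {p q : Prog} {s s' : State} {t : ℕ} :
      ¬ b.Holds s → Exec q s s' t → Exec (.ite b p q) s s' (b.cost + t + 1)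
  | loop_true {b : Test} {p : Prog} {s s' s'' : State} {t t' : ℕ} :
      b.Holds s → Exec p s s' t → Exec (.loop b p) s' s'' t' →
        Exec (.loop b p) s s'' (b.cost + t + t' + 1)
  | loop_false {b : Test} {p : Prog} {s : State} :
      ¬ b.Holds s → Exec (.loop b p) s s (b.cost + 1)

/-- The `d`-th coordinates of a list of points, as an array padded with zeros. -/
noncomputable def coords {N : ℕ} (x : Fin N → EuclideanSpace ℝ (Fin 2)) (d : Fin 2) (j : ℕ) : ℝ :=
  if h : j < N then x ⟨j, h⟩ d else 0

/-- The initial memory. Array `0` of naturals holds the number `N` of translates and the number `k`;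
arrays `0` and `1` of reals hold the coordinates of the vertices `v i` of the polygon, and arrays `2`
and `3` those of the translation vectors `x j`. All other entries are `0`. -/
noncomputable def input {n N : ℕ} (v : Fin n → EuclideanSpace ℝ (Fin 2))
    (x : Fin N → EuclideanSpace ℝ (Fin 2)) (k : ℕ) : State where
  nat a i := if a = 0 ∧ i = 0 then N else if a = 0 ∧ i = 1 then k else 0
  real a i :=
    if a = 0 then coords v 0 i else if a = 1 then coords v 1 i
    else if a = 2 then coords x 0 i else if a = 3 then coords x 1 i else 0

end RealRAM

/-!
A point `y` lies in the translate `P + x` if and only if `x` lies in the reflected polygon `y - P`.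
The vectors `x` therefore have to be coloured such that every set `y - P` that contains at least `k`
of them contains all `⌈k / α⌉` colours.

**Reduction to wedges.** The vectors are distributed over cells of small diameter. A real RAM cannot
round, hence the cells are not those of a grid: their centres are chosen greedily, at distance at
least `1 / M` in one coordinate, and each vector belongs to the first centre near to it
(`markCentres`, `cellOf`). A set `y - P` meets at most `C` cells, so that one of them contains
`k / C` of its vectors. By a compactness argument (`exists_local_corner`), `P` looks like one of its
corners on a set of small diameter; thus within a cell `y - P` is a wedge `f ≤ γ`, `g ≤ δ`, where
`f` and `g` are the edge forms of a corner (`exists_cellWedge`).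

**Rounds.** In each round, for one colour, every corner selects points among those that have no
previous colour. Among the wedges of that corner with `k / c₁` points consider the minimal ones.
Each contains a candidate: a point, minimal in the product order of `f` and `g`, that in every
direction `m` which is a negative combination of `f` and `g` has `k / c₂` points of the wedge with
smaller or equal value of `m` (`WedgeSystem.exists_candidateFor`). From all candidates an
inclusion-minimal subset `H` that still meets all minimal wedges is selected
(`WedgeSystem.IsSparseHitting`), and it gets the colour of the round.

**Few points are lost.** The points of `H` form a staircase, of which a minimal wedge contains at
most two (`IsSparseHitting.not_three`). Let `V` be a wedge of any corner, given by forms `m₁` and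
`m₂`. Because an edge form is never a positive combination of the two forms of a corner
(`IsPolygonCorner.not_pos`), each of `m₁`, `m₂` either is controlled on the wedge of a point `p` of
`H ∩ V` by the neighbours of `p` in `H ∩ V`, or is a negative combination, for which the points
below `p` were provided. Consequently the wedges of every fourth point of `H ∩ V` are disjoint and,
with at most one exception, have `k / c₂` points in `V` (`card_hitting_inter_wedge_le`). So one
round removes from `V` only a fraction of order `1 / k` of its points if `V` has at least `k / C` of
them. During `⌈k / α⌉` rounds at least half of `V` is left, `V` stays heavy, and it receives all
colours (`RoundInvariant.step`).

**Running time.** All steps are assignments conditioned on relations between indices of points. The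
relations are built from comparisons of edge forms by Boolean operations and by quantifiers that
count indices below `N`; such relations are decidable in polynomial time (`PolyDec.and`,
`PolyDec.not`, `PolyDec.count`). If `k > N` there is nothing to cover, and otherwise there are at
most `N` rounds.
-/

/-! ### Relations decidable in polynomial time on the real RAM -/

namespace RealRAM

/-- Two memories agree outside of the scratch arrays: array `5` of naturals holds the values of
bound variables, entry `0` of array `6` the truth value computed last, array `7` counters. -/
structure Agree (s D : State) : Prop where
  real : s.real = D.real
  nat : ∀ a, a ≠ 5 → a ≠ 6 → a ≠ 7 → s.nat a = D.nat a

theorem Agree.refl (s : State) : Agree s s := ⟨rfl, fun _ _ _ _ => rfl⟩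

theorem Agree.size {s D : State} (h : Agree s D) : s.nat 0 0 = D.nat 0 0 := by
  rw [h.nat 0 (by decide) (by decide) (by decide)]

theorem Agree.set_scratch {s D : State} (h : Agree s D) {a : ℕ} (ha : a = 5 ∨ a = 6 ∨ a = 7)
    (i z : ℕ) : Agree (s.setNat a i z) D :=
  ⟨h.real, fun b h5 h6 h7 => by
    have : b ≠ a := by omega
    simp [State.setNat, this, h.nat b h5 h6 h7]⟩

theorem Agree.set_data {s D : State} (h : Agree s D) (a i z : ℕ) :
    Agree (s.setNat a i z) (D.setNat a i z) :=
  ⟨h.real, fun b h5 h6 h7 => by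
    by_cases hb : b = a
    · subst hb; simp [State.setNat, h.nat b h5 h6 h7]
    · simp [State.setNat, hb, h.nat b h5 h6 h7]⟩

@[simp] theorem setNat_nat_same (s : State) (a i z : ℕ) : (s.setNat a i z).nat a i = z := by
  simp [State.setNat]

theorem setNat_nat_of_ne_left (s : State) {a b : ℕ} (h : b ≠ a) (i j z : ℕ) :
    (s.setNat a i z).nat b j = s.nat b j := by
  simp [State.setNat, h]

theorem setNat_nat_of_ne_right (s : State) {i j : ℕ} (h : j ≠ i) (a b z : ℕ) :
    (s.setNat a i z).nat b j = s.nat b j := by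
  by_cases hb : b = a
  · subst hb; simp [State.setNat, h]
  · simp [State.setNat, hb]

/-- The variables and counters with numbers below `d` are the same in both memories. -/
def KeepsBelow (d : ℕ) (s s' : State) : Prop :=
  ∀ j < d, s'.nat 5 j = s.nat 5 j ∧ s'.nat 7 j = s.nat 7 j

theorem KeepsBelow.refl (d : ℕ) (s : State) : KeepsBelow d s s := fun _ _ => ⟨rfl, rfl⟩

theorem KeepsBelow.trans {d : ℕ} {s s' s'' : State} (h : KeepsBelow d s s')
    (h' : KeepsBelow d s' s'') : KeepsBelow d s s'' :=
  fun j hj => ⟨(h' j hj).1.trans (h j hj).1, (h' j hj).2.trans (h j hj).2⟩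

theorem KeepsBelow.mono {d e : ℕ} {s s' : State} (h : KeepsBelow e s s') (hd : d ≤ e) :
    KeepsBelow d s s' := fun j hj => h j (hj.trans_le hd)

theorem keepsBelow_set {d a i : ℕ} (s : State) (z : ℕ) (h : a = 6 ∨ d ≤ i) :
    KeepsBelow d s (s.setNat a i z) := by
  intro j hj
  rcases h with rfl | h
  · exact ⟨setNat_nat_of_ne_left _ (by decide) _ _ _, setNat_nat_of_ne_left _ (by decide) _ _ _⟩
  · exact ⟨setNat_nat_of_ne_right _ (by omega) _ _ _, setNat_nat_of_ne_right _ (by omega) _ _ _⟩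

/-- The loop `for i = 0, …, N - 1 do p`, the variable `i` being entry `d` of array `5`. -/
def Prog.forLoop (d : ℕ) (p : Prog) : Prog :=
  .seq (.setNat 5 (.lit d) (.lit 0))
    (.loop (.natLt (.read 5 (.lit d)) (.read 0 (.lit 0)))
      (.seq p (.setNat 5 (.lit d) (.add (.read 5 (.lit d)) (.lit 1)))))

theorem exec_loop_induction {p : Prog} {d N B : ℕ} (I : ℕ → State → Prop)
    (hI : ∀ z s, I z s → s.nat 5 d = z ∧ s.nat 0 0 = N)
    (hstep : ∀ z < N, ∀ s, I z s → ∃ s' t, Exec p s s' t ∧ t ≤ B ∧ s'.nat 5 d = z ∧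
      I (z + 1) (s'.setNat 5 d (z + 1))) (m : ℕ) :
    ∀ z s, z + m = N → I z s → ∃ s' t,
      Exec (.loop (.natLt (.read 5 (.lit d)) (.read 0 (.lit 0)))
      (.seq p (.setNat 5 (.lit d) (.add (.read 5 (.lit d)) (.lit 1))))) s s' t ∧
      t ≤ m * (B + 12) + 6 ∧ I N s' := by
  induction m with
  | zero =>
    intro z s hz hs
    obtain ⟨h1, h2⟩ := hI z s hs
    refine ⟨s, _, .loop_false ?_, ?_, ?_⟩
    · simp only [Test.Holds, NatExpr.eval]; omega
    · simp [Test.cost, NatExpr.cost]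
    · obtain rfl : z = N := by omega
      exact hs
  | succ m ih =>
    intro z s hz hs
    obtain ⟨h1, h2⟩ := hI z s hs
    obtain ⟨s', t, he, ht, hv, hs'⟩ := hstep z (by omega) s hs
    obtain ⟨s'', t', he', ht', hs''⟩ := ih (z + 1) _ (by omega) hs'
    have e1 : Exec (.seq p (.setNat 5 (.lit d) (.add (.read 5 (.lit d)) (.lit 1)))) s
        (s'.setNat 5 d (z + 1)) (t + 6) := by
      have := Exec.seq he (Exec.setNat s' 5 (.lit d) (.add (.read 5 (.lit d)) (.lit 1)))
      simpa [NatExpr.eval, NatExpr.cost, hv] using this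
    refine ⟨s'', _, .loop_true ?_ e1 he', ?_, hs''⟩
    · simp only [Test.Holds, NatExpr.eval]; omega
    · simp only [Test.cost, NatExpr.cost]
      have : (m + 1) * (B + 12) = m * (B + 12) + B + 12 := by ring
      omega

theorem exec_forLoop {p : Prog} {d N B : ℕ} (I : ℕ → State → Prop)
    (hI : ∀ z s, I z s → s.nat 5 d = z ∧ s.nat 0 0 = N)
    (hstep : ∀ z < N, ∀ s, I z s → ∃ s' t, Exec p s s' t ∧ t ≤ B ∧ s'.nat 5 d = z ∧
      I (z + 1) (s'.setNat 5 d (z + 1))) {s : State} (hs : I 0 (s.setNat 5 d 0)) :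
    ∃ s' t, Exec (.forLoop d p) s s' t ∧ t ≤ N * (B + 12) + 9 ∧ I N s' := by
  obtain ⟨s', t, he, ht, h⟩ := exec_loop_induction I hI hstep N 0 _ (by omega) hs
  refine ⟨s', 3 + t, ?_, by omega, h⟩
  have := Exec.seq (Exec.setNat s 5 (.lit d) (.lit 0)) he
  simpa [Prog.forLoop, NatExpr.eval, NatExpr.cost] using this

/-- The `c`-fold sum of an expression: multiplication by a constant. -/
def NatExpr.mulLit (e : NatExpr) : ℕ → NatExpr
  | 0 => .lit 0
  | c + 1 => .add (NatExpr.mulLit e c) e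

theorem NatExpr.eval_mulLit (e : NatExpr) (c : ℕ) (s : State) :
    (e.mulLit c).eval s = c * e.eval s := by
  induction c with
  | zero => simp [NatExpr.mulLit, NatExpr.eval]
  | succ c ih => simp [NatExpr.mulLit, NatExpr.eval, ih, add_mul]

/-- A relation between `n` natural numbers, depending on the memory, that programs can decide in a
number of steps bounded by a polynomial in the number `N` of translates. The arguments are variables,
stored in the entries `i j < d` of array `5`; the program may use entries from `d` on. -/
def PolyDec (n : ℕ) (R : State → (Fin n → ℕ) → Prop) : Prop :=
  ∀ (d : ℕ) (i : Fin n → ℕ), (∀ j, i j < d) → ∃ (p : Prog) (T : Polynomial ℕ),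
    ∀ s D : State, Agree s D → ∃ s' t, Exec p s s' t ∧ t ≤ T.eval (D.nat 0 0) ∧ Agree s' D ∧
      KeepsBelow d s s' ∧
      (R D (fun j => s.nat 5 (i j)) ∧ s'.nat 6 0 = 1 ∨
        ¬ R D (fun j => s.nat 5 (i j)) ∧ s'.nat 6 0 = 0)

namespace PolyDec

variable {n m : ℕ} {R R' : State → (Fin n → ℕ) → Prop}

theorem congr (h : PolyDec n R) (hR : ∀ D x, R D x ↔ R' D x) : PolyDec n R' := by
  have : R = R' := by funext D x; exact propext (hR D x)
  exact this ▸ h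

theorem test (b : (Fin n → ℕ) → Test)
    (hb : ∀ i s D, Agree s D → ((b i).Holds s ↔ R D (fun j => s.nat 5 (i j)))) : PolyDec n R := by
  intro d i _
  refine ⟨.ite (b i) (.setNat 6 (.lit 0) (.lit 1)) (.setNat 6 (.lit 0) (.lit 0)),
    .C ((b i).cost + 3 + 1), fun s D hs => ?_⟩
  have hb := hb i s D hs
  by_cases h : (b i).Holds s
  · exact ⟨_, _, .ite_true h (.setNat _ _ _ _), by simp [NatExpr.cost],
      hs.set_scratch (by simp) _ _, keepsBelow_set _ _ (by simp), .inl ⟨hb.1 h, by simp [NatExpr.eval]⟩⟩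
  · exact ⟨_, _, .ite_false h (.setNat _ _ _ _), by simp [NatExpr.cost],
      hs.set_scratch (by simp) _ _, keepsBelow_set _ _ (by simp),
      .inr ⟨fun h' => h (hb.2 h'), by simp [NatExpr.eval]⟩⟩

theorem not (h : PolyDec n R) : PolyDec n (fun D x => ¬ R D x) := by
  intro d i hi
  obtain ⟨p, T, hp⟩ := h d i hi
  refine ⟨.seq p (.setNat 6 (.lit 0) (.sub (.lit 1) (.read 6 (.lit 0)))), T + .C 6,
    fun s D hs => ?_⟩
  obtain ⟨s', t, he, ht, ha, hk, hr⟩ := hp s D hs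
  refine ⟨_, _, .seq he (.setNat _ _ _ _), ?_, ha.set_scratch (by simp) _ _,
    hk.trans (keepsBelow_set _ _ (by simp)), ?_⟩
  · simp [NatExpr.cost]; omega
  · simp only [NatExpr.eval, setNat_nat_same]
    rcases hr with ⟨h1, h2⟩ | ⟨h1, h2⟩
    · exact .inr ⟨not_not.2 h1, by omega⟩
    · exact .inl ⟨h1, by omega⟩

theorem and (h : PolyDec n R) (h' : PolyDec n R') : PolyDec n (fun D x => R D x ∧ R' D x) := by
  intro d i hi
  obtain ⟨p, T, hp⟩ := h d i hi
  obtain ⟨q, T', hq⟩ := h' d i hi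
  refine ⟨.seq p (.ite (.natLt (.lit 0) (.read 6 (.lit 0))) q .skip), T + T' + .C 10,
    fun s D hs => ?_⟩
  obtain ⟨s', t, he, ht, ha, hk, hr⟩ := hp s D hs
  rcases hr with ⟨h1, h2⟩ | ⟨h1, h2⟩
  · obtain ⟨s'', t', he', ht', ha', hk', hr'⟩ := hq s' D ha
    refine ⟨s'', _, .seq he (.ite_true ?_ he'), ?_, ha', hk.trans hk', ?_⟩
    · simp [Test.Holds, NatExpr.eval, h2]
    · simp [Test.cost, NatExpr.cost]; omega
    · have : (fun j => s'.nat 5 (i j)) = fun j => s.nat 5 (i j) := by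
        funext j; exact (hk _ (hi j)).1
      rw [this] at hr'
      tauto
  · refine ⟨s', _, .seq he (.ite_false ?_ (.skip _)), ?_, ha, hk, ?_⟩
    · simp [Test.Holds, NatExpr.eval, h2]
    · simp [Test.cost, NatExpr.cost]; omega
    · tauto

theorem or (h : PolyDec n R) (h' : PolyDec n R') : PolyDec n (fun D x => R D x ∨ R' D x) :=
  (h.not.and h'.not).not.congr fun _ _ => by tauto

theorem imp (h : PolyDec n R) (h' : PolyDec n R') : PolyDec n (fun D x => R D x → R' D x) :=
  (h.and h'.not).not.congr fun _ _ => by tauto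

theorem true : PolyDec n (fun _ _ => True) :=
  test (fun _ => .natLt (.lit 0) (.lit 1)) fun _ _ _ _ => by simp [Test.Holds, NatExpr.eval]

theorem forall_mem_list {ι : Type*} (l : List ι) {S : ι → State → (Fin n → ℕ) → Prop}
    (h : ∀ i ∈ l, PolyDec n (S i)) : PolyDec n (fun D x => ∀ i ∈ l, S i D x) := by
  induction l with
  | nil => exact PolyDec.true.congr fun _ _ => by simp
  | cons a l ih =>
    exact ((h a (by simp)).and (ih fun i hi => h i (by simp [hi]))).congr fun _ _ => by simp

theorem subst (h : PolyDec n R) (σ : Fin n → Fin m) :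
    PolyDec m (fun D x => R D (fun j => x (σ j))) :=
  fun d i hi => h d (fun j => i (σ j)) fun _ => hi _

open Classical in
/-- Counting quantifiers preserve decidability in polynomial time. -/
theorem count {R : State → (Fin (n + 1) → ℕ) → Prop} (h : PolyDec (n + 1) R) (c : ℕ)
    (e : NatExpr) (th : State → ℕ) (hth : ∀ s D, Agree s D → e.eval s = th D) :
    PolyDec n (fun D x =>
      th D ≤ c * ((Finset.range (D.nat 0 0)).filter fun z => R D (Fin.cons z x)).card) := by
  intro d i hi
  obtain ⟨p, T, hp⟩ := h (d + 1) (Fin.cons d i) (by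
    intro j
    refine Fin.cases ?_ (fun j => ?_) j
    · simp
    · simpa using (hi j).trans (Nat.lt_succ_self d))
  let b : Test := .natLt ((NatExpr.read 7 (.lit d)).mulLit c) e
  let q : Prog := .seq p (.setNat 7 (.lit d) (.add (.read 7 (.lit d)) (.read 6 (.lit 0))))
  refine ⟨.seq (.seq (.setNat 7 (.lit d) (.lit 0)) (.forLoop d q))
    (.ite b (.setNat 6 (.lit 0) (.lit 0)) (.setNat 6 (.lit 0) (.lit 1))),
    .X * (T + .C 7 + .C 12) + .C (3 + 9 + b.cost + 3 + 1), fun s D hs => ?_⟩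
  set x : Fin n → ℕ := fun j => s.nat 5 (i j) with hx
  let cnt : ℕ → ℕ := fun m => ((Finset.range m).filter fun z => R D (Fin.cons z x)).card
  have hcnt : ∀ m, cnt (m + 1) = cnt m + if R D (Fin.cons m x) then 1 else 0 := by
    intro m
    simp only [cnt, Finset.range_add_one, Finset.filter_insert]
    split_ifs with hR
    · rw [Finset.card_insert_of_notMem (by simp)]
    · simp
  let I : ℕ → State → Prop := fun z s' => Agree s' D ∧ KeepsBelow d s s' ∧ s'.nat 5 d = z ∧
    s'.nat 7 d = cnt z
  obtain ⟨s₁, t₁, he₁, ht₁, ha₁, hk₁, -, hc₁⟩ := exec_forLoop (p := q) (d := d) (N := D.nat 0 0)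
      (B := T.eval (D.nat 0 0) + 7) I (fun z s' h => ⟨h.2.2.1, h.1.size⟩) (by
        rintro z hz s' ⟨ha, hk, hv, hc⟩
        obtain ⟨s'', t, he, ht, ha', hk', hr⟩ := hp s' D ha
        have hv'' : s''.nat 5 d = z := by rw [(hk' d (by omega)).1, hv]
        have hc'' : s''.nat 7 d = cnt z := by rw [(hk' d (by omega)).2, hc]
        refine ⟨_, _, .seq he (.setNat _ _ _ _), ?_, ?_, ?_, ?_, ?_, ?_⟩
        · simp [NatExpr.cost]; omega
        · rw [setNat_nat_of_ne_left _ (by decide), hv'']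
        · exact (ha'.set_scratch (by simp) _ _).set_scratch (by simp) _ _
        · exact ((hk.trans (hk'.mono (by omega))).trans (keepsBelow_set _ _ (by simp [NatExpr.eval]))).trans
            (keepsBelow_set _ _ (by simp))
        · simp
        · rw [setNat_nat_of_ne_left _ (by decide), hcnt]
          simp only [NatExpr.eval, setNat_nat_same, hc'']
          have hxx : (fun j => s'.nat 5 ((Fin.cons d i : Fin (n + 1) → ℕ) j)) = Fin.cons z x := by
            funext j
            refine Fin.cases ?_ (fun j => ?_) j
            · simp [hv]
            · simp [hx, (hk _ (hi j)).1]
          rw [hxx] at hr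
          rcases hr with ⟨h1, h2⟩ | ⟨h1, h2⟩
          · simp [h1, h2]
          · simp [h1, h2])
      (s := s.setNat 7 d 0) ⟨(hs.set_scratch (by simp) _ _).set_scratch (by simp) _ _,
        (keepsBelow_set _ _ (by simp)).trans (keepsBelow_set _ _ (by simp)), by simp, by
          rw [setNat_nat_of_ne_left _ (by decide)]; simp [cnt]⟩
  have hb : b.Holds s₁ ↔ ¬ th D ≤ c * cnt (D.nat 0 0) := by
    simp only [b, Test.Holds, NatExpr.eval_mulLit, NatExpr.eval, hth s₁ D ha₁, hc₁, not_le]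
  by_cases hB : b.Holds s₁
  · refine ⟨_, _, .seq (.seq (.setNat _ _ _ _) he₁) (.ite_true hB (.setNat _ _ _ _)), ?_,
      ha₁.set_scratch (by simp) _ _, hk₁.trans (keepsBelow_set _ _ (by simp)),
      .inr ⟨hb.1 hB, by simp [NatExpr.eval]⟩⟩
    simp [NatExpr.cost]; omega
  · refine ⟨_, _, .seq (.seq (.setNat _ _ _ _) he₁) (.ite_false hB (.setNat _ _ _ _)), ?_,
      ha₁.set_scratch (by simp) _ _, hk₁.trans (keepsBelow_set _ _ (by simp)),
      .inl ⟨not_not.1 (fun h => hB (hb.2 h)), by simp [NatExpr.eval]⟩⟩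
    simp [NatExpr.cost]; omega

theorem ex {R : State → (Fin (n + 1) → ℕ) → Prop} (h : PolyDec (n + 1) R) :
    PolyDec n (fun D x => ∃ z < D.nat 0 0, R D (Fin.cons z x)) := by
  refine (h.count 1 (.lit 1) (fun _ => 1) fun _ _ _ => rfl).congr fun D x => ?_
  rw [one_mul, Nat.one_le_iff_ne_zero, Finset.card_ne_zero]
  simp [Finset.Nonempty]

theorem all {R : State → (Fin (n + 1) → ℕ) → Prop} (h : PolyDec (n + 1) R) :
    PolyDec n (fun D x => ∀ z < D.nat 0 0, R D (Fin.cons z x)) :=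
  h.not.ex.not.congr fun D x => by push Not; rfl

end PolyDec

/-! ### Transformations of the memory computable in polynomial time -/

/-- A transformation of the memory (up to the scratch arrays) that some program performs in a number
of steps bounded by a polynomial in the number `N` of translates. -/
def PolyComputes (F : State → State) : Prop :=
  ∃ (p : Prog) (T : Polynomial ℕ), ∀ s D : State, Agree s D → ∃ s' t, Exec p s s' t ∧
    t ≤ T.eval (D.nat 0 0) ∧ Agree s' (F D)

open Classical in
/-- Go through `z = 0, …, m - 1` and set entry `z` of array `a` to `val D z` if `R D z` holds in the
current memory `D`. -/
noncomputable def assignUpTo (a : ℕ) (R : State → (Fin 1 → ℕ) → Prop) (val : State → ℕ → ℕ) :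
    ℕ → State → State
  | 0, D => D
  | m + 1, D =>
    let D' := assignUpTo a R val m D
    if R D' ![m] then D'.setNat a m (val D' m) else D'

/-- Go through all indices `z < N` and set entry `z` of array `a` to `val D z` if `R D z` holds in the
current memory `D`. -/
noncomputable def assign (a : ℕ) (R : State → (Fin 1 → ℕ) → Prop) (val : State → ℕ → ℕ)
    (D : State) : State :=
  assignUpTo a R val (D.nat 0 0) D

theorem assignUpTo_nat_of_ne {a b : ℕ} (h : b ≠ a) (R : State → (Fin 1 → ℕ) → Prop)
    (val : State → ℕ → ℕ) (m : ℕ) (D : State) : (assignUpTo a R val m D).nat b = D.nat b := by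
  induction m with
  | zero => rfl
  | succ m ih =>
    simp only [assignUpTo]
    split_ifs
    · funext j; rw [setNat_nat_of_ne_left _ h, ih]
    · exact ih

theorem assignUpTo_real (a : ℕ) (R : State → (Fin 1 → ℕ) → Prop)
    (val : State → ℕ → ℕ) (m : ℕ) (D : State) : (assignUpTo a R val m D).real = D.real := by
  induction m with
  | zero => rfl
  | succ m ih =>
    simp only [assignUpTo]
    split_ifs
    · exact ih
    · exact ih

theorem polyComputes_assign {a : ℕ} (h0 : a ≠ 0) (h5 : a ≠ 5) {R : State → (Fin 1 → ℕ) → Prop}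
    (hR : PolyDec 1 R) (e : NatExpr) (val : State → ℕ → ℕ)
    (hval : ∀ s D, Agree s D → e.eval s = val D (s.nat 5 0)) : PolyComputes (assign a R val) := by
  obtain ⟨p, T, hp⟩ := hR 1 ![0] (by simp)
  let q : Prog := .seq p (.ite (.natLt (.lit 0) (.read 6 (.lit 0)))
    (.setNat a (.read 5 (.lit 0)) e) .skip)
  refine ⟨.forLoop 0 q, .X * (T + .C (e.cost + 10) + .C 12) + .C 9, fun s D hs => ?_⟩
  let I : ℕ → State → Prop := fun z s' => Agree s' (assignUpTo a R val z D) ∧ s'.nat 5 0 = z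
  have hN : ∀ z, (assignUpTo a R val z D).nat 0 0 = D.nat 0 0 := fun z => by
    rw [assignUpTo_nat_of_ne h0.symm]
  obtain ⟨s₁, t₁, he₁, ht₁, ha₁, -⟩ := exec_forLoop (p := q) (d := 0) (N := D.nat 0 0)
      (B := T.eval (D.nat 0 0) + (e.cost + 10)) I
      (fun z s' h => ⟨h.2, h.1.size.trans (hN z)⟩) (by
        rintro z hz s' ⟨ha, hv⟩
        obtain ⟨s'', t, he, ht, ha', hk', hr⟩ := hp s' _ ha
        rw [hN] at ht
        have hv'' : s''.nat 5 0 = z := by rw [(hk' 0 (by omega)).1, hv]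
        have hxx : (fun j => s'.nat 5 ((![0] : Fin 1 → ℕ) j)) = ![z] := by
          funext j; fin_cases j; simp [hv]
        rw [hxx] at hr
        rcases hr with ⟨h1, h2⟩ | ⟨h1, h2⟩
        · refine ⟨_, _, .seq he (.ite_true ?_ (.setNat _ _ _ _)), ?_, ?_, ?_, ?_⟩
          · simp [Test.Holds, NatExpr.eval, h2]
          · simp [Test.cost, NatExpr.cost]; omega
          · rw [setNat_nat_of_ne_left _ h5.symm, hv'']
          · simp only [assignUpTo, h1, if_true, NatExpr.eval, hv'']
            rw [hval s'' _ ha', hv'']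
            exact (ha'.set_data _ _ _).set_scratch (by simp) _ _
          · simp
        · refine ⟨_, _, .seq he (.ite_false ?_ (.skip _)), ?_, hv'', ?_, ?_⟩
          · simp [Test.Holds, NatExpr.eval, h2]
          · simp [Test.cost, NatExpr.cost]; omega
          · simp only [assignUpTo, h1, if_false]
            exact ha'.set_scratch (by simp) _ _
          · simp)
      (s := s) ⟨hs.set_scratch (by simp) _ _, by simp⟩
  refine ⟨s₁, t₁, he₁, ?_, ha₁⟩
  simpa using ht₁

theorem PolyComputes.comp {F G : State → State} (hG : PolyComputes G) (hF : PolyComputes F)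
    (hN : ∀ D, (F D).nat 0 = D.nat 0) : PolyComputes (fun D => G (F D)) := by
  obtain ⟨p, T, hp⟩ := hF
  obtain ⟨q, T', hq⟩ := hG
  refine ⟨.seq p q, T + T', fun s D hs => ?_⟩
  obtain ⟨s₁, t₁, he₁, ht₁, ha₁⟩ := hp s D hs
  obtain ⟨s₂, t₂, he₂, ht₂, ha₂⟩ := hq s₁ _ ha₁
  refine ⟨s₂, _, .seq he₁ he₂, ?_, ha₂⟩
  rw [hN] at ht₂
  simp; omega

theorem PolyComputes.foldl {ι : Type*} (l : List ι) {F : ι → State → State}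
    (hF : ∀ i ∈ l, PolyComputes (F i)) (hN : ∀ i D, (F i D).nat 0 = D.nat 0) :
    PolyComputes (fun D => l.foldl (fun D i => F i D) D) := by
  induction l with
  | nil => exact ⟨.skip, .C 1, fun s D hs => ⟨s, 1, .skip s, by simp, hs⟩⟩
  | cons a l ih =>
    exact (ih fun i hi => hF i (by simp [hi])).comp (hF a (by simp)) (hN a)

/-- A loop that repeats a body computing `F` exactly `m` times. -/
theorem exec_loop_iterate {F : State → State} {p : Prog} {B : ℕ} {b : Test}
    (Good : State → Prop)
    (hp : ∀ s D, Agree s D → Good D → ∃ s' t, Exec p s s' t ∧ t ≤ B ∧ Agree s' (F D))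
    (hF : ∀ D, Good D → Good (F D)) (m : ℕ) :
    ∀ s D, Agree s D → Good D → (∀ j < m, ∀ s', Agree s' (F^[j] D) → b.Holds s') →
      (∀ s', Agree s' (F^[m] D) → ¬ b.Holds s') →
      ∃ s' t, Exec (.loop b p) s s' t ∧ t ≤ m * (B + b.cost + 1) + b.cost + 1 ∧
        Agree s' (F^[m] D) := by
  induction m with
  | zero =>
    intro s D hs _ _ h
    exact ⟨s, _, .loop_false (h s hs), by omega, hs⟩
  | succ m ih =>
    intro s D hs hD h h'
    obtain ⟨s₁, t₁, he₁, ht₁, ha₁⟩ := hp s D hs hD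
    obtain ⟨s₂, t₂, he₂, ht₂, ha₂⟩ := ih s₁ _ ha₁ (hF D hD)
      (fun j hj s' hs' => h (j + 1) (by omega) s' (by simpa using hs'))
      (fun s' hs' => h' s' (by simpa using hs'))
    refine ⟨s₂, _, .loop_true (h 0 (by omega) s hs) he₁ he₂, ?_, by simpa using ha₂⟩
    have : (m + 1) * (B + b.cost + 1) = m * (B + b.cost + 1) + (B + b.cost + 1) := by ring
    omega

end RealRAM

/-! ### Sparse hitting sets for wedges -/

/-- Points are given by indices `u`, with coordinates `f u` and `g u`. The set `H` consists of
Pareto-minimal points of `S` with different first coordinates, so that these points go down from left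
to right. -/
structure IsStaircase (S H : Finset ℕ) (f g : ℕ → ℝ) : Prop where
  subset : H ⊆ S
  pareto : ∀ p ∈ H, ∀ u ∈ S, f u ≤ f p → g u ≤ g p → f p ≤ f u ∧ g p ≤ g u
  inj : ∀ p ∈ H, ∀ q ∈ H, f p = f q → p = q

theorem IsStaircase.anti {S H : Finset ℕ} {f g : ℕ → ℝ} (h : IsStaircase S H f g) {p q : ℕ} (hp : p ∈ H)
    (hq : q ∈ H) (hpq : f p < f q) : g q < g p := by
  by_contra! hg
  exact absurd (h.pareto q hq p (h.subset hp) hpq.le hg).1 (not_le.2 hpq)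

theorem IsStaircase.mono {S H H' : Finset ℕ} {f g : ℕ → ℝ} (h : IsStaircase S H f g) (hH : H' ⊆ H) :
    IsStaircase S H' f g :=
  ⟨hH.trans h.subset, fun p hp => h.pareto p (hH hp), fun p hp q hq => h.inj p (hH hp) q (hH hq)⟩

/-- A set `U` cut out of `S` by a wedge, containing a given point `p` of `H` but no three points of
`H`, lies strictly between points of `H` that are two steps away from `p`. -/
theorem IsStaircase.between_left {S H U : Finset ℕ} {f g : ℕ → ℝ} (h : IsStaircase S H f g)
    {f₀ g₀ : ℝ} (hU : ∀ u, u ∈ U ↔ u ∈ S ∧ f u ≤ f₀ ∧ g u ≤ g₀)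
    (h3 : ∀ p ∈ H, ∀ q ∈ H, ∀ r ∈ H, p ∈ U → q ∈ U → r ∈ U → f p < f q → f q < f r → False)
    {q q' p : ℕ} (hq : q ∈ H) (hq' : q' ∈ H) (hp : p ∈ H) (h1 : f q < f q') (h2 : f q' < f p)
    (hpU : p ∈ U) {u : ℕ} (hu : u ∈ U) : f q < f u ∧ g u < g q := by
  have hg1 := h.anti hq hq' h1
  have hg2 := h.anti hq' hp h2
  obtain ⟨-, hp1, hp2⟩ := (hU p).1 hpU
  obtain ⟨huS, hu1, hu2⟩ := (hU u).1 hu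
  have hg : g₀ < g q := by
    by_contra! hg
    exact h3 q hq q' hq' p hp ((hU q).2 ⟨h.subset hq, by linarith, hg⟩)
      ((hU q').2 ⟨h.subset hq', by linarith, by linarith⟩) hpU h1 h2
  refine ⟨?_, by linarith⟩
  by_contra! hf
  linarith [(h.pareto q hq u huS hf (by linarith)).2]

theorem IsStaircase.between_right {S H U : Finset ℕ} {f g : ℕ → ℝ} (h : IsStaircase S H f g)
    {f₀ g₀ : ℝ} (hU : ∀ u, u ∈ U ↔ u ∈ S ∧ f u ≤ f₀ ∧ g u ≤ g₀)
    (h3 : ∀ p ∈ H, ∀ q ∈ H, ∀ r ∈ H, p ∈ U → q ∈ U → r ∈ U → f p < f q → f q < f r → False)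
    {q q' p : ℕ} (hq : q ∈ H) (hq' : q' ∈ H) (hp : p ∈ H) (h1 : f q' < f q) (h2 : f p < f q')
    (hpU : p ∈ U) {u : ℕ} (hu : u ∈ U) : f u < f q ∧ g q < g u := by
  have hg1 := h.anti hq' hq h1
  have hg2 := h.anti hp hq' h2
  obtain ⟨-, hp1, hp2⟩ := (hU p).1 hpU
  obtain ⟨huS, hu1, hu2⟩ := (hU u).1 hu
  have hf : f₀ < f q := by
    by_contra! hf
    exact h3 p hp q' hq' q hq hpU ((hU q').2 ⟨h.subset hq', by linarith, by linarith⟩)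
      ((hU q).2 ⟨h.subset hq, hf, by linarith⟩) h2 h1
  refine ⟨by linarith, ?_⟩
  by_contra! hg
  linarith [(h.pareto q hq u huS (by linarith) hg).1]

/-- Enumeration of a finite set in increasing order of `f`. -/
theorem exists_enumeration (H : Finset ℕ) (f : ℕ → ℝ) (hf : ∀ p ∈ H, ∀ q ∈ H, f p = f q → p = q) :
    ∃ e : ℕ → ℕ, (∀ i < H.card, e i ∈ H) ∧ ∀ i j, i < j → j < H.card → f (e i) < f (e j) := by
  classical
  have hcard : (H.image f).card = H.card := Finset.card_image_of_injOn fun p hp q hq => hf p hp q hq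
  let E := (H.image f).orderEmbOfFin hcard
  have hE : ∀ i, ∃ p ∈ H, f p = E i := fun i => by
    exact Finset.mem_image.1 (Finset.orderEmbOfFin_mem (H.image f) hcard i)
  choose e he hfe using hE
  refine ⟨fun i => if h : i < H.card then e ⟨i, h⟩ else 0, fun i hi => by simp [hi, he],
    fun i j hij hj => ?_⟩
  simp only [hj, hij.trans hj, dif_pos, hfe]
  exact E.strictMono hij

/-- Let `l₁ f + r₁ g` and `l₂ f + r₂ g` both decrease in `f` and in `g`. The part of the plane where
the first one is at most `γ` and the second one is above `δ`, and the part where it is the other way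
round, are separated by a value of `f`. Therefore a set that meets both parts (in `u` and `u'`) cannot
lie to the left of another such set (with points `w` and `w'`). -/
theorem false_of_straddling {fu fu' fw fw' gu gu' gw gw' l₁ r₁ l₂ r₂ γ δ : ℝ}
    (hr₁ : r₁ < 0) (hr₂ : r₂ < 0)
    (h1 : l₁ * fu + r₁ * gu ≤ γ) (h2 : δ < l₂ * fu + r₂ * gu)
    (h3 : l₂ * fu' + r₂ * gu' ≤ δ) (h4 : γ < l₁ * fu' + r₁ * gu')
    (h5 : l₁ * fw + r₁ * gw ≤ γ) (h6 : δ < l₂ * fw + r₂ * gw)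
    (h7 : l₂ * fw' + r₂ * gw' ≤ δ) (h8 : γ < l₁ * fw' + r₁ * gw')
    (huw : fu < fw') (huw' : fu' < fw) : False := by
  -- `r₂ * (first) - r₁ * (second)` depends on `f` only
  have e1 : (r₂ * l₁ - r₁ * l₂) * fu > r₂ * γ - r₁ * δ := by nlinarith
  have e2 : (r₂ * l₁ - r₁ * l₂) * fu' < r₂ * γ - r₁ * δ := by nlinarith
  have e3 : (r₂ * l₁ - r₁ * l₂) * fw > r₂ * γ - r₁ * δ := by nlinarith
  have e4 : (r₂ * l₁ - r₁ * l₂) * fw' < r₂ * γ - r₁ * δ := by nlinarith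
  rcases le_total 0 (r₂ * l₁ - r₁ * l₂) with h | h
  · nlinarith
  · nlinarith

open Classical in
/-- A sparse set `H` of Pareto-minimal points meets every wedge `V` of another type in few points,
compared with the number of points of `S` in `V`. Each point `p` of `H` lies in a wedge `U p` with many
points of which many are not farther than `p` in each direction `m₁`, `m₂` that decreases in both
coordinates. Taking every fourth point of `H ∩ V`, these wedges are disjoint and, but for one exception,
have many points in `V`. -/
theorem card_hitting_inter_wedge_le {S H : Finset ℕ} {f g m₁ m₂ : ℕ → ℝ} (h : IsStaircase S H f g)
    {k c : ℕ} {γ δ l₁ r₁ l₂ r₂ : ℝ}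
    (hm₁ : ∀ u, m₁ u = l₁ * f u + r₁ * g u) (hm₂ : ∀ u, m₂ u = l₂ * f u + r₂ * g u)
    (h₁ : ¬ (0 < l₁ ∧ 0 < r₁)) (h₂ : ¬ (0 < l₂ ∧ 0 < r₂))
    (U : ℕ → Finset ℕ) (f₀ g₀ : ℕ → ℝ)
    (hU : ∀ p ∈ H, ∀ u, u ∈ U p ↔ u ∈ S ∧ f u ≤ f₀ p ∧ g u ≤ g₀ p) (hpU : ∀ p ∈ H, p ∈ U p)
    (h3 : ∀ o ∈ H, ∀ p ∈ H, ∀ q ∈ H, ∀ r ∈ H, p ∈ U o → q ∈ U o → r ∈ U o → f p < f q → f q < f r →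
      False)
    (hk : ∀ p ∈ H, k ≤ c * (U p).card)
    (hk₁ : ∀ p ∈ H, l₁ < 0 → r₁ < 0 → k ≤ c * ((U p).filter fun u => m₁ u ≤ m₁ p).card)
    (hk₂ : ∀ p ∈ H, l₂ < 0 → r₂ < 0 → k ≤ c * ((U p).filter fun u => m₂ u ≤ m₂ p).card) :
    k * (H.filter fun u => m₁ u ≤ γ ∧ m₂ u ≤ δ).card ≤
      4 * c * (S.filter fun u => m₁ u ≤ γ ∧ m₂ u ≤ δ).card + 8 * k := by
  set H' := H.filter fun u => m₁ u ≤ γ ∧ m₂ u ≤ δ with hH'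
  have hsub : H' ⊆ H := Finset.filter_subset _ _
  have hin : ∀ p ∈ H', m₁ p ≤ γ ∧ m₂ p ≤ δ := fun p hp => (Finset.mem_filter.1 hp).2
  obtain ⟨e, heH, hef⟩ := exists_enumeration H' f fun p hp q hq => h.inj p (hsub hp) q (hsub hq)
  set M := H'.card
  let V : ℕ → Finset ℕ := fun t => (U (e (4 * t + 2))).filter fun u => m₁ u ≤ γ ∧ m₂ u ≤ δ
  set n := (M - 1) / 4 with hn
  -- all points of the chosen wedges are strictly between two points of `H ∩ V`
  have hL : ∀ t < n, ∀ u ∈ U (e (4 * t + 2)), f (e (4 * t)) < f u ∧ g u < g (e (4 * t)) :=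
    fun t ht u hu => h.between_left (hU _ (hsub (heH _ (by omega))))
      (h3 _ (hsub (heH _ (by omega)))) (q' := e (4 * t + 1)) (p := e (4 * t + 2))
      (hsub (heH _ (by omega))) (hsub (heH _ (by omega))) (hsub (heH _ (by omega)))
      (hef _ _ (by omega) (by omega)) (hef _ _ (by omega) (by omega))
      (hpU _ (hsub (heH _ (by omega)))) hu
  have hR : ∀ t < n, ∀ u ∈ U (e (4 * t + 2)), f u < f (e (4 * t + 4)) ∧ g (e (4 * t + 4)) < g u :=
    fun t ht u hu => h.between_right (hU _ (hsub (heH _ (by omega))))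
      (h3 _ (hsub (heH _ (by omega)))) (q' := e (4 * t + 3)) (p := e (4 * t + 2))
      (hsub (heH _ (by omega))) (hsub (heH _ (by omega))) (hsub (heH _ (by omega)))
      (hef _ _ (by omega) (by omega)) (hef _ _ (by omega) (by omega))
      (hpU _ (hsub (heH _ (by omega)))) hu
  -- a functional that does not decrease in both coordinates is controlled by these two points
  have hctl : ∀ (l r : ℝ) (m : ℕ → ℝ) (β : ℝ), (∀ u, m u = l * f u + r * g u) →
      ¬ (0 < l ∧ 0 < r) → ¬ (l < 0 ∧ r < 0) → (∀ p ∈ H', m p ≤ β) →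
      ∀ t < n, ∀ u ∈ U (e (4 * t + 2)), m u ≤ β := by
    intro l r m β hm hpos hneg hβ t ht u hu
    obtain ⟨a1, a2⟩ := hL t ht u hu
    obtain ⟨b1, b2⟩ := hR t ht u hu
    have ha := hβ _ (heH (4 * t) (by omega))
    have hb := hβ _ (heH (4 * t + 4) (by omega))
    rw [hm] at ha hb ⊢
    have : (l ≤ 0 ∧ 0 ≤ r) ∨ (0 ≤ l ∧ r ≤ 0) := by
      rcases lt_trichotomy l 0 with hl | hl | hl
      · exact .inl ⟨hl.le, by by_contra! hr; exact hneg ⟨hl, hr⟩⟩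
      · rcases le_total 0 r with hr | hr
        · exact .inl ⟨hl.le, hr⟩
        · exact .inr ⟨hl.ge, hr⟩
      · exact .inr ⟨hl.le, by by_contra! hr; exact hpos ⟨hl, hr⟩⟩
    rcases this with ⟨hl, hr⟩ | ⟨hl, hr⟩ <;> nlinarith
  have hV : ∀ t < n, ¬ k ≤ c * (V t).card → (l₁ < 0 ∧ r₁ < 0) ∧ (l₂ < 0 ∧ r₂ < 0) ∧
      (∃ u ∈ U (e (4 * t + 2)), m₁ u ≤ γ ∧ δ < m₂ u) ∧
      (∃ u ∈ U (e (4 * t + 2)), m₂ u ≤ δ ∧ γ < m₁ u) := by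
    intro t ht hbad
    have hp := heH (4 * t + 2) (by omega)
    have key : ∀ W ⊆ U (e (4 * t + 2)), k ≤ c * W.card → ∃ u ∈ W, ¬ (m₁ u ≤ γ ∧ m₂ u ≤ δ) := by
      intro W hW hkW
      by_contra! hall
      refine hbad (hkW.trans (Nat.mul_le_mul_left _ (Finset.card_le_card fun u hu => ?_)))
      exact Finset.mem_filter.2 ⟨hW hu, hall u hu⟩
    have c₁ := hctl l₁ r₁ m₁ γ hm₁ h₁
    have c₂ := hctl l₂ r₂ m₂ δ hm₂ h₂
    have hd₁ : l₁ < 0 ∧ r₁ < 0 → ∃ u ∈ U (e (4 * t + 2)), m₁ u ≤ γ ∧ δ < m₂ u := by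
      intro hd
      obtain ⟨u, hu, hn⟩ := key _ (Finset.filter_subset _ _) (hk₁ _ (hsub hp) hd.1 hd.2)
      obtain ⟨hu1, hu2⟩ := Finset.mem_filter.1 hu
      have : m₁ u ≤ γ := hu2.trans (hin _ hp).1
      exact ⟨u, hu1, this, not_le.1 fun h' => hn ⟨this, h'⟩⟩
    have hd₂ : l₂ < 0 ∧ r₂ < 0 → ∃ u ∈ U (e (4 * t + 2)), m₂ u ≤ δ ∧ γ < m₁ u := by
      intro hd
      obtain ⟨u, hu, hn⟩ := key _ (Finset.filter_subset _ _) (hk₂ _ (hsub hp) hd.1 hd.2)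
      obtain ⟨hu1, hu2⟩ := Finset.mem_filter.1 hu
      have : m₂ u ≤ δ := hu2.trans (hin _ hp).2
      exact ⟨u, hu1, this, not_le.1 fun h' => hn ⟨h', this⟩⟩
    have hd1 : l₁ < 0 ∧ r₁ < 0 := by
      by_contra hd1
      by_cases hd2 : l₂ < 0 ∧ r₂ < 0
      · obtain ⟨u, hu, -, hu'⟩ := hd₂ hd2
        exact absurd (c₁ hd1 (fun p hp => (hin p hp).1) t ht u hu) (not_le.2 hu')
      · obtain ⟨u, hu, hn⟩ := key _ subset_rfl (hk _ (hsub hp))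
        exact hn ⟨c₁ hd1 (fun p hp => (hin p hp).1) t ht u hu,
          c₂ hd2 (fun p hp => (hin p hp).2) t ht u hu⟩
    have hd2 : l₂ < 0 ∧ r₂ < 0 := by
      by_contra hd2
      obtain ⟨u, hu, -, hu'⟩ := hd₁ hd1
      exact absurd (c₂ hd2 (fun p hp => (hin p hp).2) t ht u hu) (not_le.2 hu')
    exact ⟨hd1, hd2, hd₁ hd1, hd₂ hd2⟩
  have hmono : ∀ t t', t < t' → t' < n → ∀ u ∈ U (e (4 * t + 2)), ∀ w ∈ U (e (4 * t' + 2)),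
      f u < f w := by
    intro t t' htt ht' u hu w hw
    have a := (hR t (by omega) u hu).1
    have b := (hL t' ht' w hw).1
    have c : f (e (4 * t + 4)) ≤ f (e (4 * t')) := by
      rcases Nat.eq_or_lt_of_le (show 4 * t + 4 ≤ 4 * t' by omega) with h' | h'
      · rw [h']
      · exact (hef _ _ h' (by omega)).le
    linarith
  have hone : ∀ t t', t < t' → t' < n → ¬ k ≤ c * (V t).card → k ≤ c * (V t').card := by
    intro t t' htt ht' hbad
    by_contra hbad'
    obtain ⟨hd1, hd2, ⟨u, hu, hu1, hu2⟩, ⟨u', hu', hu1', hu2'⟩⟩ := hV t (by omega) hbad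
    obtain ⟨-, -, ⟨w, hw, hw1, hw2⟩, ⟨w', hw', hw1', hw2'⟩⟩ := hV t' ht' hbad'
    rw [hm₁] at hu1 hu2' hw1 hw2'
    rw [hm₂] at hu2 hu1' hw2 hw1'
    exact false_of_straddling hd1.2 hd2.2 hu1 hu2 hu1' hu2' hw1 hw2 hw1' hw2'
      (hmono t t' htt ht' u hu w' hw') (hmono t t' htt ht' u' hu' w hw)
  have hdisj : (↑(Finset.range n) : Set ℕ).PairwiseDisjoint V := by
    intro t ht t' ht' hne
    simp only [Finset.coe_range, Set.mem_Iio] at ht ht'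
    refine Finset.disjoint_left.2 fun u hu hu' => ?_
    have hu := (Finset.mem_filter.1 hu).1
    have hu' := (Finset.mem_filter.1 hu').1
    rcases lt_or_gt_of_ne hne with h' | h'
    · exact lt_irrefl _ (hmono t t' h' ht' u hu u hu')
    · exact lt_irrefl _ (hmono t' t h' ht u hu' u hu)
  have hsum : ∑ t ∈ Finset.range n, (V t).card ≤
      (S.filter fun u => m₁ u ≤ γ ∧ m₂ u ≤ δ).card := by
    rw [← Finset.card_biUnion fun t ht t' ht' hne => hdisj (by simpa using ht) (by simpa using ht') hne]
    refine Finset.card_le_card fun u hu => ?_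
    simp only [Finset.mem_biUnion, Finset.mem_range, V, Finset.mem_filter] at hu ⊢
    obtain ⟨t, ht, hu, hu'⟩ := hu
    exact ⟨((hU _ (hsub (heH _ (by omega))) u).1 hu).1, hu'⟩
  have hcount : (n - 1) * k ≤ c * ∑ t ∈ Finset.range n, (V t).card := by
    rw [Finset.mul_sum]
    by_cases hall : ∀ t < n, k ≤ c * (V t).card
    · calc (n - 1) * k ≤ n * k := Nat.mul_le_mul_right _ (by omega)
        _ = ∑ t ∈ Finset.range n, k := by simp
        _ ≤ _ := Finset.sum_le_sum fun t ht => hall t (by simpa using ht)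
    · push Not at hall
      obtain ⟨t₀, ht₀, hbad⟩ := hall
      calc (n - 1) * k = ∑ t ∈ (Finset.range n).erase t₀, k := by
            rw [Finset.sum_const, Finset.card_erase_of_mem (by simpa using ht₀)]; simp
        _ ≤ ∑ t ∈ (Finset.range n).erase t₀, c * (V t).card := by
            refine Finset.sum_le_sum fun t ht => ?_
            simp only [Finset.mem_erase, Finset.mem_range] at ht
            rcases lt_or_gt_of_ne ht.1 with h' | h'
            · by_contra hb
              exact absurd (hone t t₀ h' ht₀ hb) (not_le.2 hbad)
            · exact hone t₀ t h' ht.2 (not_le.2 hbad)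
        _ ≤ _ := Finset.sum_le_sum_of_subset (Finset.erase_subset _ _)
  have hMn : M ≤ 4 * (n - 1) + 8 := by omega
  calc k * M ≤ k * (4 * (n - 1) + 8) := Nat.mul_le_mul_left _ hMn
    _ = 4 * ((n - 1) * k) + 8 * k := by ring
    _ ≤ 4 * (c * (S.filter fun u => m₁ u ≤ γ ∧ m₂ u ≤ δ).card) + 8 * k := by
        have := hcount.trans (Nat.mul_le_mul_left c hsum)
        omega
    _ = _ := by ring

/-- A finite set `Q` of points with indices below `N`, distributed over cells, and the coordinates `f`
and `g` that define wedges `f ≤ f₀`, `g ≤ g₀`. The other data are the parameters of the selection of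
points: a wedge is heavy if it has at least `k / c₁` points of one cell; `dirs` are the functionals that
decrease in both coordinates, for which a selected point must have `k / c₂` points below it. -/
structure WedgeSystem (ι : Type*) where
  N : ℕ
  Q : Finset ℕ
  cell : ℕ → ℕ
  f : ℕ → ℝ
  g : ℕ → ℝ
  dirs : Finset ι
  m : ι → ℕ → ℝ
  k : ℕ
  c₁ : ℕ
  c₂ : ℕ

namespace WedgeSystem

variable {ι : Type*} (A : WedgeSystem ι)

/-- The points of `Q` in the cell of `a` that lie in the wedge bounded by `a` in the first and by `b` in
the second coordinate. -/
noncomputable def wedge (a b : ℕ) : Finset ℕ :=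
  A.Q.filter fun u => A.cell u = A.cell a ∧ A.f u ≤ A.f a ∧ A.g u ≤ A.g b

/-- The wedge has at least `k / c₁` points. -/
def Heavy (a b : ℕ) : Prop := A.k ≤ A.c₁ * (A.wedge a b).card

/-- The wedge is minimal with respect to inclusion among the heavy ones. -/
def MinHeavy (a b : ℕ) : Prop :=
  A.Heavy a b ∧ ∀ a' < A.N, ∀ b' < A.N, A.Heavy a' b' → A.wedge a' b' ⊆ A.wedge a b →
    A.wedge a b ⊆ A.wedge a' b'

/-- No point of `Q` in the cell of `p` is strictly below `p` in the product order. -/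
def Pareto (p : ℕ) : Prop :=
  ∀ q ∈ A.Q, A.cell q = A.cell p → A.f q ≤ A.f p → A.g q ≤ A.g p → A.f p ≤ A.f q ∧ A.g p ≤ A.g q

/-- At least `k / c₂` points of the wedge are not above `p`, for each functional in `dirs`. -/
def Supported (a b p : ℕ) : Prop :=
  ∀ i ∈ A.dirs, A.k ≤ A.c₂ * ((A.wedge a b).filter fun u => A.m i u ≤ A.m i p).card

/-- `p` may be selected on account of the wedge given by `a` and `b`. -/
def CandidateFor (a b p : ℕ) : Prop :=
  A.MinHeavy a b ∧ p ∈ A.wedge a b ∧ A.Pareto p ∧ A.Supported a b p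

/-- `p` may be selected on account of some wedge. -/
def Candidate (p : ℕ) : Prop := ∃ a < A.N, ∃ b < A.N, A.CandidateFor a b p

/-- A hitting set for the heavy wedges that consists of candidates and is minimal: each of its points
is the only one in some minimal heavy wedge. -/
structure IsSparseHitting (H : Finset ℕ) : Prop where
  candidate : ∀ p ∈ H, A.Candidate p
  hit : ∀ a < A.N, ∀ b < A.N, A.MinHeavy a b → ∃ p ∈ H, p ∈ A.wedge a b
  isolated : ∀ p ∈ H, ∃ a < A.N, ∃ b < A.N, A.MinHeavy a b ∧ p ∈ A.wedge a b ∧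
    ∀ q ∈ H, q ∈ A.wedge a b → q = p

variable {A}

theorem mem_wedge {a b u : ℕ} :
    u ∈ A.wedge a b ↔ u ∈ A.Q ∧ A.cell u = A.cell a ∧ A.f u ≤ A.f a ∧ A.g u ≤ A.g b := by
  simp [wedge]

theorem exists_pareto_below {p : ℕ} (hp : p ∈ A.Q) :
    ∃ q ∈ A.Q, A.cell q = A.cell p ∧ A.f q ≤ A.f p ∧ A.g q ≤ A.g p ∧ A.Pareto q := by
  obtain ⟨q, hq, hmin⟩ := Finset.exists_min_image
    (A.Q.filter fun u => A.cell u = A.cell p ∧ A.f u ≤ A.f p ∧ A.g u ≤ A.g p)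
    (fun u => A.f u + A.g u) ⟨p, by simp [hp]⟩
  simp only [Finset.mem_filter] at hq hmin
  refine ⟨q, hq.1, hq.2.1, hq.2.2.1, hq.2.2.2, fun u hu hc hf hg => ?_⟩
  have := hmin u ⟨hu, hc.trans hq.2.1, hf.trans hq.2.2.1, hg.trans hq.2.2.2⟩
  constructor <;> linarith

/-- Few points of a wedge lack support in a given direction, so that a heavy wedge has a point with
support in all directions; going down to a Pareto-minimal point keeps the support. -/
theorem exists_candidateFor (hk : 0 < A.k) (hc : A.dirs.card * A.c₁ < A.c₂)
    (hdirs : ∀ i ∈ A.dirs, ∃ l r : ℝ, l < 0 ∧ r < 0 ∧ ∀ u, A.m i u = l * A.f u + r * A.g u)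
    {a b : ℕ} (h : A.MinHeavy a b) : ∃ p, A.CandidateFor a b p := by
  classical
  set v := A.wedge a b with hv
  have hheavy : A.k ≤ A.c₁ * v.card := h.1
  let X : ι → Finset ℕ := fun i =>
    v.filter fun p => A.c₂ * (v.filter fun u => A.m i u ≤ A.m i p).card < A.k
  have hX : ∀ i, A.c₂ * (X i).card ≤ A.k := by
    intro i
    rcases (X i).eq_empty_or_nonempty with h0 | hne
    · simp [h0]
    · obtain ⟨p, hp, hmax⟩ := Finset.exists_max_image (X i) (A.m i) hne
      refine le_trans (Nat.mul_le_mul_left _ (Finset.card_le_card fun u hu => ?_))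
        (Finset.mem_filter.1 hp).2.le
      exact Finset.mem_filter.2 ⟨(Finset.mem_filter.1 hu).1, hmax u hu⟩
  have hex : ∃ p ∈ v, ∀ i ∈ A.dirs, p ∉ X i := by
    by_contra! hall
    have hsub : v ⊆ A.dirs.biUnion X := fun p hp => by
      obtain ⟨i, hi, hpi⟩ := hall p hp
      exact Finset.mem_biUnion.2 ⟨i, hi, hpi⟩
    have h1 : A.c₂ * v.card ≤ A.dirs.card * A.k := by
      calc A.c₂ * v.card ≤ A.c₂ * ∑ i ∈ A.dirs, (X i).card :=
            Nat.mul_le_mul_left _ ((Finset.card_le_card hsub).trans Finset.card_biUnion_le)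
        _ = ∑ i ∈ A.dirs, A.c₂ * (X i).card := Finset.mul_sum _ _ _
        _ ≤ ∑ i ∈ A.dirs, A.k := Finset.sum_le_sum fun i _ => hX i
        _ = _ := by simp
    have h2 : A.dirs.card * A.k ≤ A.dirs.card * A.c₁ * v.card := by
      rw [mul_assoc]; exact Nat.mul_le_mul_left _ hheavy
    have h3 : 0 < v.card := by
      by_contra! h0
      have : v.card = 0 := by omega
      rw [this] at hheavy; omega
    have h4 := Nat.mul_lt_mul_of_pos_right hc h3
    omega
  obtain ⟨p, hp, hpX⟩ := hex
  have hp' := mem_wedge.1 hp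
  obtain ⟨q, hq, hqc, hqf, hqg, hpar⟩ := exists_pareto_below hp'.1
  refine ⟨q, h, mem_wedge.2 ⟨hq, hqc.trans hp'.2.1, hqf.trans hp'.2.2.1, hqg.trans hp'.2.2.2⟩, hpar,
    fun i hi => ?_⟩
  have h1 : A.k ≤ A.c₂ * (v.filter fun u => A.m i u ≤ A.m i p).card := by
    by_contra! hlt
    exact hpX i hi (Finset.mem_filter.2 ⟨hp, hlt⟩)
  refine h1.trans (Nat.mul_le_mul_left _ (Finset.card_le_card fun u hu => ?_))
  obtain ⟨hu1, hu2⟩ := Finset.mem_filter.1 hu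
  refine Finset.mem_filter.2 ⟨hu1, hu2.trans ?_⟩
  obtain ⟨l, r, hl, hr, hm⟩ := hdirs i hi
  rw [hm, hm]
  nlinarith

theorem Heavy.exists_minHeavy {a b : ℕ} (ha : a < A.N) (hb : b < A.N) (h : A.Heavy a b) :
    ∃ a' < A.N, ∃ b' < A.N, A.MinHeavy a' b' ∧ A.wedge a' b' ⊆ A.wedge a b := by
  classical
  obtain ⟨⟨a', b'⟩, hmem, hmin⟩ := Finset.exists_min_image
    ((Finset.range A.N ×ˢ Finset.range A.N).filter fun x : ℕ × ℕ =>
      A.Heavy x.1 x.2 ∧ A.wedge x.1 x.2 ⊆ A.wedge a b) (fun x => (A.wedge x.1 x.2).card)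
    ⟨(a, b), by simp [ha, hb, h]⟩
  simp only [Finset.mem_filter, Finset.mem_product, Finset.mem_range, Prod.forall] at hmem hmin
  refine ⟨a', hmem.1.1, b', hmem.1.2, ⟨hmem.2.1, fun a'' ha'' b'' hb'' hh hsub => ?_⟩, hmem.2.2⟩
  exact (Finset.eq_of_subset_of_card_le hsub
    (hmin a'' b'' ⟨⟨ha'', hb''⟩, hh, hsub.trans hmem.2.2⟩)).ge

/-- A sparse hitting set meets all wedges, with arbitrary bounds, that have at least `k / c₁` points. -/
theorem IsSparseHitting.exists_mem {H : Finset ℕ} (hH : A.IsSparseHitting H)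
    (hQ : ∀ u ∈ A.Q, u < A.N) (hk : 0 < A.k) (o : ℕ) (f₀ g₀ : ℝ)
    (hV : A.k ≤ A.c₁ * (A.Q.filter fun u => A.cell u = o ∧ A.f u ≤ f₀ ∧ A.g u ≤ g₀).card) :
    ∃ p ∈ H, A.cell p = o ∧ A.f p ≤ f₀ ∧ A.g p ≤ g₀ := by
  set V := A.Q.filter fun u => A.cell u = o ∧ A.f u ≤ f₀ ∧ A.g u ≤ g₀ with hVdef
  have hne : V.Nonempty := by
    rw [← Finset.card_pos]
    by_contra! h0
    have : V.card = 0 := by omega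
    rw [this] at hV; omega
  obtain ⟨a, ha, hamax⟩ := Finset.exists_max_image V A.f hne
  obtain ⟨b, hb, hbmax⟩ := Finset.exists_max_image V A.g hne
  have hW : A.wedge a b = V := by
    have ha' := (Finset.mem_filter.1 ha).2
    have hb' := (Finset.mem_filter.1 hb).2
    ext u
    rw [mem_wedge]
    constructor
    · rintro ⟨h1, h2, h3, h4⟩
      exact Finset.mem_filter.2 ⟨h1, h2.trans ha'.1, h3.trans ha'.2.1, h4.trans hb'.2.2⟩
    · intro hu
      obtain ⟨h1, h2, -⟩ := Finset.mem_filter.1 hu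
      exact ⟨h1, h2.trans ha'.1.symm, hamax u hu, hbmax u hu⟩
  have hheavy : A.Heavy a b := by rw [Heavy, hW]; exact hV
  obtain ⟨a', ha', b', hb', hmin, hsub⟩ := hheavy.exists_minHeavy
    (hQ a (Finset.mem_filter.1 ha).1) (hQ b (Finset.mem_filter.1 hb).1)
  obtain ⟨p, hp, hpw⟩ := hH.hit a' ha' b' hb' hmin
  have hpV := hsub hpw
  rw [hW] at hpV
  exact ⟨p, hp, (Finset.mem_filter.1 hpV).2⟩

theorem IsSparseHitting.isStaircase {H : Finset ℕ} (hH : A.IsSparseHitting H) (o : ℕ) :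
    IsStaircase (A.Q.filter fun u => A.cell u = o) (H.filter fun u => A.cell u = o) A.f A.g where
  subset p hp := by
    obtain ⟨hp, ho⟩ := Finset.mem_filter.1 hp
    obtain ⟨a, -, b, -, -, hw, -⟩ := hH.candidate p hp
    exact Finset.mem_filter.2 ⟨(mem_wedge.1 hw).1, ho⟩
  pareto p hp u hu hf hg := by
    obtain ⟨hp, ho⟩ := Finset.mem_filter.1 hp
    obtain ⟨hu, hu'⟩ := Finset.mem_filter.1 hu
    obtain ⟨a, -, b, -, -, -, hpar, -⟩ := hH.candidate p hp
    exact hpar u hu (hu'.trans ho.symm) hf hg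
  inj p hp q hq hpq := by
    -- points with equal `f` are equal points of the plane, so that wedges do not separate them
    obtain ⟨hp, hpo⟩ := Finset.mem_filter.1 hp
    obtain ⟨hq, hqo⟩ := Finset.mem_filter.1 hq
    obtain ⟨a, -, b, -, -, hpw, hpp, -⟩ := hH.candidate p hp
    obtain ⟨a', -, b', -, -, hqw, hqp, -⟩ := hH.candidate q hq
    have hpQ := (mem_wedge.1 hpw).1
    have hqQ := (mem_wedge.1 hqw).1
    have hg : A.g p = A.g q := by
      rcases le_total (A.g p) (A.g q) with h | h
      · exact le_antisymm h (hqp p hpQ (hpo.trans hqo.symm) hpq.le h).2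
      · exact le_antisymm (hpp q hqQ (hqo.trans hpo.symm) hpq.ge h).2 h
    obtain ⟨a₁, -, b₁, -, -, hw, hiso⟩ := hH.isolated p hp
    obtain ⟨-, h2, h3, h4⟩ := mem_wedge.1 hw
    exact (hiso q hq (mem_wedge.2 ⟨hqQ, (hqo.trans hpo.symm).trans h2, hpq ▸ h3, hg ▸ h4⟩)).symm

/-- A minimal heavy wedge contains at most two points of a sparse hitting set: of three points, the
middle one is isolated by a heavy wedge, which is contained in the given one and smaller. -/
theorem IsSparseHitting.not_three {H : Finset ℕ} (hH : A.IsSparseHitting H) {a b : ℕ}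
    (hab : A.MinHeavy a b) {p q r : ℕ} (hp : p ∈ H) (hq : q ∈ H) (hr : r ∈ H)
    (hpw : p ∈ A.wedge a b) (hqw : q ∈ A.wedge a b) (hrw : r ∈ A.wedge a b)
    (hpq : A.f p < A.f q) (hqr : A.f q < A.f r) : False := by
  obtain ⟨a', ha', b', hb', hmin, hqw', hiso⟩ := hH.isolated q hq
  have hst := hH.isStaircase (A.cell q)
  obtain ⟨hpQ, hpc, hpf, hpg⟩ := mem_wedge.1 hpw
  obtain ⟨hqQ, hqc, hqf, hqg⟩ := mem_wedge.1 hqw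
  obtain ⟨hrQ, hrc, hrf, hrg⟩ := mem_wedge.1 hrw
  obtain ⟨-, hqc', hqf', hqg'⟩ := mem_wedge.1 hqw'
  have hpH : p ∈ H.filter fun u => A.cell u = A.cell q := by simp [hp, hpc, hqc]
  have hqH : q ∈ H.filter fun u => A.cell u = A.cell q := by simp [hq]
  have hrH : r ∈ H.filter fun u => A.cell u = A.cell q := by simp [hr, hrc, hqc]
  have hg2 := hst.anti hqH hrH hqr
  have hpn : p ∉ A.wedge a' b' := fun h => by rw [hiso p hp h] at hpq; exact lt_irrefl _ hpq
  have hrn : r ∉ A.wedge a' b' := fun h => by rw [hiso r hr h] at hqr; exact lt_irrefl _ hqr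
  have hgp : A.g b' < A.g p := by
    by_contra! h
    exact hpn (mem_wedge.2 ⟨hpQ, by rw [hpc, ← hqc, hqc'], by linarith, h⟩)
  have hfr : A.f a' < A.f r := by
    by_contra! h
    exact hrn (mem_wedge.2 ⟨hrQ, by rw [hrc, ← hqc, hqc'], h, by linarith⟩)
  refine hpn (hab.2 a' ha' b' hb' hmin.1 (fun u hu => ?_) hpw)
  obtain ⟨h1, h2, h3, h4⟩ := mem_wedge.1 hu
  exact mem_wedge.2 ⟨h1, by rw [h2, ← hqc', hqc], by linarith, by linarith⟩

/-- A sparse hitting set contains few points of a wedge of any type, compared with the number of points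
in that wedge. -/
theorem IsSparseHitting.card_le {H : Finset ℕ} (hH : A.IsSparseHitting H) (hc : A.c₁ ≤ A.c₂)
    {i₁ i₂ : ι} {l₁ r₁ l₂ r₂ : ℝ}
    (hm₁ : ∀ u, A.m i₁ u = l₁ * A.f u + r₁ * A.g u) (hm₂ : ∀ u, A.m i₂ u = l₂ * A.f u + r₂ * A.g u)
    (h₁ : ¬ (0 < l₁ ∧ 0 < r₁)) (h₂ : ¬ (0 < l₂ ∧ 0 < r₂))
    (hd₁ : l₁ < 0 → r₁ < 0 → i₁ ∈ A.dirs) (hd₂ : l₂ < 0 → r₂ < 0 → i₂ ∈ A.dirs)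
    (o : ℕ) (γ δ : ℝ) :
    A.k * (H.filter fun u => A.cell u = o ∧ A.m i₁ u ≤ γ ∧ A.m i₂ u ≤ δ).card ≤
      4 * A.c₂ * (A.Q.filter fun u => A.cell u = o ∧ A.m i₁ u ≤ γ ∧ A.m i₂ u ≤ δ).card +
        8 * A.k := by
  classical
  have hcand : ∀ p, ∃ a b : ℕ, p ∈ H → A.CandidateFor a b p := by
    intro p
    by_cases hp : p ∈ H
    · obtain ⟨a, -, b, -, h⟩ := hH.candidate p hp
      exact ⟨a, b, fun _ => h⟩
    · exact ⟨0, 0, fun h => absurd h hp⟩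
  choose a b hab using hcand
  have key := card_hitting_inter_wedge_le (γ := γ) (δ := δ) (k := A.k) (c := A.c₂)
    (hH.isStaircase o) hm₁ hm₂ h₁ h₂ (fun p => A.wedge (a p) (b p))
    (fun p => A.f (a p)) (fun p => A.g (b p))
    (fun p hp u => by
      obtain ⟨hp, hpo⟩ := Finset.mem_filter.1 hp
      have := (mem_wedge.1 (hab p hp).2.1).2.1
      rw [mem_wedge, Finset.mem_filter, ← this, hpo]; tauto)
    (fun p hp => (hab p (Finset.mem_filter.1 hp).1).2.1)
    (fun o ho p hp q hq r hr => hH.not_three (hab o (Finset.mem_filter.1 ho).1).1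
      (Finset.mem_filter.1 hp).1 (Finset.mem_filter.1 hq).1 (Finset.mem_filter.1 hr).1)
    (fun p hp => (hab p (Finset.mem_filter.1 hp).1).1.1.trans (Nat.mul_le_mul_right _ hc))
    (fun p hp hl hr => (hab p (Finset.mem_filter.1 hp).1).2.2.2 i₁ (hd₁ hl hr))
    (fun p hp hl hr => (hab p (Finset.mem_filter.1 hp).1).2.2.2 i₂ (hd₂ hl hr))
  simpa only [Finset.filter_filter] using key

end WedgeSystem

/-! ### The local structure of a convex polygon -/

section Polygon

/-- The Euclidean plane. -/
abbrev EuclideanPlane := EuclideanSpace ℝ (Fin 2)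

/-- The linear form that vanishes on the direction from `v l.1` to `v l.2`. If `l` is an edge in
clockwise orientation, the form attains its minimum over the polygon on this edge. -/
def edgeForm {n : ℕ} (v : Fin n → EuclideanPlane) (l : Fin n × Fin n) (u : EuclideanPlane) : ℝ :=
  (v l.2 1 - v l.1 1) * u 0 - (v l.2 0 - v l.1 0) * u 1

/-- The determinant of the edge forms of `l` and `l'`. -/
def edgeDet {n : ℕ} (v : Fin n → EuclideanPlane) (l l' : Fin n × Fin n) : ℝ :=
  (v l.2 0 - v l.1 0) * (v l'.2 1 - v l'.1 1) - (v l.2 1 - v l.1 1) * (v l'.2 0 - v l'.1 0)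

/-- The pair of points `v l.1`, `v l.2` spans an edge, in clockwise orientation. -/
def IsEdge {n : ℕ} (v : Fin n → EuclideanPlane) (l : Fin n × Fin n) : Prop :=
  l.1 ≠ l.2 ∧ ∀ w, edgeForm v l (v l.1) ≤ edgeForm v l (v w)

/-- The two edges meet, in a vertex of the polygon, and are not parallel. -/
def IsPolygonCorner {n : ℕ} (P : Set EuclideanPlane) (v : Fin n → EuclideanPlane)
    (t : (Fin n × Fin n) × (Fin n × Fin n)) : Prop :=
  IsEdge v t.1 ∧ IsEdge v t.2 ∧ edgeDet v t.1 t.2 ≠ 0 ∧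
    ∃ z ∈ P, edgeForm v t.1 z = edgeForm v t.1 (v t.1.1) ∧ edgeForm v t.2 z = edgeForm v t.2 (v t.2.1)

variable {n : ℕ} {v : Fin n → EuclideanPlane} {P : Set EuclideanPlane}

theorem edgeForm_sub (v : Fin n → EuclideanPlane) (l : Fin n × Fin n) (u w : EuclideanPlane) :
    edgeForm v l (u - w) = edgeForm v l u - edgeForm v l w := by
  simp [edgeForm]; ring

theorem edgeForm_snd (v : Fin n → EuclideanPlane) (l : Fin n × Fin n) :
    edgeForm v l (v l.2) = edgeForm v l (v l.1) := by
  simp [edgeForm]; ring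

theorem continuous_edgeForm (v : Fin n → EuclideanPlane) (l : Fin n × Fin n) :
    Continuous (edgeForm v l) := by
  unfold edgeForm; fun_prop

theorem IsConvexPolygon.isCompact (hP : IsConvexPolygon P) : IsCompact P := by
  obtain ⟨⟨S, rfl⟩, -⟩ := hP
  exact S.finite_toSet.isCompact_convexHull ℝ

theorem IsConvexPolygon.eq_convexHull (hP : IsConvexPolygon P) (hv : IsVertexList P v) :
    P = convexHull ℝ (Set.range v) := by
  have hc : Convex ℝ P := by
    obtain ⟨⟨S, rfl⟩, -⟩ := hP
    exact convex_convexHull ℝ _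
  have h := closure_convexHull_extremePoints hP.isCompact hc
  rw [← hv.2, ((Set.finite_range v).isClosed_convexHull ℝ).closure_eq] at h
  exact h.symm

theorem mem_of_isVertexList (hv : IsVertexList P v) (w : Fin n) : v w ∈ P := by
  have : v w ∈ P.extremePoints ℝ := hv.2 ▸ Set.mem_range_self w
  exact this.1

theorem lt_of_mem_interior {p q β : ℝ} (h : p ≠ 0 ∨ q ≠ 0) (hβ : ∀ u ∈ P, β ≤ p * u 0 + q * u 1)
    {o : EuclideanPlane} (ho : o ∈ interior P) : β < p * o 0 + q * o 1 := by
  have hc : Continuous fun t : ℝ => o - t • (!₂[p, q] : EuclideanPlane) := by fun_prop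
  have h0 : (fun t : ℝ => o - t • (!₂[p, q] : EuclideanPlane)) ⁻¹' interior P ∈ nhds (0 : ℝ) :=
    (isOpen_interior.preimage hc).mem_nhds (by simpa using ho)
  obtain ⟨ε, hε, hball⟩ := Metric.mem_nhds_iff.1 h0
  have hmem := interior_subset (hball (show ε / 2 ∈ Metric.ball (0 : ℝ) ε by
    simp only [Metric.mem_ball, dist_zero_right, Real.norm_eq_abs]; rw [abs_of_pos] <;> linarith))
  have := hβ _ hmem
  simp at this
  have hpos : 0 < p ^ 2 + q ^ 2 := by
    rcases h with h | h
    · have := pow_pos (abs_pos.2 h) 2; rw [sq_abs] at this; nlinarith [sq_nonneg q]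
    · have := pow_pos (abs_pos.2 h) 2; rw [sq_abs] at this; nlinarith [sq_nonneg p]
  nlinarith [mul_pos (half_pos hε) hpos]

theorem IsEdge.le (hP : P = convexHull ℝ (Set.range v)) {l : Fin n × Fin n} (hl : IsEdge v l)
    {u : EuclideanPlane} (hu : u ∈ P) : edgeForm v l (v l.1) ≤ edgeForm v l u := by
  have hlin : IsLinearMap ℝ (edgeForm v l) :=
    ⟨fun x y => by simp [edgeForm]; ring, fun c x => by simp [edgeForm]; ring⟩
  rw [hP] at hu
  refine convexHull_min (t := {u | edgeForm v l (v l.1) ≤ edgeForm v l u}) ?_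
    (convex_halfSpace_ge hlin _) hu
  rintro _ ⟨w, rfl⟩
  exact hl.2 w

theorem IsEdge.lt_of_mem_interior (hP : P = convexHull ℝ (Set.range v)) (hinj : Function.Injective v)
    {l : Fin n × Fin n} (hl : IsEdge v l) {o : EuclideanPlane} (ho : o ∈ interior P) :
    edgeForm v l (v l.1) < edgeForm v l o := by
  have hne : v l.2 1 - v l.1 1 ≠ 0 ∨ -(v l.2 0 - v l.1 0) ≠ 0 := by
    by_contra! h
    refine hl.1 (hinj ?_)
    ext i; fin_cases i
    · have := h.2; simp only [Fin.zero_eta]; linarith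
    · have := h.1; simp only [Fin.mk_one]; linarith
  have := _root_.lt_of_mem_interior (β := edgeForm v l (v l.1)) hne (fun u hu => by
    have := hl.le hP hu; simp only [edgeForm] at this ⊢; linarith) ho
  simp only [edgeForm] at this ⊢; linarith

/-- Among finitely many vectors in an open half plane there is one such that no other vector is on
its left. -/
theorem exists_extreme_direction {ι : Type*} (s : Finset ι) (hs : s.Nonempty) (x y : ι → ℝ) (α β : ℝ)
    (h : ∀ i ∈ s, 0 < α * x i + β * y i) : ∃ i ∈ s, ∀ j ∈ s, 0 ≤ x j * y i - y j * x i := by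
  obtain ⟨i, hi, hmax⟩ := Finset.exists_max_image s
    (fun i => (-β * x i + α * y i) / (α * x i + β * y i)) hs
  refine ⟨i, hi, fun j hj => ?_⟩
  have h1 := hmax j hj
  rw [div_le_div_iff₀ (h j hj) (h i hi)] at h1
  have h2 : 0 ≤ (α ^ 2 + β ^ 2) * (x j * y i - y j * x i) := by nlinarith
  have h3 : 0 < α ^ 2 + β ^ 2 := by
    by_contra! h0
    have ha : α = 0 := by nlinarith [sq_nonneg α, sq_nonneg β]
    have hb : β = 0 := by nlinarith [sq_nonneg α, sq_nonneg β]
    have := h i hi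
    simp [ha, hb] at this
  exact nonneg_of_mul_nonneg_right h2 h3

theorem clm_apply_eq (f : EuclideanPlane →L[ℝ] ℝ) :
    ∃ α β : ℝ, ∀ z : EuclideanPlane, f z = α * z 0 + β * z 1 := by
  refine ⟨f (EuclideanSpace.single 0 1), f (EuclideanSpace.single 1 1), fun z => ?_⟩
  have hz : z = z 0 • EuclideanSpace.single (0 : Fin 2) (1 : ℝ) +
      z 1 • EuclideanSpace.single (1 : Fin 2) (1 : ℝ) := by
    ext i; fin_cases i <;> simp
  conv_lhs => rw [hz]
  simp [mul_comm]

/-- At each vertex there are two non-parallel edges. -/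
theorem exists_edges_at_vertex (hP : P = convexHull ℝ (Set.range v)) (hint : (interior P).Nonempty)
    (hv : IsVertexList P v) (w : Fin n) :
    ∃ q q' : Fin n, IsEdge v (w, q) ∧ IsEdge v (q', w) ∧ edgeDet v (w, q) (q', w) ≠ 0 := by
  classical
  obtain ⟨o, ho⟩ := hint
  have hconv : Convex ℝ P := hP ▸ convex_convexHull ℝ _
  have hw : v w ∈ P.extremePoints ℝ := hv.2 ▸ Set.mem_range_self w
  rw [hconv.mem_extremePoints_iff_mem_sdiff_convexHull_sdiff] at hw
  have hw' : v w ∉ convexHull ℝ (Set.range v \ {v w}) := fun h =>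
    hw.2 (convexHull_mono (Set.sdiff_subset_sdiff_left (hP ▸ subset_convexHull ℝ _)) h)
  obtain ⟨f, c, hfc, hcf⟩ := geometric_hahn_banach_point_closed (convex_convexHull ℝ _)
    (((Set.finite_range v).subset Set.sdiff_subset).isClosed_convexHull ℝ) hw'
  obtain ⟨α, β, hf⟩ := clm_apply_eq f
  let s : Finset (Fin n) := Finset.univ.erase w
  have hφ : ∀ q ∈ s, 0 < α * (v q 0 - v w 0) + β * (v q 1 - v w 1) := by
    intro q hq
    have hq' : q ≠ w := by simpa [s] using hq
    have := hcf (v q) (subset_convexHull ℝ _ ⟨Set.mem_range_self q, fun h => hq' (hv.1 h)⟩)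
    rw [hf] at this hfc
    linarith
  have hs : s.Nonempty := by
    by_contra hs
    rw [Finset.not_nonempty_iff_eq_empty] at hs
    have hall : ∀ u ∈ P, u = v w := by
      intro u hu
      have hr : Set.range v ⊆ {v w} := by
        rintro _ ⟨q, rfl⟩
        by_contra hq
        have : q ∈ s := by
          simp only [s, Finset.mem_erase, Finset.mem_univ, and_true]; rintro rfl; simp at hq
        simp [hs] at this
      rw [hP] at hu
      simpa using convexHull_mono hr hu
    have h1 := lt_of_mem_interior (p := 1) (q := 0) (β := v w 0) (by simp)
      (fun u hu => by rw [hall u hu]; simp) ho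
    rw [hall o (interior_subset ho)] at h1
    simp at h1
  obtain ⟨q, hq, hqmax⟩ := exists_extreme_direction s hs (fun i => v i 0 - v w 0)
    (fun i => v i 1 - v w 1) α β hφ
  obtain ⟨q', hq', hqmin⟩ := exists_extreme_direction s hs (fun i => v i 1 - v w 1)
    (fun i => v i 0 - v w 0) β α (fun i hi => by linarith [hφ i hi])
  have he : IsEdge v (w, q) := by
    refine ⟨fun h => (Finset.mem_erase.1 hq).1 h.symm, fun j => ?_⟩
    by_cases hj : j = w
    · rw [hj]
    · have := hqmax j (by simp [s, hj])
      simp only [edgeForm]; linarith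
  have he' : IsEdge v (q', w) := by
    refine ⟨(Finset.mem_erase.1 hq').1, fun j => ?_⟩
    by_cases hj : j = w
    · rw [hj]; exact (edgeForm_snd v (q', w)).ge
    · have := hqmin j (by simp [s, hj])
      simp only [edgeForm]; linarith
  refine ⟨q, q', he, he', fun hdet => ?_⟩
  have h1 := he.lt_of_mem_interior hP hv.1 ho
  have h2 := he'.lt_of_mem_interior hP hv.1 ho
  have hq1 := hφ q hq
  have hq2 := hφ q' hq'
  simp only [edgeForm, edgeDet] at h1 h2 hdet
  -- parallel edge forms at `v w` would have opposite signs
  set a := v q 0 - v w 0 with ha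
  set b := v q 1 - v w 1 with hb
  set a' := v q' 0 - v w 0 with ha'
  set b' := v q' 1 - v w 1 with hb'
  have e1 : 0 < (o 0 - v w 0) * b - (o 1 - v w 1) * a := by linarith
  have e2 : (o 0 - v w 0) * b' - (o 1 - v w 1) * a' < 0 := by linarith
  have e3 : a * b' = b * a' := by linarith
  have e4 : (α * a + β * b) * ((o 0 - v w 0) * b' - (o 1 - v w 1) * a') =
      (α * a' + β * b') * ((o 0 - v w 0) * b - (o 1 - v w 1) * a) := by
    linear_combination (α * (o 0 - v w 0) + β * (o 1 - v w 1)) * e3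
  nlinarith [mul_pos hq2 e1, mul_neg_of_pos_of_neg hq1 e2]

theorem IsEdge.isPolygonCorner_of_vertex (hP : P = convexHull ℝ (Set.range v))
    {l l' : Fin n × Fin n} (hl : IsEdge v l) (hl' : IsEdge v l') (hd : edgeDet v l l' ≠ 0)
    {w : Fin n} (h : edgeForm v l (v w) = edgeForm v l (v l.1))
    (h' : edgeForm v l' (v w) = edgeForm v l' (v l'.1)) : IsPolygonCorner P v (l, l') :=
  ⟨hl, hl', hd, v w, hP ▸ subset_convexHull ℝ _ (Set.mem_range_self w), h, h'⟩

/-- Every edge is part of a corner. -/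
theorem IsEdge.exists_isPolygonCorner (hP : P = convexHull ℝ (Set.range v))
    (hint : (interior P).Nonempty) (hv : IsVertexList P v) {l : Fin n × Fin n} (hl : IsEdge v l) :
    ∃ l', IsPolygonCorner P v (l, l') := by
  obtain ⟨q, q', he, he', hd⟩ := exists_edges_at_vertex hP hint hv l.1
  by_cases h : edgeDet v l (l.1, q) = 0
  · by_cases h' : edgeDet v l (q', l.1) = 0
    · exfalso
      simp only [edgeDet] at h h' hd
      obtain ⟨o, ho⟩ := hint
      have hne := hl.lt_of_mem_interior hP hv.1 ho
      simp only [edgeForm] at hne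
      apply hd
      set a := v l.2 0 - v l.1 0
      set b := v l.2 1 - v l.1 1
      set c := v q 0 - v l.1 0
      set d := v q 1 - v l.1 1
      set c' := v l.1 0 - v q' 0
      set d' := v l.1 1 - v q' 1
      have hab : a ≠ 0 ∨ b ≠ 0 := by
        by_contra! h0
        rw [h0.1, h0.2] at hne
        simp at hne
      rcases hab with ha | hb
      · exact mul_left_cancel₀ ha (by linear_combination c * h' - c' * h)
      · exact mul_left_cancel₀ hb (by linear_combination d * h' - d' * h)
    · exact ⟨_, hl.isPolygonCorner_of_vertex hP he' h' (w := l.1) rfl (edgeForm_snd v (q', l.1))⟩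
  · exact ⟨_, hl.isPolygonCorner_of_vertex hP he h (w := l.1) rfl rfl⟩

theorem edgeForm_cramer {l₁ l₂ : Fin n × Fin n} (hd : edgeDet v l₁ l₂ ≠ 0) (l : Fin n × Fin n)
    (u : EuclideanPlane) : edgeForm v l u = edgeDet v l l₂ / edgeDet v l₁ l₂ * edgeForm v l₁ u +
      edgeDet v l₁ l / edgeDet v l₁ l₂ * edgeForm v l₂ u := by
  field_simp
  simp only [edgeForm, edgeDet]; ring

/-- No edge form is a positive combination of the two edge forms of a corner, since it would attain its
minimum over the polygon only at that corner. -/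
theorem IsPolygonCorner.not_pos (hP : P = convexHull ℝ (Set.range v)) (hinj : Function.Injective v)
    {l₁ l₂ : Fin n × Fin n} (ht : IsPolygonCorner P v (l₁, l₂)) {l : Fin n × Fin n} (hl : IsEdge v l)
    {a b : ℝ} (hab : ∀ u, edgeForm v l u = a * edgeForm v l₁ u + b * edgeForm v l₂ u) :
    ¬ (0 < a ∧ 0 < b) := by
  rintro ⟨ha, hb⟩
  obtain ⟨h1, h2, hd, z, hz, hz1, hz2⟩ := ht
  simp only at h1 h2 hd hz1 hz2
  have hmem : ∀ w, v w ∈ P := fun w => hP ▸ subset_convexHull ℝ _ (Set.mem_range_self w)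
  have hzl := hl.le hP hz
  have key : ∀ w, edgeForm v l (v w) = edgeForm v l (v l.1) →
      edgeForm v l₁ (v w) = edgeForm v l₁ z ∧ edgeForm v l₂ (v w) = edgeForm v l₂ z := by
    intro w hw
    have e1 := h1.le hP (hmem w)
    have e2 := h2.le hP (hmem w)
    rw [← hw, hab, hab] at hzl
    rw [← hz1] at e1
    rw [← hz2] at e2
    constructor <;> nlinarith [mul_nonneg ha.le (sub_nonneg.2 e1), mul_nonneg hb.le (sub_nonneg.2 e2)]
  obtain ⟨a1, a2⟩ := key l.1 rfl
  obtain ⟨b1, b2⟩ := key l.2 (edgeForm_snd v l)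
  have c1 : edgeForm v l₁ (v l.1 - v l.2) = 0 := by rw [edgeForm_sub]; linarith
  have c2 : edgeForm v l₂ (v l.1 - v l.2) = 0 := by rw [edgeForm_sub]; linarith
  refine hl.1 (hinj ?_)
  simp only [edgeForm, PiLp.sub_apply] at c1 c2
  simp only [edgeDet] at hd
  ext i; fin_cases i
  · refine sub_eq_zero.1 (mul_left_cancel₀ hd ?_)
    simp only [Fin.zero_eta]
    linear_combination (v l₁.2 0 - v l₁.1 0) * c2 - (v l₂.2 0 - v l₂.1 0) * c1
  · refine sub_eq_zero.1 (mul_left_cancel₀ hd ?_)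
    simp only [Fin.mk_one]
    linear_combination (v l₁.2 1 - v l₁.1 1) * c2 - (v l₂.2 1 - v l₂.1 1) * c1

/-- The polygon is the intersection of the half planes given by its edges: the two edges at a vertex
that maximizes a separating functional already exclude a point outside of the polygon. -/
theorem mem_of_forall_isEdge (hP : P = convexHull ℝ (Set.range v)) (hint : (interior P).Nonempty)
    (hv : IsVertexList P v) {u : EuclideanPlane}
    (hu : ∀ l, IsEdge v l → edgeForm v l (v l.1) ≤ edgeForm v l u) :
    u ∈ P := by
  by_contra hn
  have hcl : IsClosed P := hP ▸ (Set.finite_range v).isClosed_convexHull ℝ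
  have hconv : Convex ℝ P := hP ▸ convex_convexHull ℝ _
  obtain ⟨f, c, hfc, hcf⟩ := geometric_hahn_banach_closed_point hconv hcl hn
  obtain ⟨α, β, hf⟩ := clm_apply_eq f
  obtain ⟨o, ho⟩ := hint
  have hne : Nonempty (Fin n) := by
    by_contra h
    rw [not_nonempty_iff] at h
    have := interior_subset ho
    rw [hP, Set.range_eq_empty] at this
    simp at this
  obtain ⟨w, -, hw⟩ := Finset.exists_max_image Finset.univ (fun w => f (v w)) Finset.univ_nonempty
  obtain ⟨q, q', he, he', hd⟩ := exists_edges_at_vertex hP ⟨o, ho⟩ hv w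
  have h1 := hu _ he
  have h2 := hu _ he'
  have h3 := he'.2 q
  have f0 := hfc (v w) (mem_of_isVertexList hv w)
  have f1 := hw q (Finset.mem_univ _)
  have f2 := hw q' (Finset.mem_univ _)
  simp only [hf] at f0 f1 f2 hcf
  simp only [edgeForm, edgeDet] at h1 h2 h3 hd
  -- `u - v w` is a nonnegative combination of the directions of the two edges
  set a := v q 0 - v w 0 with ha
  set b := v q 1 - v w 1 with hb
  set a' := v w 0 - v q' 0 with ha'
  set b' := v w 1 - v q' 1 with hb'
  have e1 : 0 ≤ (u 0 - v w 0) * b - (u 1 - v w 1) * a := by linarith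
  have e2 : 0 ≤ (u 0 - v w 0) * b' - (u 1 - v w 1) * a' := by linarith
  have e3 : 0 < a * b' - b * a' := lt_of_le_of_ne (by linarith) (Ne.symm hd)
  have e4 : (a * b' - b * a') * (α * (u 0 - v w 0) + β * (u 1 - v w 1)) =
      ((u 0 - v w 0) * b' - (u 1 - v w 1) * a') * (α * a + β * b) -
      ((u 0 - v w 0) * b - (u 1 - v w 1) * a) * (α * a' + β * b') := by ring
  have e5 : α * a + β * b ≤ 0 := by linarith
  have e6 : 0 ≤ α * a' + β * b' := by linarith
  have e7 : 0 < α * (u 0 - v w 0) + β * (u 1 - v w 1) := by linarith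
  nlinarith [mul_pos e3 e7, mul_nonneg e1 e6, mul_nonneg e2 (neg_nonneg.2 e5)]

/-- At each point `z` of the polygon, the edges containing it impose no more constraints than a suitable
corner. -/
theorem exists_isPolygonCorner_active (hP : P = convexHull ℝ (Set.range v))
    (hint : (interior P).Nonempty) (hv : IsVertexList P v) {z : EuclideanPlane} (hz : z ∈ P) : ∃ t, IsPolygonCorner P v t ∧ ∀ u,
      edgeForm v t.1 (v t.1.1) ≤ edgeForm v t.1 u → edgeForm v t.2 (v t.2.1) ≤ edgeForm v t.2 u →
      ∀ l, IsEdge v l → edgeForm v l z = edgeForm v l (v l.1) →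
        edgeForm v l (v l.1) ≤ edgeForm v l u := by
  obtain ⟨o, ho⟩ := id hint
  by_cases h : ∃ l₁ l₂, IsEdge v l₁ ∧ IsEdge v l₂ ∧ edgeForm v l₁ z = edgeForm v l₁ (v l₁.1) ∧
    edgeForm v l₂ z = edgeForm v l₂ (v l₂.1) ∧ edgeDet v l₁ l₂ ≠ 0
  · obtain ⟨l₁, l₂, h1, h2, a1, a2, hd⟩ := h
    have ht : IsPolygonCorner P v (l₁, l₂) := ⟨h1, h2, hd, z, hz, a1, a2⟩
    refine ⟨(l₁, l₂), ht, fun u hu1 hu2 l hl hlz => ?_⟩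
    simp only at hu1 hu2
    have o1 := h1.lt_of_mem_interior hP hv.1 ho
    have o2 := h2.lt_of_mem_interior hP hv.1 ho
    have ol := hl.lt_of_mem_interior hP hv.1 ho
    have hc := edgeForm_cramer hd l
    set x := edgeDet v l l₂ / edgeDet v l₁ l₂ with hx
    set y := edgeDet v l₁ l / edgeDet v l₁ l₂ with hy
    have n0 := ht.not_pos hP hv.1 hl hc
    have n1 : ¬ (0 < x ∧ y < 0) := by
      rintro ⟨hx0, hy0⟩
      have hd' : edgeDet v l l₂ ≠ 0 := fun h0 => by simp [hx, h0] at hx0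
      have ht' : IsPolygonCorner P v (l, l₂) := ⟨hl, h2, hd', z, hz, hlz, a2⟩
      refine ht'.not_pos hP hv.1 h1 (a := 1 / x) (b := -y / x) (fun u => ?_)
        ⟨by positivity, div_pos (by linarith) hx0⟩
      rw [hc u]; field_simp; ring
    have n2 : ¬ (x < 0 ∧ 0 < y) := by
      rintro ⟨hx0, hy0⟩
      have hd' : edgeDet v l₁ l ≠ 0 := fun h0 => by simp [hy, h0] at hy0
      have ht' : IsPolygonCorner P v (l₁, l) := ⟨h1, hl, hd', z, hz, a1, hlz⟩
      refine ht'.not_pos hP hv.1 h2 (a := -x / y) (b := 1 / y) (fun u => ?_)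
        ⟨div_pos (by linarith) hy0, by positivity⟩
      rw [hc u]; field_simp; ring
    rw [← hlz, hc z, hc o, a1, a2] at ol
    rw [← hlz, hc z, hc u, a1, a2]
    have hxy : 0 ≤ x ∧ 0 ≤ y := by
      by_contra! hxy
      rcases lt_or_ge x 0 with hx0 | hx0
      · have : y ≤ 0 := by by_contra! hy0; exact n2 ⟨hx0, hy0⟩
        nlinarith
      · have hy0 := hxy hx0
        have : x ≤ 0 := by by_contra! hx1; exact n1 ⟨hx1, hy0⟩
        nlinarith
    nlinarith [hxy.1, hxy.2]
  · push Not at h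
    by_cases ha : ∃ l₁, IsEdge v l₁ ∧ edgeForm v l₁ z = edgeForm v l₁ (v l₁.1)
    · obtain ⟨l₁, h1, a1⟩ := ha
      obtain ⟨l₂, ht⟩ := h1.exists_isPolygonCorner hP hint hv
      refine ⟨(l₁, l₂), ht, fun u hu1 _ l hl hlz => ?_⟩
      simp only at hu1
      have hd := h l₁ l h1 hl a1 hlz
      have o1 := h1.lt_of_mem_interior hP hv.1 ho
      have ol := hl.lt_of_mem_interior hP hv.1 ho
      rw [← hlz] at ol ⊢
      rw [← a1] at o1 hu1
      -- parallel forms are proportional, with a positive factor as seen at the interior point `o`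
      have e : (edgeForm v l o - edgeForm v l z) * (edgeForm v l₁ u - edgeForm v l₁ z) =
          (edgeForm v l₁ o - edgeForm v l₁ z) * (edgeForm v l u - edgeForm v l z) := by
        simp only [edgeForm]
        simp only [edgeDet] at hd
        linear_combination ((o 1 - z 1) * (u 0 - z 0) - (o 0 - z 0) * (u 1 - z 1)) * hd
      by_contra! hlt
      nlinarith [mul_nonneg (sub_nonneg.2 ol.le) (sub_nonneg.2 hu1),
        mul_pos (sub_pos.2 o1) (sub_pos.2 hlt)]
    · push Not at ha
      have hne : Nonempty (Fin n) := by
        by_contra h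
        rw [not_nonempty_iff] at h
        rw [hP, Set.range_eq_empty] at hz
        simp at hz
      obtain ⟨q, q', he, -⟩ := exists_edges_at_vertex hP hint hv hne.some
      obtain ⟨l', ht⟩ := he.exists_isPolygonCorner hP hint hv
      exact ⟨_, ht, fun u _ _ l hl hlz => absurd hlz (ha l hl)⟩

/-- A polygon looks like one of its corners on every set of small diameter that it meets. -/
theorem exists_local_corner (hP : P = convexHull ℝ (Set.range v)) (hint : (interior P).Nonempty)
    (hv : IsVertexList P v) (hcomp : IsCompact P) : ∃ ε > 0, ∀ T : Set EuclideanPlane,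
      (∀ u ∈ T, ∀ u' ∈ T, dist u u' < ε) → (∃ u ∈ T, u ∈ P) → ∃ t, IsPolygonCorner P v t ∧ ∀ u ∈ T,
        (u ∈ P ↔ edgeForm v t.1 (v t.1.1) ≤ edgeForm v t.1 u ∧
          edgeForm v t.2 (v t.2.1) ≤ edgeForm v t.2 u) := by
  let c : P → Set EuclideanPlane := fun z => {u |
    ∀ l, IsEdge v l → edgeForm v l z ≠ edgeForm v l (v l.1) →
    edgeForm v l (v l.1) < edgeForm v l u}
  have hc : ∀ z, IsOpen (c z) := by
    intro z
    simp only [c, Set.ofPred_forall]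
    refine isOpen_iInter_of_finite fun l => isOpen_iInter_of_finite fun _ =>
      isOpen_iInter_of_finite fun _ => isOpen_lt continuous_const (continuous_edgeForm v l)
  obtain ⟨ε, hε, hleb⟩ := lebesgue_number_lemma_of_metric hcomp hc (fun z hz =>
    Set.mem_iUnion.2 ⟨⟨z, hz⟩, fun l hl hne => lt_of_le_of_ne (hl.le hP hz) (Ne.symm hne)⟩)
  refine ⟨ε, hε, fun T hT ⟨w, hwT, hwP⟩ => ?_⟩
  obtain ⟨z, hz⟩ := hleb w hwP
  obtain ⟨t, ht, hact⟩ := exists_isPolygonCorner_active hP hint hv z.2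
  refine ⟨t, ht, fun u hu => ⟨fun huP => ⟨ht.1.le hP huP, ht.2.1.le hP huP⟩, fun hu' => ?_⟩⟩
  refine mem_of_forall_isEdge hP hint hv fun l hl => ?_
  by_cases hlz : edgeForm v l z = edgeForm v l (v l.1)
  · exact hact u hu'.1 hu'.2 l hl hlz
  · exact (hz (Metric.mem_ball.2 (hT u hu w hwT)) l hl hlz).le

end Polygon

/-! ### The algorithm -/

namespace RealRAM

/-- Entries `i < N` of arrays `2` and `3` of reals are the points `p`; the edge form of two vertices,
given by their positions in arrays `0` and `1`, at such a point. -/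
noncomputable def linForm (D : State) (l : ℕ × ℕ) (p : ℕ) : ℝ :=
  (D.real 1 l.2 - D.real 1 l.1) * D.real 2 p - (D.real 0 l.2 - D.real 0 l.1) * D.real 3 p

/-- Both coordinates of two points differ by less than `1 / M`. -/
def Near (M : ℕ) (D : State) (p q : ℕ) : Prop :=
  (M * (D.real 2 p - D.real 2 q) < 1 ∧ M * (D.real 2 q - D.real 2 p) < 1) ∧
    (M * (D.real 3 p - D.real 3 q) < 1 ∧ M * (D.real 3 q - D.real 3 p) < 1)

/-- `o` is marked (in array `3`) as the centre of a cell, and `p` is near to it. -/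
def NearCentre (M : ℕ) (D : State) (o p : ℕ) : Prop := D.nat 3 o = 1 ∧ Near M D o p

open Classical in
/-- The cell of `p` is the first centre near to `p`, or `N` if there is none. -/
noncomputable def cellOf (M : ℕ) (D : State) (p : ℕ) : ℕ :=
  Nat.find (p := fun o => D.nat 0 0 ≤ o ∨ NearCentre M D o p) ⟨D.nat 0 0, .inl le_rfl⟩

/-- Array `1` holds `0` for points without colour and the colour plus `1` for the others, and entry `0`
of array `8` the current colour. A point is available if it has no previous colour. Points that have the
current colour remain available, so that all corners processed in one round see the same points. -/
def Avail (D : State) (p : ℕ) : Prop := D.nat 1 p = 0 ∨ D.nat 1 p = D.nat 8 0 + 1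

open Classical in
/-- The available points, with the wedges of the corner `t` of the polygon. -/
noncomputable def wedgeSystem (M c₁ c₂ : ℕ) (t : (ℕ × ℕ) × (ℕ × ℕ)) (dirs : Finset (ℕ × ℕ))
    (D : State) : WedgeSystem (ℕ × ℕ) where
  N := D.nat 0 0
  Q := (Finset.range (D.nat 0 0)).filter (Avail D)
  cell := cellOf M D
  f := linForm D t.1
  g := linForm D t.2
  dirs := dirs
  m := linForm D
  k := D.nat 0 1
  c₁ := c₁
  c₂ := c₂

/-- The expression for `linForm`, with the number of the point in entry `i` of array `5`. -/
def linExpr (l : ℕ × ℕ) (i : ℕ) : RealExpr :=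
  .sub (.mul (.sub (.read 1 (.lit l.2)) (.read 1 (.lit l.1))) (.read 2 (.read 5 (.lit i))))
    (.mul (.sub (.read 0 (.lit l.2)) (.read 0 (.lit l.1))) (.read 3 (.read 5 (.lit i))))

theorem eval_linExpr {s D : State} (h : Agree s D) (l : ℕ × ℕ) (i : ℕ) :
    (linExpr l i).eval s = linForm D l (s.nat 5 i) := by
  simp [linExpr, RealExpr.eval, NatExpr.eval, linForm, h.real]

theorem polyDec_linForm_le (l : ℕ × ℕ) :
    PolyDec 2 (fun D x => linForm D l (x 0) ≤ linForm D l (x 1)) :=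
  .test (fun i => .not (.realLt (linExpr l (i 1)) (linExpr l (i 0)))) fun i s D h => by
    simp [Test.Holds, eval_linExpr h]

theorem polyDec_near_aux (M a : ℕ) :
    PolyDec 2 (fun D x => M * (D.real a (x 0) - D.real a (x 1)) < 1) :=
  .test (fun i => .realLt (.mul (.ofNat (.lit M)) (.sub (.read a (.read 5 (.lit (i 0))))
    (.read a (.read 5 (.lit (i 1)))))) (.ofNat (.lit 1))) fun i s D h => by
    simp [Test.Holds, RealExpr.eval, NatExpr.eval, h.real]

theorem polyDec_near (M : ℕ) : PolyDec 2 (fun D x => Near M D (x 0) (x 1)) :=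
  ((polyDec_near_aux M 2).and ((polyDec_near_aux M 2).subst ![1, 0])).and
    ((polyDec_near_aux M 3).and ((polyDec_near_aux M 3).subst ![1, 0]))

theorem polyDec_nat_eq {a : ℕ} (h5 : a ≠ 5) (h6 : a ≠ 6) (h7 : a ≠ 7) (z : ℕ) :
    PolyDec 1 (fun D x => D.nat a (x 0) = z) :=
  .test (fun i => .and (.not (.natLt (.read a (.read 5 (.lit (i 0)))) (.lit z)))
    (.not (.natLt (.lit z) (.read a (.read 5 (.lit (i 0))))))) fun i s D h => by
    simp [Test.Holds, NatExpr.eval, h.nat a h5 h6 h7]; omega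

theorem polyDec_lt : PolyDec 2 (fun _ x => x 0 < x 1) :=
  .test (fun i => .natLt (.read 5 (.lit (i 0))) (.read 5 (.lit (i 1)))) fun i s D h => by
    simp [Test.Holds, NatExpr.eval]

theorem polyDec_avail : PolyDec 1 (fun D x => Avail D (x 0)) :=
  (polyDec_nat_eq (by decide) (by decide) (by decide) 0).or
    (.test (fun i => .and
      (.not (.natLt (.read 1 (.read 5 (.lit (i 0)))) (.add (.read 8 (.lit 0)) (.lit 1))))
      (.not (.natLt (.add (.read 8 (.lit 0)) (.lit 1)) (.read 1 (.read 5 (.lit (i 0)))))))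
      fun i s D h => by
        simp [Test.Holds, NatExpr.eval, h.nat 1 (by decide) (by decide) (by decide),
          h.nat 8 (by decide) (by decide) (by decide)]; omega)

theorem polyDec_nearCentre (M : ℕ) : PolyDec 2 (fun D x => NearCentre M D (x 0) (x 1)) :=
  ((polyDec_nat_eq (a := 3) (by decide) (by decide) (by decide) 1).subst ![0]).and (polyDec_near M)

theorem cellOf_eq_iff {M : ℕ} {D : State} {o p : ℕ} (ho : o < D.nat 0 0) :
    cellOf M D p = o ↔ NearCentre M D o p ∧ ∀ o' < D.nat 0 0, o' < o → ¬ NearCentre M D o' p := by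
  classical
  rw [cellOf, Nat.find_eq_iff]
  constructor
  · rintro ⟨h1, h2⟩
    exact ⟨h1.resolve_left (by omega), fun o' _ ho' h => h2 o' ho' (.inr h)⟩
  · rintro ⟨h1, h2⟩
    refine ⟨.inr h1, fun o' ho' h => ?_⟩
    exact h2 o' (by omega) ho' (h.resolve_left (by omega))

theorem cellOf_le (M : ℕ) (D : State) (p : ℕ) : cellOf M D p ≤ D.nat 0 0 := by
  classical
  exact Nat.find_min' _ (.inl le_rfl)

theorem cellOf_eq_cellOf_iff {M : ℕ} {D : State} {p q : ℕ} :
    cellOf M D p = cellOf M D q ↔ ∀ o < D.nat 0 0, (cellOf M D p = o ↔ cellOf M D q = o) := by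
  refine ⟨fun h o _ => by rw [h], fun h => ?_⟩
  have hp := cellOf_le M D p
  have hq := cellOf_le M D q
  rcases hp.lt_or_eq with hp | hp
  · exact ((h _ hp).1 rfl).symm
  · rcases hq.lt_or_eq with hq | hq
    · exact (h _ hq).2 rfl
    · rw [hp, hq]

theorem polyDec_cellOf_eq (M : ℕ) :
    PolyDec 2 (fun D x => cellOf M D (x 0) = cellOf M D (x 1)) := by
  have h1 : PolyDec 2 (fun D x => NearCentre M D (x 0) (x 1) ∧
      ∀ o' < D.nat 0 0, o' < x 0 → ¬ NearCentre M D o' (x 1)) :=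
    (polyDec_nearCentre M).and (PolyDec.all (n := 2)
      (R := fun D x => x 0 < x 1 → ¬ NearCentre M D (x 0) (x 2))
      ((polyDec_lt.subst ![0, 1]).imp ((polyDec_nearCentre M).subst ![0, 2]).not))
  refine (PolyDec.all (n := 2) ((((h1.subst ![0, 1]).imp (h1.subst ![0, 2]))).and
    ((h1.subst ![0, 2]).imp (h1.subst ![0, 1])))).congr fun D x => ?_
  rw [cellOf_eq_cellOf_iff]
  refine forall₂_congr fun o ho => ?_
  rw [cellOf_eq_iff ho, cellOf_eq_iff ho]
  exact iff_iff_implies_and_implies.symm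

section

variable (M c₁ c₂ : ℕ) (t : (ℕ × ℕ) × (ℕ × ℕ)) (dirs : Finset (ℕ × ℕ))

theorem mem_wedgeSystem {D : State} {u : ℕ} :
    u ∈ (wedgeSystem M c₁ c₂ t dirs D).Q ↔ u < D.nat 0 0 ∧ Avail D u := by
  simp [wedgeSystem]

theorem polyDec_mem_wedge :
    PolyDec 3 (fun D x => x 2 ∈ (wedgeSystem M c₁ c₂ t dirs D).wedge (x 0) (x 1)) := by
  have hN : PolyDec 1 (fun D x => x 0 < D.nat 0 0) :=
    .test (fun i => .natLt (.read 5 (.lit (i 0))) (.read 0 (.lit 0))) fun i s D h => by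
      simp [Test.Holds, NatExpr.eval, h.size]
  refine (((hN.and polyDec_avail).subst ![2]).and (((polyDec_cellOf_eq M).subst ![2, 0]).and
    (((polyDec_linForm_le t.1).subst ![2, 0]).and
      ((polyDec_linForm_le t.2).subst ![2, 1])))).congr fun D x => ?_
  rw [WedgeSystem.mem_wedge, mem_wedgeSystem]
  rfl

theorem mem_wedge_lt {D : State} {a b u : ℕ}
    (hu : u ∈ (wedgeSystem M c₁ c₂ t dirs D).wedge a b) : u < D.nat 0 0 :=
  ((mem_wedgeSystem ..).1 (WedgeSystem.mem_wedge.1 hu).1).1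

theorem eval_threshold (s D : State) (h : Agree s D) :
    (NatExpr.read 0 (.lit 1)).eval s = D.nat 0 1 := by
  simp [NatExpr.eval, h.nat 0 (by decide) (by decide) (by decide)]

theorem polyDec_heavy : PolyDec 2 (fun D x => (wedgeSystem M c₁ c₂ t dirs D).Heavy (x 0) (x 1)) := by
  classical
  refine (((polyDec_mem_wedge M c₁ c₂ t dirs).subst ![1, 2, 0]).count c₁ (.read 0 (.lit 1)) _
    eval_threshold).congr fun D x => ?_
  have : (wedgeSystem M c₁ c₂ t dirs D).wedge (x 0) (x 1) = (Finset.range (D.nat 0 0)).filter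
      fun u => u ∈ (wedgeSystem M c₁ c₂ t dirs D).wedge (x 0) (x 1) := by
    ext u
    rw [Finset.mem_filter, Finset.mem_range]
    exact ⟨fun h => ⟨mem_wedge_lt _ _ _ _ _ h, h⟩, fun h => h.2⟩
  rw [WedgeSystem.Heavy, this]
  exact Iff.of_eq (by congr)

theorem polyDec_minHeavy :
    PolyDec 2 (fun D x => (wedgeSystem M c₁ c₂ t dirs D).MinHeavy (x 0) (x 1)) := by
  have hsub : PolyDec 4 (fun D x => (wedgeSystem M c₁ c₂ t dirs D).wedge (x 0) (x 1) ⊆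
      (wedgeSystem M c₁ c₂ t dirs D).wedge (x 2) (x 3)) :=
    (PolyDec.all (((polyDec_mem_wedge M c₁ c₂ t dirs).subst ![1, 2, 0]).imp
      ((polyDec_mem_wedge M c₁ c₂ t dirs).subst ![3, 4, 0]))).congr fun D x =>
        ⟨fun h u hu => h u (mem_wedge_lt _ _ _ _ _ hu) hu, fun h u _ hu => h hu⟩
  -- variables of the quantified statement: `b'`, `a'`, `a`, `b`
  exact (polyDec_heavy M c₁ c₂ t dirs).and (PolyDec.all (PolyDec.all
    (((polyDec_heavy M c₁ c₂ t dirs).subst ![1, 0]).imp ((hsub.subst ![1, 0, 2, 3]).imp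
      (hsub.subst ![2, 3, 1, 0])))))

theorem polyDec_pareto : PolyDec 1 (fun D x => (wedgeSystem M c₁ c₂ t dirs D).Pareto (x 0)) := by
  refine (PolyDec.all ((polyDec_avail.subst ![0]).imp (((polyDec_cellOf_eq M).subst ![0, 1]).imp
    (((polyDec_linForm_le t.1).subst ![0, 1]).imp (((polyDec_linForm_le t.2).subst ![0, 1]).imp
      (((polyDec_linForm_le t.1).subst ![1, 0]).and ((polyDec_linForm_le t.2).subst ![1, 0]))))))).congr
      fun D x => ?_
  constructor
  · intro h q hq
    rw [mem_wedgeSystem] at hq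
    exact h q hq.1 hq.2
  · intro h q hq hq'
    exact h q ((mem_wedgeSystem ..).2 ⟨hq, hq'⟩)

theorem polyDec_supported :
    PolyDec 3 (fun D x => (wedgeSystem M c₁ c₂ t dirs D).Supported (x 0) (x 1) (x 2)) := by
  classical
  refine (PolyDec.forall_mem_list dirs.toList fun i _ =>
    (((polyDec_mem_wedge M c₁ c₂ t dirs).subst ![1, 2, 0]).and
      ((polyDec_linForm_le i).subst ![0, 3])).count c₂
      (.read 0 (.lit 1)) _ eval_threshold).congr fun D x => ?_
  simp only [Finset.mem_toList]
  refine forall₂_congr fun i hi => ?_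
  have : ((wedgeSystem M c₁ c₂ t dirs D).wedge (x 0) (x 1)).filter
        (fun u => linForm D i u ≤ linForm D i (x 2)) =
      (Finset.range (D.nat 0 0)).filter fun u =>
        u ∈ (wedgeSystem M c₁ c₂ t dirs D).wedge (x 0) (x 1) ∧
          linForm D i u ≤ linForm D i (x 2) := by
    ext u
    rw [Finset.mem_filter, Finset.mem_filter, Finset.mem_range]
    exact ⟨fun h => ⟨mem_wedge_lt _ _ _ _ _ h.1, h⟩, fun h => h.2⟩
  have e : (wedgeSystem M c₁ c₂ t dirs D).m = linForm D := rfl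
  rw [e, this]
  exact Iff.of_eq (by congr)

theorem polyDec_candidate :
    PolyDec 1 (fun D x => (wedgeSystem M c₁ c₂ t dirs D).Candidate (x 0)) :=
  -- variables of the quantified statement: `b`, `a`, `p`
  PolyDec.ex (PolyDec.ex (((polyDec_minHeavy M c₁ c₂ t dirs).subst ![1, 0]).and
    (((polyDec_mem_wedge M c₁ c₂ t dirs).subst ![1, 0, 2]).and
      (((polyDec_pareto M c₁ c₂ t dirs).subst ![2]).and
        ((polyDec_supported M c₁ c₂ t dirs).subst ![1, 0, 2])))))

/-- Every minimal heavy wedge that contains `p` contains another point marked in array `4`. -/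
def Redundant (D : State) (p : ℕ) : Prop :=
  ∀ a < D.nat 0 0, ∀ b < D.nat 0 0, (wedgeSystem M c₁ c₂ t dirs D).MinHeavy a b →
    p ∈ (wedgeSystem M c₁ c₂ t dirs D).wedge a b → ∃ u < D.nat 0 0,
      (u < p ∨ p < u) ∧ u ∈ (wedgeSystem M c₁ c₂ t dirs D).wedge a b ∧ D.nat 4 u = 1

theorem polyDec_redundant :
    PolyDec 1 (fun D x => Redundant M c₁ c₂ t dirs D (x 0)) :=
  -- variables of the innermost statement: `u`, `b`, `a`, `p`
  PolyDec.all (PolyDec.all (((polyDec_minHeavy M c₁ c₂ t dirs).subst ![1, 0]).imp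
    (((polyDec_mem_wedge M c₁ c₂ t dirs).subst ![1, 0, 2]).imp (PolyDec.ex
      (((polyDec_lt.subst ![0, 3]).or (polyDec_lt.subst ![3, 0])).and
        (((polyDec_mem_wedge M c₁ c₂ t dirs).subst ![2, 1, 0]).and
          ((polyDec_nat_eq (a := 4) (by decide) (by decide) (by decide) 1).subst ![0])))))))

/-- Mark all candidates in array `4`. -/
noncomputable def markCandidates (D : State) : State :=
  assign 4 (fun D x => (wedgeSystem M c₁ c₂ t dirs D).Candidate (x 0)) (fun _ _ => 1)
    (assign 4 (fun _ _ => True) (fun _ _ => 0) D)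

/-- Remove the marks of redundant points, one after the other. -/
noncomputable def pruneMarks : State → State :=
  assign 4 (fun D x => Redundant M c₁ c₂ t dirs D (x 0)) (fun _ _ => 0)

/-- Give the current colour to all marked points. -/
noncomputable def colourMarked : State → State :=
  assign 1 (fun D x => D.nat 4 (x 0) = 1) (fun D _ => D.nat 8 0 + 1)

/-- Select points that hit the heavy wedges of the corner `t`, and give them the current colour. -/
noncomputable def hitCorner (D : State) : State :=
  colourMarked (pruneMarks M c₁ c₂ t dirs (markCandidates M c₁ c₂ t dirs D))

theorem assign_nat_of_ne {a b : ℕ} (h : b ≠ a) (R : State → (Fin 1 → ℕ) → Prop)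
    (val : State → ℕ → ℕ) (D : State) : (assign a R val D).nat b = D.nat b :=
  assignUpTo_nat_of_ne h ..

theorem polyComputes_hitCorner : PolyComputes (hitCorner M c₁ c₂ t dirs) := by
  have h0 : ∀ (a : ℕ) (R : State → (Fin 1 → ℕ) → Prop) (val : State → ℕ → ℕ) (D : State), a ≠ 0 →
    (assign a R val D).nat 0 = D.nat 0 := fun a R val D ha => assign_nat_of_ne ha.symm R val D
  have h1 : PolyComputes (markCandidates M c₁ c₂ t dirs) :=
    (polyComputes_assign (by decide) (by decide) (polyDec_candidate M c₁ c₂ t dirs) (.lit 1) _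
      fun _ _ _ => rfl).comp (polyComputes_assign (by decide) (by decide) .true (.lit 0) _
        fun _ _ _ => rfl) fun D => h0 _ _ _ _ (by decide)
  have h2 : PolyComputes (pruneMarks M c₁ c₂ t dirs) :=
    polyComputes_assign (by decide) (by decide) (polyDec_redundant M c₁ c₂ t dirs) (.lit 0) _
      fun _ _ _ => rfl
  have h3 : PolyComputes colourMarked :=
    polyComputes_assign (by decide) (by decide)
      (polyDec_nat_eq (by decide) (by decide) (by decide) 1) (.add (.read 8 (.lit 0)) (.lit 1)) _
      fun s D h => by simp [NatExpr.eval, h.nat 8 (by decide) (by decide) (by decide)]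
  exact h3.comp (h2.comp h1 fun D => by simp [markCandidates, h0]) fun D => by
    simp [pruneMarks, markCandidates, h0]

end

/-- Mark centres of cells in array `3`: go through all points and select those that are not near to a
point selected before. -/
noncomputable def markCentres (M : ℕ) : State → State :=
  assign 3 (fun D x => ¬ ∃ q < D.nat 0 0, q < x 0 ∧ NearCentre M D q (x 0)) (fun _ _ => 1)

theorem polyComputes_markCentres (M : ℕ) : PolyComputes (markCentres M) :=
  polyComputes_assign (by decide) (by decide) (PolyDec.not (PolyDec.ex (n := 1)
    ((polyDec_lt.subst ![0, 1]).and ((polyDec_nearCentre M).subst ![0, 1])))) (.lit 1) _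
    fun _ _ _ => rfl

/-- The colours themselves in array `1`, with colour `0` for the remaining points. -/
noncomputable def finish : State → State := assign 1 (fun _ _ => True) (fun D z => D.nat 1 z - 1)

theorem polyComputes_finish : PolyComputes finish :=
  polyComputes_assign (by decide) (by decide) .true (.sub (.read 1 (.read 5 (.lit 0))) (.lit 1)) _
    fun s D h => by simp [NatExpr.eval, h.nat 1 (by decide) (by decide) (by decide)]

/-- Entry `0` of array `8` counts the rounds. -/
noncomputable def nextRound (D : State) : State := D.setNat 8 0 (D.nat 8 0 + 1)

theorem polyComputes_nextRound : PolyComputes nextRound :=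
  ⟨.setNat 8 (.lit 0) (.add (.read 8 (.lit 0)) (.lit 1)), .C 6, fun s D h =>
    ⟨_, _, .setNat _ _ _ _, by simp [NatExpr.cost], by
      have : (s.nat 8) 0 = D.nat 8 0 := by rw [h.nat 8 (by decide) (by decide) (by decide)]
      simpa [NatExpr.eval, nextRound, this] using h.set_data 8 0 (D.nat 8 0 + 1)⟩⟩

end RealRAM

/-! ### Correctness of the rounds -/

namespace RealRAM

theorem assign_real (a : ℕ) (R : State → (Fin 1 → ℕ) → Prop) (val : State → ℕ → ℕ) (D : State) :
    (assign a R val D).real = D.real := assignUpTo_real ..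

/-- Assignments that depend on the old value of the entry in question, but not on other entries of the
same array, can be described as if they were made simultaneously. -/
theorem assign_nat_same {a : ℕ} {R : State → (Fin 1 → ℕ) → Prop} {val : State → ℕ → ℕ} {D : State}
    {z : ℕ} (hz : z < D.nat 0 0) (h : ∀ D' : State, D'.real = D.real → (∀ b ≠ a, D'.nat b = D.nat b) →
      D'.nat a z = D.nat a z → (R D' ![z] ↔ R D ![z]) ∧ val D' z = val D z) :
    (R D ![z] → (assign a R val D).nat a z = val D z) ∧
      (¬ R D ![z] → (assign a R val D).nat a z = D.nat a z) := by
  have key : ∀ m, (m ≤ z → (assignUpTo a R val m D).nat a z = D.nat a z) ∧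
      (z < m → (R D ![z] → (assignUpTo a R val m D).nat a z = val D z) ∧
        (¬ R D ![z] → (assignUpTo a R val m D).nat a z = D.nat a z)) := by
    intro m
    induction m with
    | zero => exact ⟨fun _ => rfl, fun h => absurd h (Nat.not_lt_zero _)⟩
    | succ m ih =>
      simp only [assignUpTo]
      rcases lt_trichotomy m z with hm | rfl | hm
      · refine ⟨fun _ => ?_, fun h => by omega⟩
        split_ifs
        · rw [setNat_nat_of_ne_right _ (by omega), ih.1 hm.le]
        · exact ih.1 hm.le
      · obtain ⟨h1, h2⟩ := h _ (assignUpTo_real a R val m D)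
          (fun b hb => assignUpTo_nat_of_ne hb R val m D) (ih.1 le_rfl)
        refine ⟨fun h => by omega, fun _ => ⟨fun hR => ?_, fun hR => ?_⟩⟩
        · rw [if_pos (h1.2 hR), setNat_nat_same, h2]
        · rw [if_neg (fun h => hR (h1.1 h)), ih.1 le_rfl]
      · refine ⟨fun h => by omega, fun _ => ?_⟩
        have : (assignUpTo a R val (m + 1) D).nat a z = (assignUpTo a R val m D).nat a z := by
          simp only [assignUpTo]
          split_ifs
          · rw [setNat_nat_of_ne_right _ (by omega)]
          · rfl
        have e := ih.2 hm
        simp only [assignUpTo] at this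
        rw [this]
        exact e
  exact (key _).2 hz

theorem assignUpTo_induction {a : ℕ} {R : State → (Fin 1 → ℕ) → Prop} {val : State → ℕ → ℕ}
    (I : ℕ → State → Prop) {D : State} (h0 : I 0 D) (N : ℕ)
    (hpos : ∀ z < N, ∀ D', I z D' → R D' ![z] → I (z + 1) (D'.setNat a z (val D' z)))
    (hneg : ∀ z < N, ∀ D', I z D' → ¬ R D' ![z] → I (z + 1) D') : I N (assignUpTo a R val N D) := by
  have key : ∀ m ≤ N, I m (assignUpTo a R val m D) := by
    intro m
    induction m with
    | zero => exact fun _ => h0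
    | succ m ih =>
      intro hm
      simp only [assignUpTo]
      split_ifs with h
      · exact hpos m hm _ (ih (by omega)) h
      · exact hneg m hm _ (ih (by omega)) h
  exact key N le_rfl

theorem linForm_congr {D D' : State} (h : D'.real = D.real) : linForm D' = linForm D := by
  funext l p; simp [linForm, h]

theorem nearCentre_congr {D D' : State} (h : D'.real = D.real) (h3 : D'.nat 3 = D.nat 3) (M : ℕ) :
    NearCentre M D' = NearCentre M D := by
  funext o p; simp [NearCentre, Near, h, h3]

theorem cellOf_congr {D D' : State} (h : D'.real = D.real) (h3 : D'.nat 3 = D.nat 3)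
    (h0 : D'.nat 0 = D.nat 0) (M : ℕ) : cellOf M D' = cellOf M D := by
  classical
  funext p
  exact Nat.find_congr' (by intro o; rw [nearCentre_congr h h3, h0])

theorem wedgeSystem_congr {D D' : State} (h : D'.real = D.real) (h0 : D'.nat 0 = D.nat 0)
    (h3 : D'.nat 3 = D.nat 3) (ha : ∀ p < D.nat 0 0, (Avail D' p ↔ Avail D p)) (M c₁ c₂ : ℕ)
    (t : (ℕ × ℕ) × (ℕ × ℕ)) (dirs : Finset (ℕ × ℕ)) :
    wedgeSystem M c₁ c₂ t dirs D' = wedgeSystem M c₁ c₂ t dirs D := by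
  classical
  have : (Finset.range (D.nat 0 0)).filter (Avail D') = (Finset.range (D.nat 0 0)).filter (Avail D) :=
    Finset.filter_congr fun p hp => ha p (Finset.mem_range.1 hp)
  simp only [wedgeSystem, linForm_congr h, cellOf_congr h h3 h0, h0]
  congr

theorem pruneMarks_spec (M c₁ c₂ : ℕ) (t : (ℕ × ℕ) × (ℕ × ℕ)) (dirs : Finset (ℕ × ℕ)) {D : State}
    (hcand : ∀ p < D.nat 0 0, D.nat 4 p = 1 ↔ (wedgeSystem M c₁ c₂ t dirs D).Candidate p)
    (hex : ∀ a b, (wedgeSystem M c₁ c₂ t dirs D).MinHeavy a b →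
      ∃ p, (wedgeSystem M c₁ c₂ t dirs D).CandidateFor a b p) :
    (wedgeSystem M c₁ c₂ t dirs D).IsSparseHitting
      ((Finset.range (D.nat 0 0)).filter fun p => (pruneMarks M c₁ c₂ t dirs D).nat 4 p = 1) := by
  set A := wedgeSystem M c₁ c₂ t dirs D with hA
  let I : ℕ → State → Prop := fun z D' => D'.real = D.real ∧ (∀ b ≠ 4, D'.nat b = D.nat b) ∧
    (∀ p < D.nat 0 0, D'.nat 4 p = 1 → A.Candidate p) ∧
    (∀ a < D.nat 0 0, ∀ b < D.nat 0 0, A.MinHeavy a b →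
      ∃ p < D.nat 0 0, D'.nat 4 p = 1 ∧ p ∈ A.wedge a b) ∧
    (∀ p < z, p < D.nat 0 0 → D'.nat 4 p = 1 → ∃ a < D.nat 0 0, ∃ b < D.nat 0 0, A.MinHeavy a b ∧
      p ∈ A.wedge a b ∧ ∀ q < D.nat 0 0, D'.nat 4 q = 1 → q ∈ A.wedge a b → q = p)
  have hsys : ∀ z D', I z D' → wedgeSystem M c₁ c₂ t dirs D' = A ∧ D'.nat 0 0 = D.nat 0 0 := by
    intro z D' h
    refine ⟨wedgeSystem_congr h.1 (h.2.1 _ (by decide)) (h.2.1 _ (by decide)) (fun p _ => ?_) ..,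
      by rw [h.2.1 _ (by decide)]⟩
    rw [Avail, Avail, h.2.1 1 (by decide), h.2.1 8 (by decide)]
  have key := assignUpTo_induction (a := 4)
    (R := fun D x => Redundant M c₁ c₂ t dirs D (x 0)) (val := fun _ _ => 0) I (D := D)
    ⟨rfl, fun _ _ => rfl, fun p hp h => (hcand p hp).1 h, fun a ha b hb hab => by
      obtain ⟨p, hp⟩ := hex a b hab
      have hpN := mem_wedge_lt _ _ _ _ _ hp.2.1
      exact ⟨p, hpN, (hcand p hpN).2 ⟨a, ha, b, hb, hp⟩, hp.2.1⟩,
      fun p hp => absurd hp (Nat.not_lt_zero p)⟩ (D.nat 0 0)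
    (fun z _ D' h hred => by
      obtain ⟨hA', hN⟩ := hsys z D' h
      obtain ⟨i1, i2, i3, i4, i5⟩ := h
      have hold : ∀ p, (D'.setNat 4 z 0).nat 4 p = 1 → p ≠ z ∧ D'.nat 4 p = 1 := by
        intro p hp
        by_cases hpz : p = z
        · subst hpz; simp at hp
        · rw [setNat_nat_of_ne_right _ hpz] at hp; exact ⟨hpz, hp⟩
      refine ⟨i1, fun b hb => ?_, fun p hp hp1 => i3 p hp (hold p hp1).2, fun a ha b hb hab => ?_,
        fun p hpz hp hp1 => ?_⟩
      · funext j; rw [setNat_nat_of_ne_left _ hb, i2 b hb]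
      · obtain ⟨p, hp, hp1, hpw⟩ := i4 a ha b hb hab
        by_cases hpz : p = z
        · subst hpz
          obtain ⟨u, hu, hne, huw, hu1⟩ := hred a (hN ▸ ha) b (hN ▸ hb) (hA' ▸ hab) (hA' ▸ hpw)
          rw [hA'] at huw
          have hne : u ≠ p := by simp at hne; omega
          exact ⟨u, hN ▸ hu, by rw [setNat_nat_of_ne_right _ hne]; exact hu1, huw⟩
        · exact ⟨p, hp, by rw [setNat_nat_of_ne_right _ hpz]; exact hp1, hpw⟩
      · obtain ⟨hne, hp1⟩ := hold p hp1
        obtain ⟨a, ha, b, hb, hab, hpw, hiso⟩ := i5 p (by omega) hp hp1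
        exact ⟨a, ha, b, hb, hab, hpw, fun q hq hq1 => hiso q hq (hold q hq1).2⟩)
    (fun z _ D' h hred => by
      obtain ⟨hA', hN⟩ := hsys z D' h
      obtain ⟨i1, i2, i3, i4, i5⟩ := h
      refine ⟨i1, i2, i3, i4, fun p hpz hp hp1 => ?_⟩
      by_cases hpz' : p = z
      · subst hpz'
        simp only [Redundant] at hred
        push Not at hred
        obtain ⟨a, ha, b, hb, hab, hpw, hiso⟩ := hred
        rw [hN] at ha hb
        rw [hA'] at hab hpw
        refine ⟨a, ha, b, hb, hab, hpw, fun q hq hq1 hqw => ?_⟩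
        by_contra hne
        exact hiso q (hN ▸ hq) (by simp; omega) (hA' ▸ hqw) hq1
      · exact i5 p (by omega) hp hp1)
  obtain ⟨-, -, i3, i4, i5⟩ := key
  change ∀ p < D.nat 0 0, (pruneMarks M c₁ c₂ t dirs D).nat 4 p = 1 → _ at i3
  refine ⟨fun p hp => ?_, fun a ha b hb hab => ?_, fun p hp => ?_⟩
  · simp only [Finset.mem_filter, Finset.mem_range] at hp
    exact i3 p hp.1 hp.2
  · obtain ⟨p, hp, hp1, hpw⟩ := i4 a ha b hb hab
    exact ⟨p, by simp only [Finset.mem_filter, Finset.mem_range]; exact ⟨hp, hp1⟩, hpw⟩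
  · simp only [Finset.mem_filter, Finset.mem_range] at hp
    obtain ⟨a, ha, b, hb, hab, hpw, hiso⟩ := i5 p hp.1 hp.1 hp.2
    refine ⟨a, ha, b, hb, hab, hpw, fun q hq => ?_⟩
    simp only [Finset.mem_filter, Finset.mem_range] at hq
    exact hiso q hq.1 hq.2

/-- Processing one corner gives the current colour to the points of a sparse hitting set. -/
theorem hitCorner_spec (M c₁ c₂ : ℕ) (t : (ℕ × ℕ) × (ℕ × ℕ)) (dirs : Finset (ℕ × ℕ)) {D : State}
    (hk : 0 < D.nat 0 1) (hc : dirs.card * c₁ < c₂)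
    (hdirs : ∀ i ∈ dirs, ∃ l r : ℝ, l < 0 ∧ r < 0 ∧
      ∀ u, linForm D i u = l * linForm D t.1 u + r * linForm D t.2 u) :
    (hitCorner M c₁ c₂ t dirs D).real = D.real ∧
    (∀ b, b ≠ 1 → b ≠ 4 → (hitCorner M c₁ c₂ t dirs D).nat b = D.nat b) ∧
    ∃ H : Finset ℕ, (∀ p ∈ H, p < D.nat 0 0) ∧ (wedgeSystem M c₁ c₂ t dirs D).IsSparseHitting H ∧
      ∀ p < D.nat 0 0, (p ∈ H → (hitCorner M c₁ c₂ t dirs D).nat 1 p = D.nat 8 0 + 1) ∧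
        (p ∉ H → (hitCorner M c₁ c₂ t dirs D).nat 1 p = D.nat 1 p) := by
  set D₀ := assign 4 (fun _ _ => True) (fun _ _ => 0) D with hD₀
  set D₁ := markCandidates M c₁ c₂ t dirs D with hD₁
  set D₂ := pruneMarks M c₁ c₂ t dirs D₁ with hD₂
  have r0 : D₀.real = D.real := assign_real ..
  have n0 : ∀ b ≠ 4, D₀.nat b = D.nat b := fun b hb => assign_nat_of_ne hb ..
  have r1 : D₁.real = D.real := (assign_real ..).trans r0
  have n1 : ∀ b ≠ 4, D₁.nat b = D.nat b := fun b hb => (assign_nat_of_ne hb ..).trans (n0 b hb)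
  have r2 : D₂.real = D.real := (assign_real ..).trans r1
  have n2 : ∀ b ≠ 4, D₂.nat b = D.nat b := fun b hb => (assign_nat_of_ne hb ..).trans (n1 b hb)
  have hN : ∀ D' : State, (∀ b ≠ 4, D'.nat b = D.nat b) → D'.nat 0 0 = D.nat 0 0 := fun D' h => by
    rw [h 0 (by decide)]
  have hsys : ∀ D' : State, D'.real = D.real → (∀ b ≠ 4, D'.nat b = D.nat b) →
      wedgeSystem M c₁ c₂ t dirs D' = wedgeSystem M c₁ c₂ t dirs D := by
    intro D' hr h
    refine wedgeSystem_congr hr (h 0 (by decide)) (h 3 (by decide)) (fun p _ => ?_) ..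
    rw [Avail, Avail, h 1 (by decide), h 8 (by decide)]
  have hz : ∀ p < D.nat 0 0, D₀.nat 4 p = 0 := fun p hp =>
    (assign_nat_same hp (fun D' _ _ _ => ⟨Iff.rfl, rfl⟩)).1 trivial
  have hcand : ∀ p < D₁.nat 0 0, D₁.nat 4 p = 1 ↔ (wedgeSystem M c₁ c₂ t dirs D₁).Candidate p := by
    intro p hp
    rw [hN _ n1] at hp
    have h := assign_nat_same (a := 4) (val := fun _ _ => 1) (D := D₀) (z := p)
      (R := fun D x => (wedgeSystem M c₁ c₂ t dirs D).Candidate (x 0)) (by rwa [hN _ n0])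
      (fun D' hr hn _ => ⟨by
        rw [hsys D' (hr.trans r0) fun b hb => (hn b hb).trans (n0 b hb), hsys D₀ r0 n0], rfl⟩)
    rw [hsys D₁ r1 n1]
    rw [hsys D₀ r0 n0] at h
    by_cases hp' : (wedgeSystem M c₁ c₂ t dirs D).Candidate p
    · exact ⟨fun _ => hp', fun _ => h.1 hp'⟩
    · refine ⟨fun h1 => ?_, fun h => absurd h hp'⟩
      have := (h.2 hp').trans (hz p hp)
      change D₁.nat 4 p = 0 at this
      omega
  have hspec := pruneMarks_spec M c₁ c₂ t dirs hcand (by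
    rw [hsys D₁ r1 n1]
    exact fun a b hab => WedgeSystem.exists_candidateFor hk hc hdirs hab)
  rw [hsys D₁ r1 n1, hN _ n1] at hspec
  refine ⟨(assign_real ..).trans r2, fun b h1 h4 => (assign_nat_of_ne h1 ..).trans (n2 b h4),
    _, fun p hp => Finset.mem_range.1 (Finset.mem_filter.1 hp).1, hspec, fun p hp => ?_⟩
  have h := assign_nat_same (a := 1) (val := fun D _ => D.nat 8 0 + 1) (D := D₂) (z := p)
    (R := fun D x => D.nat 4 (x 0) = 1) (by rwa [hN _ n2])
    (fun D' _ hn _ => ⟨by rw [hn 4 (by decide)], by rw [hn 8 (by decide)]⟩)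
  simp only [Finset.mem_filter, Finset.mem_range, hp, true_and]
  exact ⟨fun hp1 => (h.1 hp1).trans (by rw [n2 8 (by decide)]),
    fun hp1 => (h.2 hp1).trans (by rw [n2 1 (by decide)])⟩

section Round

variable {κ : Type*} (M c₁ c₂ : ℕ) (corner : κ → (ℕ × ℕ) × (ℕ × ℕ)) (dirs : κ → Finset (ℕ × ℕ))

/-- One round: all corners are processed with the same colour. -/
noncomputable def roundStep (types : List κ) (D : State) : State :=
  nextRound (types.foldl (fun D t => hitCorner M c₁ c₂ (corner t) (dirs t) D) D)

/-- The points of one cell that lie in a wedge of a corner. -/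
noncomputable def cellWedge (D : State) (t : (ℕ × ℕ) × (ℕ × ℕ)) (o : ℕ) (γ δ : ℝ) : Finset ℕ :=
  (Finset.range (D.nat 0 0)).filter fun u =>
    cellOf M D u = o ∧ linForm D t.1 u ≤ γ ∧ linForm D t.2 u ≤ δ

/-- The assumptions on the edge forms of the corners: no edge form is a positive combination of the two
forms of a corner, and `dirs` lists the negative combinations. -/
structure CornerData (D : State) (types : List κ) : Prop where
  dirs_neg : ∀ t ∈ types, ∀ i ∈ dirs t, ∃ l r : ℝ, l < 0 ∧ r < 0 ∧
    ∀ u, linForm D i u = l * linForm D (corner t).1 u + r * linForm D (corner t).2 u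
  comb : ∀ t ∈ types, ∀ t' ∈ types, ∀ i, i = (corner t').1 ∨ i = (corner t').2 → ∃ l r : ℝ,
    (∀ u, linForm D i u = l * linForm D (corner t).1 u + r * linForm D (corner t).2 u) ∧
      ¬ (0 < l ∧ 0 < r) ∧ (l < 0 → r < 0 → i ∈ dirs t)
  card_lt : ∀ t ∈ types, (dirs t).card * c₁ < c₂
  le : c₁ ≤ c₂
  pos : 0 < D.nat 0 1

/-- What holds after `r` rounds, started in the memory `D₀`. Wedges that have at least `k / C` points
in one cell have lost few of them, and contain all colours used. -/
structure RoundInvariant (C : ℕ) (types : List κ) (D₀ : State) (r : ℕ) (D : State) : Prop where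
  real : D.real = D₀.real
  nat : ∀ b, b ≠ 1 → b ≠ 4 → b ≠ 8 → D.nat b = D₀.nat b
  round : D.nat 8 0 = r
  le : ∀ p < D₀.nat 0 0, D.nat 1 p ≤ r
  loss : ∀ t ∈ types, ∀ o γ δ, D₀.nat 0 1 ≤ C * (cellWedge M D₀ (corner t) o γ δ).card →
    D₀.nat 0 1 * ((cellWedge M D₀ (corner t) o γ δ).filter fun p => D.nat 1 p ≠ 0).card ≤
      r * types.length * ((4 * c₂ + 8 * C) * (cellWedge M D₀ (corner t) o γ δ).card)
  hit : ∀ t ∈ types, ∀ o γ δ, D₀.nat 0 1 ≤ C * (cellWedge M D₀ (corner t) o γ δ).card →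
    ∀ r' < r, ∃ p ∈ cellWedge M D₀ (corner t) o γ δ, D.nat 1 p = r' + 1

/-- What holds within a round, started in the memory `D` with current colour `r`, after processing the
corners in the list `done`. -/
structure CornerInvariant (C r : ℕ) (types done : List κ) (D D' : State) : Prop where
  real : D'.real = D.real
  nat : ∀ b, b ≠ 1 → b ≠ 4 → D'.nat b = D.nat b
  change : ∀ p < D.nat 0 0, D'.nat 1 p = D.nat 1 p ∨ (D.nat 1 p = 0 ∧ D'.nat 1 p = r + 1)
  loss : ∀ t ∈ types, ∀ o γ δ, D.nat 0 1 ≤ C * (cellWedge M D (corner t) o γ δ).card →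
    D.nat 0 1 * ((cellWedge M D (corner t) o γ δ).filter fun p => D'.nat 1 p ≠ D.nat 1 p).card ≤
      done.length * ((4 * c₂ + 8 * C) * (cellWedge M D (corner t) o γ δ).card)
  hit : ∀ t ∈ done, ∀ o γ δ, D.nat 0 1 ≤ C * (cellWedge M D (corner t) o γ δ).card →
    ∃ p ∈ cellWedge M D (corner t) o γ δ, D'.nat 1 p = r + 1

variable {M c₁ c₂ corner dirs}

theorem CornerInvariant.step {C r : ℕ} {types done : List κ} {D D' : State}
    (hcd : CornerData c₁ c₂ corner dirs D types) (hr : D.nat 8 0 = r)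
    (hle : ∀ p < D.nat 0 0, D.nat 1 p ≤ r)
    (hheavy : ∀ t ∈ types, ∀ o γ δ, D.nat 0 1 ≤ C * (cellWedge M D (corner t) o γ δ).card →
      D.nat 0 1 ≤ c₁ * ((cellWedge M D (corner t) o γ δ).filter fun p => D.nat 1 p = 0).card)
    (h : CornerInvariant M c₂ corner C r types done D D') {t : κ} (ht : t ∈ types) :
    CornerInvariant M c₂ corner C r types (done ++ [t]) D
      (hitCorner M c₁ c₂ (corner t) (dirs t) D') := by
  have h0 : D'.nat 0 = D.nat 0 := h.nat 0 (by decide) (by decide)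
  have h8 : D'.nat 8 0 = r := by rw [h.nat 8 (by decide) (by decide), hr]
  have hlin := linForm_congr h.real
  have havail : ∀ p < D.nat 0 0, Avail D p ↔ D.nat 1 p = 0 := by
    intro p hp
    have := hle p hp
    rw [Avail, hr]; omega
  have hsys : wedgeSystem M c₁ c₂ (corner t) (dirs t) D' =
      wedgeSystem M c₁ c₂ (corner t) (dirs t) D := by
    refine wedgeSystem_congr h.real h0 (h.nat 3 (by decide) (by decide)) (fun p hp => ?_) ..
    rw [havail p hp, Avail, h8]
    have := hle p hp
    have := h.change p hp
    omega
  obtain ⟨s1, s2, H, hHN, hH, hval⟩ := hitCorner_spec M c₁ c₂ (corner t) (dirs t) (D := D')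
    (by rw [h0]; exact hcd.pos) (hcd.card_lt t ht) (by rw [hlin]; exact hcd.dirs_neg t ht)
  rw [hsys] at hH
  rw [h0] at hHN hval
  rw [h8] at hval
  have hHQ : ∀ p ∈ H, D.nat 1 p = 0 := by
    intro p hp
    obtain ⟨a, -, b, -, -, hw, -⟩ := hH.candidate p hp
    have := ((mem_wedgeSystem ..).1 (WedgeSystem.mem_wedge.1 hw).1).2
    exact (havail p (hHN p hp)).1 this
  have hQ : ∀ (t' : (ℕ × ℕ) × (ℕ × ℕ)) (o : ℕ) (γ δ : ℝ),
      (wedgeSystem M c₁ c₂ (corner t) (dirs t) D).Q.filter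
        (fun u => cellOf M D u = o ∧ linForm D t'.1 u ≤ γ ∧ linForm D t'.2 u ≤ δ) =
      (cellWedge M D t' o γ δ).filter fun p => D.nat 1 p = 0 := by
    intro t' o γ δ
    ext u
    rw [Finset.mem_filter, Finset.mem_filter, mem_wedgeSystem, cellWedge, Finset.mem_filter,
      Finset.mem_range]
    constructor
    · rintro ⟨⟨a, b⟩, c⟩; exact ⟨⟨a, c⟩, (havail u a).1 b⟩
    · rintro ⟨⟨a, c⟩, b⟩; exact ⟨⟨a, (havail u a).2 b⟩, c⟩
  refine ⟨s1.trans h.real, fun b h1 h4 => (s2 b h1 h4).trans (h.nat b h1 h4), fun p hp => ?_,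
    fun t' ht' o γ δ hV => ?_, fun t' ht' o γ δ hV => ?_⟩
  · by_cases hpH : p ∈ H
    · exact .inr ⟨hHQ p hpH, (hval p hp).1 hpH⟩
    · rw [(hval p hp).2 hpH]; exact h.change p hp
  · set V := cellWedge M D (corner t') o γ δ with hVdef
    have hVN : ∀ p ∈ V, p < D.nat 0 0 := fun p hp =>
      Finset.mem_range.1 (Finset.mem_filter.1 hp).1
    obtain ⟨l₁, r₁, hm₁, hp₁, hd₁⟩ := hcd.comb t ht t' ht' _ (.inl rfl)
    obtain ⟨l₂, r₂, hm₂, hp₂, hd₂⟩ := hcd.comb t ht t' ht' _ (.inr rfl)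
    have hcard : D.nat 0 1 * (H.filter fun u => cellOf M D u = o ∧ linForm D (corner t').1 u ≤ γ ∧
        linForm D (corner t').2 u ≤ δ).card ≤ 4 * c₂ * (V.filter fun p => D.nat 1 p = 0).card +
          8 * D.nat 0 1 := by
      rw [← hQ]
      exact hH.card_le hcd.le hm₁ hm₂ hp₁ hp₂ hd₁ hd₂ o γ δ
    have hsub : (V.filter fun p => (hitCorner M c₁ c₂ (corner t) (dirs t) D').nat 1 p ≠ D.nat 1 p) ⊆
        (V.filter fun p => D'.nat 1 p ≠ D.nat 1 p) ∪ H.filter fun u => cellOf M D u = o ∧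
          linForm D (corner t').1 u ≤ γ ∧ linForm D (corner t').2 u ≤ δ := by
      intro p hp
      obtain ⟨hpV, hne⟩ := Finset.mem_filter.1 hp
      by_cases hpH : p ∈ H
      · exact Finset.mem_union_right _ (Finset.mem_filter.2 ⟨hpH, (Finset.mem_filter.1 hpV).2⟩)
      · rw [(hval p (hVN p hpV)).2 hpH] at hne
        exact Finset.mem_union_left _ (Finset.mem_filter.2 ⟨hpV, hne⟩)
    have h1 := (Finset.card_le_card hsub).trans (Finset.card_union_le _ _)
    have h2 := h.loss t' ht' o γ δ hV
    rw [← hVdef] at h2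
    have h3 : (V.filter fun p => D.nat 1 p = 0).card ≤ V.card := Finset.card_filter_le _ _
    rw [List.length_append, List.length_singleton]
    have h4 := Nat.mul_le_mul_left (D.nat 0 1) h1
    have h5 := Nat.mul_le_mul_left (4 * c₂) h3
    rw [Nat.mul_add] at h4
    have e : (done.length + 1) * ((4 * c₂ + 8 * C) * V.card) =
      done.length * ((4 * c₂ + 8 * C) * V.card) + (4 * c₂ * V.card + 8 * (C * V.card)) := by ring
    rw [e]
    omega
  · have hHadd : ∀ p < D.nat 0 0, D'.nat 1 p = r + 1 →
        (hitCorner M c₁ c₂ (corner t) (dirs t) D').nat 1 p = r + 1 := by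
      intro p hp h1
      by_cases hpH : p ∈ H
      · exact (hval p hp).1 hpH
      · rw [(hval p hp).2 hpH, h1]
    rw [List.mem_append, List.mem_singleton] at ht'
    rcases ht' with ht' | rfl
    · obtain ⟨p, hp, hp1⟩ := h.hit t' ht' o γ δ hV
      exact ⟨p, hp, hHadd p (Finset.mem_range.1 (Finset.mem_filter.1 hp).1) hp1⟩
    · obtain ⟨p, hp, hpV⟩ := hH.exists_mem (fun u hu => ((mem_wedgeSystem ..).1 hu).1) hcd.pos o γ δ
        ((hheavy t' ht o γ δ hV).trans_eq (by rw [← hQ]; rfl))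
      exact ⟨p, Finset.mem_filter.2 ⟨Finset.mem_range.2 (hHN p hp), hpV⟩, (hval p (hHN p hp)).1 hp⟩

theorem CornerInvariant.foldl {C r : ℕ} {types : List κ} {D : State}
    (hcd : CornerData c₁ c₂ corner dirs D types) (hr : D.nat 8 0 = r)
    (hle : ∀ p < D.nat 0 0, D.nat 1 p ≤ r)
    (hheavy : ∀ t ∈ types, ∀ o γ δ, D.nat 0 1 ≤ C * (cellWedge M D (corner t) o γ δ).card →
      D.nat 0 1 ≤ c₁ * ((cellWedge M D (corner t) o γ δ).filter fun p => D.nat 1 p = 0).card)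
    (l : List κ) (hl : ∀ t ∈ l, t ∈ types) : ∀ (done : List κ) (D' : State),
    CornerInvariant M c₂ corner C r types done D D' → CornerInvariant M c₂ corner C r types
      (done ++ l) D (l.foldl (fun D t => hitCorner M c₁ c₂ (corner t) (dirs t) D) D') := by
  induction l with
  | nil => intro done D' h; simpa using h
  | cons t l ih =>
    intro done D' h
    have := ih (fun t ht => hl t (by simp [ht])) (done ++ [t]) _
      (h.step hcd hr hle hheavy (hl t (by simp)))
    simpa using this

theorem cellWedge_congr {D D' : State} (h : D'.real = D.real) (h0 : D'.nat 0 = D.nat 0)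
    (h3 : D'.nat 3 = D.nat 3) (t : (ℕ × ℕ) × (ℕ × ℕ)) (o : ℕ) (γ δ : ℝ) :
    cellWedge M D' t o γ δ = cellWedge M D t o γ δ := by
  simp only [cellWedge, linForm_congr h, cellOf_congr h h3 h0, h0]

/-- As long as `α r < k`, only half of the points of a wedge can have been used. -/
theorem RoundInvariant.step {C α r : ℕ} {types : List κ} {D₀ D : State}
    (hcd : CornerData c₁ c₂ corner dirs D₀ types) (hc₁ : c₁ = 2 * C)
    (hα : 2 * types.length * (4 * c₂ + 8 * C) ≤ α) (hr : α * r < D₀.nat 0 1)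
    (h : RoundInvariant M c₂ corner C types D₀ r D) :
    RoundInvariant M c₂ corner C types D₀ (r + 1) (roundStep M c₁ c₂ corner dirs types D) := by
  have h0 : D.nat 0 = D₀.nat 0 := h.nat 0 (by decide) (by decide) (by decide)
  have h3 : D.nat 3 = D₀.nat 3 := h.nat 3 (by decide) (by decide) (by decide)
  have hlin := linForm_congr h.real
  have hcw : ∀ t o γ δ, cellWedge M D t o γ δ = cellWedge M D₀ t o γ δ :=
    cellWedge_congr h.real h0 h3
  have hcd' : CornerData c₁ c₂ corner dirs D types := by
    obtain ⟨a1, a2, a3, a4, a5⟩ := hcd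
    exact ⟨by rw [hlin]; exact a1, by rw [hlin]; exact a2, a3, a4, by rw [h0]; exact a5⟩
  have key := CornerInvariant.foldl (M := M) (C := C) (r := r) hcd' h.round
    (by rw [h0]; exact h.le) (by
      intro t ht o γ δ hV
      rw [hcw, h0] at *
      have hl := h.loss t ht o γ δ hV
      set V := cellWedge M D₀ (corner t) o γ δ
      have hsum : (V.filter fun p => D.nat 1 p = 0).card + (V.filter fun p => D.nat 1 p ≠ 0).card =
        V.card := Finset.card_filter_add_card_filter_not _
      have h1 : 2 * (D₀.nat 0 1 * (V.filter fun p => D.nat 1 p ≠ 0).card) ≤ D₀.nat 0 1 * V.card := by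
        calc 2 * (D₀.nat 0 1 * (V.filter fun p => D.nat 1 p ≠ 0).card)
            ≤ 2 * (r * types.length * ((4 * c₂ + 8 * C) * V.card)) := Nat.mul_le_mul_left _ hl
          _ = (2 * types.length * (4 * c₂ + 8 * C)) * r * V.card := by ring
          _ ≤ α * r * V.card := by gcongr
          _ ≤ D₀.nat 0 1 * V.card := Nat.mul_le_mul_right _ hr.le
      have h2 : 2 * (V.filter fun p => D.nat 1 p ≠ 0).card ≤ V.card :=
        Nat.le_of_mul_le_mul_left (by linarith) hcd.pos
      rw [hc₁, mul_comm 2 C, mul_assoc]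
      exact hV.trans (Nat.mul_le_mul_left _ (by omega))) types (fun _ h => h) [] D
    ⟨rfl, fun _ _ _ => rfl, fun _ _ => .inl rfl, fun t ht o γ δ hV => by simp,
      fun t ht => by simp at ht⟩
  rw [List.nil_append] at key
  obtain ⟨k1, k2, k3, k4, k5⟩ := key
  rw [h0] at k3
  simp only [hcw, h0] at k4 k5
  set D' := types.foldl (fun D t => hitCorner M c₁ c₂ (corner t) (dirs t) D) D
  have hn1 : ∀ p, (roundStep M c₁ c₂ corner dirs types D).nat 1 p = D'.nat 1 p := fun p =>
    setNat_nat_of_ne_left _ (by decide) ..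
  refine ⟨k1.trans h.real, fun b b1 b4 b8 => ?_, ?_, fun p hp => ?_, fun t ht o γ δ hV => ?_,
    fun t ht o γ δ hV r' hr' => ?_⟩
  · funext j
    change (D'.setNat 8 0 _).nat b j = _
    rw [setNat_nat_of_ne_left _ b8, k2 b b1 b4, h.nat b b1 b4 b8]
  · change (D'.setNat 8 0 _).nat 8 0 = _
    rw [setNat_nat_same, k2 8 (by decide) (by decide), h.round]
  · rw [hn1]
    have := h.le p hp
    rcases k3 p hp with h' | h' <;> omega
  · have hl := h.loss t ht o γ δ hV
    have hl' := k4 t ht o γ δ hV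
    set V := cellWedge M D₀ (corner t) o γ δ
    have hsub : (V.filter fun p => (roundStep M c₁ c₂ corner dirs types D).nat 1 p ≠ 0) ⊆
        (V.filter fun p => D.nat 1 p ≠ 0) ∪ V.filter fun p => D'.nat 1 p ≠ D.nat 1 p := by
      intro p hp
      rw [Finset.mem_filter, hn1] at hp
      rw [Finset.mem_union, Finset.mem_filter, Finset.mem_filter]
      by_cases h0 : D.nat 1 p = 0
      · exact .inr ⟨hp.1, by rw [h0]; exact hp.2⟩
      · exact .inl ⟨hp.1, h0⟩
    have h4 := Nat.mul_le_mul_left (D₀.nat 0 1)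
      ((Finset.card_le_card hsub).trans (Finset.card_union_le _ _))
    rw [Nat.mul_add] at h4
    have e : (r + 1) * types.length * ((4 * c₂ + 8 * C) * V.card) =
      r * types.length * ((4 * c₂ + 8 * C) * V.card) +
        types.length * ((4 * c₂ + 8 * C) * V.card) := by ring
    rw [e]
    exact h4.trans (Nat.add_le_add hl hl')
  · rcases Nat.lt_succ_iff_lt_or_eq.1 hr' with hr' | rfl
    · obtain ⟨p, hp, hp1⟩ := h.hit t ht o γ δ hV r' hr'
      refine ⟨p, hp, ?_⟩
      rw [hn1]
      rcases k3 p (Finset.mem_range.1 (Finset.mem_filter.1 hp).1) with h' | h' <;> omega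
    · obtain ⟨p, hp, hp1⟩ := k5 t ht o γ δ hV
      exact ⟨p, hp, by rw [hn1]; exact hp1⟩

theorem roundStep_nat_zero (types : List κ) (D : State) :
    (roundStep M c₁ c₂ corner dirs types D).nat 0 = D.nat 0 := by
  have hfold : ∀ (l : List κ) (D : State),
      (l.foldl (fun D t => hitCorner M c₁ c₂ (corner t) (dirs t) D) D).nat 0 = D.nat 0 := by
    intro l
    induction l with
    | nil => intro D; rfl
    | cons t l ih =>
      intro D
      rw [List.foldl_cons, ih]
      simp [hitCorner, colourMarked, pruneMarks, markCandidates, assign_nat_of_ne]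
  rw [← hfold types D]
  funext j
  exact setNat_nat_of_ne_left _ (by decide) ..

theorem polyComputes_roundStep (types : List κ) :
    PolyComputes (roundStep M c₁ c₂ corner dirs types) := by
  have h0 : ∀ (t : κ) (D : State), (hitCorner M c₁ c₂ (corner t) (dirs t) D).nat 0 = D.nat 0 := by
    intro t D
    simp [hitCorner, colourMarked, pruneMarks, markCandidates, assign_nat_of_ne]
  refine polyComputes_nextRound.comp
    (PolyComputes.foldl types (fun t _ => polyComputes_hitCorner _ _ _ _ _) h0) fun D => ?_
  rw [← roundStep_nat_zero (M := M) (c₁ := c₁) (c₂ := c₂) (corner := corner) (dirs := dirs) types D]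
  funext j
  exact (setNat_nat_of_ne_left _ (by decide) ..).symm

end Round

end RealRAM

/-! ### Cells -/

namespace RealRAM

theorem markCentres_spec (M : ℕ) {D : State} (h3 : ∀ p, D.nat 3 p = 0) :
    (∀ p < D.nat 0 0, ∃ o < D.nat 0 0, NearCentre M (markCentres M D) o p) ∧
      ∀ p q, p < q → (markCentres M D).nat 3 p = 1 → (markCentres M D).nat 3 q = 1 →
        ¬ Near M D p q := by
  let I : ℕ → State → Prop := fun z D' => D'.real = D.real ∧ (∀ b ≠ 3, D'.nat b = D.nat b) ∧
    (∀ p, z ≤ p → D'.nat 3 p = 0) ∧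
    (∀ p < z, ∃ o ≤ p, NearCentre M D' o p) ∧
    ∀ p q, p < q → D'.nat 3 p = 1 → D'.nat 3 q = 1 → ¬ Near M D p q
  have hnear : ∀ D' : State, D'.real = D.real → Near M D' = Near M D := fun D' h => by
    funext p q; simp [Near, h]
  have key := assignUpTo_induction (a := 3)
    (R := fun D x => ¬ ∃ q < D.nat 0 0, q < x 0 ∧ NearCentre M D q (x 0)) (val := fun _ _ => 1)
    I (D := D) ⟨rfl, fun _ _ => rfl, fun p _ => h3 p, fun p hp => absurd hp (Nat.not_lt_zero p),
      fun p q _ hp => by simp [h3] at hp⟩ (D.nat 0 0)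
    (fun z hz D' h hR => by
      obtain ⟨i1, i2, i3, i4, i5⟩ := h
      have hN : D'.nat 0 0 = D.nat 0 0 := by rw [i2 0 (by decide)]
      have hold : ∀ p, p ≠ z → (D'.setNat 3 z 1).nat 3 p = D'.nat 3 p := fun p hp =>
        setNat_nat_of_ne_right _ hp ..
      have hn := hnear D' i1
      have hn' := hnear (D'.setNat 3 z 1) i1
      refine ⟨i1, fun b hb => ?_, fun p hp => ?_, fun p hp => ?_, fun p q hpq hp hq => ?_⟩
      · funext j; rw [setNat_nat_of_ne_left _ hb, i2 b hb]
      · rw [hold p (by omega)]; exact i3 p (by omega)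
      · by_cases hpz : p = z
        · subst hpz
          exact ⟨p, le_rfl, setNat_nat_same .., by rw [hn']; simp [Near]⟩
        · obtain ⟨o, ho, ho1, ho2⟩ := i4 p (by omega)
          exact ⟨o, ho, by rw [hold o (by omega)]; exact ho1, by rw [hn', ← hn]; exact ho2⟩
      · by_cases hqz : q = z
        · subst hqz
          rw [hold p (by omega)] at hp
          intro hnr
          exact hR ⟨p, by omega, hpq, hp, by rw [hn]; exact hnr⟩
        · by_cases hpz : p = z
          · rw [hold q hqz, i3 q (by omega)] at hq; omega
          · rw [hold p hpz] at hp
            rw [hold q hqz] at hq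
            exact i5 p q hpq hp hq)
    (fun z hz D' h hR => by
      obtain ⟨i1, i2, i3, i4, i5⟩ := h
      refine ⟨i1, i2, fun p hp => i3 p (by omega), fun p hp => ?_, i5⟩
      by_cases hpz : p = z
      · subst hpz
        obtain ⟨q, -, hq, hq'⟩ := not_not.1 hR
        exact ⟨q, le_of_lt hq, hq'⟩
      · exact i4 p (by omega))
  obtain ⟨-, -, -, i4, i5⟩ := key
  exact ⟨fun p hp => (i4 p hp).imp fun o ho => ⟨ho.1.trans_lt hp, ho.2⟩, i5⟩

/-- Points in a square that are pairwise not near are in different squares of a fine grid. -/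
theorem card_le_of_not_near {M : ℕ} {D : State} (O : Finset ℕ)
    (hO : ∀ p ∈ O, ∀ q ∈ O, p < q → ¬ Near M D p q) (a b : ℝ) (B : ℕ)
    (h : ∀ p ∈ O, |D.real 2 p - a| ≤ B ∧ |D.real 3 p - b| ≤ B) :
    O.card ≤ (2 * (M * B) + 1) * (2 * (M * B) + 1) := by
  let φ : ℕ → ℤ × ℤ := fun p => (⌊M * (D.real 2 p - a)⌋, ⌊M * (D.real 3 p - b)⌋)
  have hfl : ∀ s t : ℝ, ⌊M * s⌋ = ⌊M * t⌋ → M * (s - t) < 1 := by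
    intro s t hst
    have h1 := Int.lt_floor_add_one ((M : ℝ) * s)
    have h2 := Int.floor_le ((M : ℝ) * t)
    rw [hst] at h1
    linarith
  have hnear : ∀ p q, φ p = φ q → Near M D p q := by
    intro p q hpq
    simp only [φ, Prod.mk.injEq] at hpq
    have h1 := hfl _ _ hpq.1
    have h2 := hfl _ _ hpq.1.symm
    have h3 := hfl _ _ hpq.2
    have h4 := hfl _ _ hpq.2.symm
    simp only [sub_sub_sub_cancel_right] at h1 h2 h3 h4
    exact ⟨⟨h1, h2⟩, h3, h4⟩
  have hinj : Set.InjOn φ O := by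
    intro p hp q hq hpq
    rcases lt_trichotomy p q with h' | h' | h'
    · exact absurd (hnear p q hpq) (hO p hp q hq h')
    · exact h'
    · exact absurd (hnear q p hpq.symm) (hO q hq p hp h')
  have hrange : ∀ s : ℝ, |s| ≤ B → ⌊M * s⌋ ∈ Finset.Icc (-(M * B : ℤ)) (M * B) := by
    intro s hs
    obtain ⟨hs1, hs2⟩ := abs_le.1 hs
    have hM : (0 : ℝ) ≤ M := Nat.cast_nonneg M
    rw [Finset.mem_Icc]
    constructor
    · rw [Int.le_floor]; push_cast; nlinarith
    · have : (⌊M * s⌋ : ℝ) ≤ ((M * B : ℤ) : ℝ) := (Int.floor_le _).trans (by push_cast; nlinarith)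
      exact_mod_cast this
  have := Finset.card_le_card_of_injOn (s := O)
    (t := Finset.Icc (-(M * B : ℤ)) (M * B) ×ˢ Finset.Icc (-(M * B : ℤ)) (M * B)) φ
    (fun p hp => by
      rw [Finset.mem_coe, Finset.mem_product]
      exact ⟨hrange _ (h p hp).1, hrange _ (h p hp).2⟩) hinj
  rw [Finset.card_product, Int.card_Icc] at this
  have e : ((M * B : ℤ) + 1 - -(M * B : ℤ)).toNat = 2 * (M * B) + 1 := by
    have : ((M * B : ℤ) + 1 - -(M * B : ℤ)) = ((2 * (M * B) + 1 : ℕ) : ℤ) := by push_cast; ring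
    rw [this, Int.toNat_natCast]
  rwa [e] at this

/-! ### Decomposition of collections of translates of a polygon -/

/-- The points as a function of all natural numbers, extended by the origin. -/
noncomputable def pointAt {N : ℕ} (x : Fin N → EuclideanPlane) (p : ℕ) : EuclideanPlane :=
  if h : p < N then x ⟨p, h⟩ else 0

/-- An edge given by the numbers of its end points in memory. -/
def edgeIndex {n : ℕ} (l : Fin n × Fin n) : ℕ × ℕ := (l.1, l.2)

/-- A corner given by the numbers of the end points of its two edges in memory. -/
def cornerIndex {n : ℕ} (t : (Fin n × Fin n) × (Fin n × Fin n)) : (ℕ × ℕ) × (ℕ × ℕ) :=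
  (edgeIndex t.1, edgeIndex t.2)

theorem input_real_two {n N : ℕ} (v : Fin n → EuclideanPlane) (x : Fin N → EuclideanPlane)
    (k p : ℕ) : (input v x k).real 2 p = pointAt x p 0 ∧ (input v x k).real 3 p = pointAt x p 1 := by
  simp only [input, coords, pointAt]
  constructor <;> split_ifs <;> simp_all

theorem linForm_input {n N : ℕ} (v : Fin n → EuclideanPlane) (x : Fin N → EuclideanPlane) (k : ℕ)
    (l : Fin n × Fin n) (p : ℕ) :
    linForm (input v x k) (edgeIndex l) p = edgeForm v l (pointAt x p) := by
  rw [linForm, (input_real_two v x k p).1, (input_real_two v x k p).2, edgeForm]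
  simp [input, coords, edgeIndex]

open Classical in
/-- The corners of a polygon. -/
noncomputable def corners {n : ℕ} (P : Set EuclideanPlane) (v : Fin n → EuclideanPlane) :
    List ((Fin n × Fin n) × (Fin n × Fin n)) :=
  (Finset.univ.filter fun t => IsPolygonCorner P v t).toList

theorem mem_corners {n : ℕ} {P : Set EuclideanPlane} {v : Fin n → EuclideanPlane}
    {t : (Fin n × Fin n) × (Fin n × Fin n)} : t ∈ corners P v ↔ IsPolygonCorner P v t := by
  simp [corners]

/-- The pairs of vertices whose forms are negative combinations of the two edge forms of a corner. -/
noncomputable def negativeEdges {n : ℕ} (v : Fin n → EuclideanPlane)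
    (t : (Fin n × Fin n) × (Fin n × Fin n)) : Finset (ℕ × ℕ) :=
  (Finset.univ.filter fun l => edgeDet v l t.2 / edgeDet v t.1 t.2 < 0 ∧
    edgeDet v t.1 l / edgeDet v t.1 t.2 < 0).image edgeIndex

theorem card_negativeEdges_le {n : ℕ} (v : Fin n → EuclideanPlane)
    (t : (Fin n × Fin n) × (Fin n × Fin n)) : (negativeEdges v t).card ≤ n * n := by
  refine Finset.card_image_le.trans ((Finset.card_filter_le _ _).trans ?_)
  simp

theorem cornerData_input {n N : ℕ} {P : Set EuclideanPlane} {v : Fin n → EuclideanPlane}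
    (hP : P = convexHull ℝ (Set.range v)) (hinj : Function.Injective v)
    (x : Fin N → EuclideanPlane) {k : ℕ} (hk : 1 ≤ k) {c₁ c₂ : ℕ} (hc : (n * n + 1) * c₁ < c₂)
    {D : State} (hD : D.real = (input v x k).real) (hDk : D.nat 0 1 = k) :
    CornerData c₁ c₂ cornerIndex (negativeEdges v) D (corners P v) := by
  have hlin : ∀ l p, linForm D (edgeIndex l) p = edgeForm v l (pointAt x p) := by
    rw [linForm_congr hD]; exact linForm_input v x k
  refine ⟨fun t ht i hi => ?_, fun t ht t' ht' i hi => ?_, fun t ht => ?_, by nlinarith, by omega⟩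
  · obtain ⟨l, hl, rfl⟩ := Finset.mem_image.1 hi
    obtain ⟨-, h1, h2⟩ := Finset.mem_filter.1 hl
    refine ⟨_, _, h1, h2, fun u => ?_⟩
    simp only [cornerIndex, hlin]
    exact edgeForm_cramer (mem_corners.1 ht).2.2.1 l _
  · have ht := mem_corners.1 ht
    have ht' := mem_corners.1 ht'
    have hl : ∃ l, i = edgeIndex l ∧ IsEdge v l := by
      rcases hi with rfl | rfl
      · exact ⟨t'.1, rfl, ht'.1⟩
      · exact ⟨t'.2, rfl, ht'.2.1⟩
    obtain ⟨l, rfl, hl⟩ := hl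
    have hcr := edgeForm_cramer ht.2.2.1 l
    refine ⟨_, _, fun u => ?_, ht.not_pos hP hinj hl hcr, fun h1 h2 => ?_⟩
    · simp only [cornerIndex, hlin]
      exact hcr _
    · exact Finset.mem_image_of_mem _ (Finset.mem_filter.2 ⟨Finset.mem_univ _, h1, h2⟩)
  · have := card_negativeEdges_le v t
    nlinarith

theorem dist_lt_of_coord {u w : EuclideanPlane} {ε : ℝ} (h0 : |u 0 - w 0| < ε / 2)
    (h1 : |u 1 - w 1| < ε / 2) : dist u w < ε := by
  have hε : 0 < ε := by linarith [abs_nonneg (u 0 - w 0)]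
  rw [EuclideanSpace.dist_eq, Real.sqrt_lt' hε, Fin.sum_univ_two, Real.dist_eq, Real.dist_eq]
  nlinarith [abs_nonneg (u 0 - w 0), abs_nonneg (u 1 - w 1)]

/-- If a point lies in at least `k` translates, some cell contains at least `k / C` of the corresponding
translation vectors, and those are cut out of the cell by a wedge of some corner. -/
theorem exists_cellWedge {n N : ℕ} {P : Set EuclideanPlane} {v : Fin n → EuclideanPlane}
    {M B : ℕ} {ε : ℝ} (hM : 0 < M) (hMε : 4 / ε < M) (hε : 0 < ε)
    (hB : ∀ u ∈ P, |u 0| ≤ B ∧ |u 1| ≤ B)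
    (hloc : ∀ T : Set EuclideanPlane, (∀ u ∈ T, ∀ u' ∈ T, dist u u' < ε) → (∃ u ∈ T, u ∈ P) →
      ∃ t, IsPolygonCorner P v t ∧ ∀ u ∈ T, (u ∈ P ↔ edgeForm v t.1 (v t.1.1) ≤ edgeForm v t.1 u ∧
          edgeForm v t.2 (v t.2.1) ≤ edgeForm v t.2 u))
    (x : Fin N → EuclideanPlane) {k : ℕ} (hk : 1 ≤ k) (y : EuclideanPlane)
    (hy : k ≤ {j : Fin N | y ∈ planeTranslate P (x j)}.ncard) :
    ∃ t ∈ corners P v, ∃ o γ δ,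
      k ≤ (2 * (M * (B + 1)) + 1) * (2 * (M * (B + 1)) + 1) *
        (cellWedge M (markCentres M (input v x k)) (cornerIndex t) o γ δ).card ∧
      ∀ p ∈ cellWedge M (markCentres M (input v x k)) (cornerIndex t) o γ δ,
        y - pointAt x p ∈ P := by
  classical
  set D₀ := input v x k with hD₀
  set D := markCentres M D₀ with hD
  have hN₀ : D₀.nat 0 0 = N := by simp [D₀, input]
  have hreal : D.real = D₀.real := assign_real ..
  have hN : D.nat 0 0 = N := by
    rw [hD, markCentres, assign_nat_of_ne (by decide), hN₀]
  obtain ⟨hcover, hsep⟩ := markCentres_spec M (D := D₀) (fun p => by simp [D₀, input])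
  rw [← hD, hN₀] at hcover
  rw [← hD] at hsep
  have hX : ∀ p, D.real 2 p = pointAt x p 0 ∧ D.real 3 p = pointAt x p 1 := by
    rw [hreal]; exact input_real_two v x k
  have hcell : ∀ p < N, NearCentre M D (cellOf M D p) p := by
    intro p hp
    obtain ⟨o, ho, hop⟩ := hcover p hp
    have hlt : cellOf M D p < D.nat 0 0 := by
      rw [hN]; exact (Nat.find_min' _ (Or.inr hop)).trans_lt ho
    exact ((cellOf_eq_iff hlt).1 rfl).1
  have hMpos : (0 : ℝ) < M := by exact_mod_cast hM
  have habs : ∀ s : ℝ, M * s < 1 → M * (-s) < 1 → |s| < 1 / M := by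
    intro s h1 h2
    rw [lt_div_iff₀ hMpos]
    rcases abs_cases s with ⟨h, -⟩ | ⟨h, -⟩ <;> rw [h] <;> linarith
  have hclose : ∀ p < N, |pointAt x (cellOf M D p) 0 - pointAt x p 0| < 1 / M ∧
      |pointAt x (cellOf M D p) 1 - pointAt x p 1| < 1 / M := by
    intro p hp
    obtain ⟨-, ⟨h1, h2⟩, h3, h4⟩ := hcell p hp
    simp only [hX] at h1 h2 h3 h4
    exact ⟨habs _ h1 (by rwa [neg_sub]), habs _ h3 (by rwa [neg_sub])⟩
  let W : Finset ℕ := (Finset.range N).filter fun p => y - pointAt x p ∈ P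
  have hW : k ≤ W.card := by
    refine hy.trans ?_
    rw [← Set.ncard_coe_finset]
    refine Set.ncard_le_ncard_of_injOn (fun j : Fin N => (j : ℕ)) (fun j hj => ?_)
      (fun i _ j _ h => Fin.ext h) (Finset.finite_toSet W)
    have hj' : y - x j ∈ P := hj
    refine Finset.mem_coe.2 (Finset.mem_filter.2 ⟨Finset.mem_range.2 j.2, ?_⟩)
    rw [pointAt, dif_pos j.2]
    exact hj'
  set C := (2 * (M * (B + 1)) + 1) * (2 * (M * (B + 1)) + 1) with hC
  have himg : (W.image (cellOf M D)).card ≤ C := by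
    have h1M : 1 / (M : ℝ) ≤ 1 := by
      rw [div_le_one hMpos]; exact_mod_cast hM
    refine card_le_of_not_near (D := D) (M := M) _ (fun p hp q hq hpq => ?_) (y 0) (y 1) (B + 1)
      fun q hq => ?_
    · obtain ⟨p', hp', rfl⟩ := Finset.mem_image.1 hp
      obtain ⟨q', hq', rfl⟩ := Finset.mem_image.1 hq
      have hp' := Finset.mem_range.1 (Finset.mem_filter.1 hp').1
      have hq' := Finset.mem_range.1 (Finset.mem_filter.1 hq').1
      have := hsep _ _ hpq (hcell p' hp').1 (hcell q' hq').1
      simpa only [Near, hreal] using this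
    · obtain ⟨p, hp, rfl⟩ := Finset.mem_image.1 hq
      obtain ⟨hp, hpP⟩ := Finset.mem_filter.1 hp
      have hp := Finset.mem_range.1 hp
      obtain ⟨b0, b1⟩ := hB _ hpP
      obtain ⟨c0, c1⟩ := hclose p hp
      simp only [PiLp.sub_apply, abs_le] at b0 b1
      rw [abs_lt] at c0 c1
      simp only [hX, Nat.cast_add, Nat.cast_one, abs_le]
      refine ⟨⟨?_, ?_⟩, ?_, ?_⟩ <;> linarith [b0.1, b0.2, b1.1, b1.2, c0.1, c0.2, c1.1, c1.2]
  have hWne : W.Nonempty := Finset.card_pos.1 (by omega)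
  obtain ⟨o, ho, hmax⟩ := Finset.exists_max_image (W.image (cellOf M D))
    (fun o => (W.filter fun p => cellOf M D p = o).card) (hWne.image _)
  have hWo : k ≤ C * (W.filter fun p => cellOf M D p = o).card := by
    have := Finset.card_le_mul_card_image (f := cellOf M D) W _ hmax
    rw [mul_comm] at this
    exact hW.trans (this.trans (Nat.mul_le_mul_right _ himg))
  obtain ⟨p₀, hp₀, hp₀o⟩ := Finset.mem_image.1 ho
  obtain ⟨hp₀, hp₀P⟩ := Finset.mem_filter.1 hp₀
  have hp₀ := Finset.mem_range.1 hp₀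
  obtain ⟨t, ht, hmem⟩ := hloc {u | ∃ p < N, cellOf M D p = o ∧ u = y - pointAt x p} (by
      rintro _ ⟨p, hp, hpo, rfl⟩ _ ⟨q, hq, hqo, rfl⟩
      obtain ⟨c0, c1⟩ := hclose p hp
      obtain ⟨d0, d1⟩ := hclose q hq
      rw [hpo] at c0 c1
      rw [hqo] at d0 d1
      have h4 : 2 / (M : ℝ) < ε / 2 := by
        rw [div_lt_iff₀ hε] at hMε
        rw [div_lt_div_iff₀ hMpos (by norm_num)]
        linarith
      have h2 : 2 / (M : ℝ) = 1 / M + 1 / M := by ring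
      rw [abs_lt] at c0 c1 d0 d1
      refine dist_lt_of_coord ?_ ?_
      · simp only [PiLp.sub_apply]
        rw [abs_lt]; constructor <;> linarith [c0.1, c0.2, d0.1, d0.2]
      · simp only [PiLp.sub_apply]
        rw [abs_lt]; constructor <;> linarith [c1.1, c1.2, d1.1, d1.2])
    ⟨_, ⟨p₀, hp₀, hp₀o, rfl⟩, hp₀P⟩
  have hlin : ∀ l p, linForm D (edgeIndex l) p = edgeForm v l (pointAt x p) := by
    rw [linForm_congr hreal]; exact linForm_input v x k
  have hiff : ∀ p < N, cellOf M D p = o → (y - pointAt x p ∈ P ↔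
      linForm D (cornerIndex t).1 p ≤ edgeForm v t.1 y - edgeForm v t.1 (v t.1.1) ∧
      linForm D (cornerIndex t).2 p ≤ edgeForm v t.2 y - edgeForm v t.2 (v t.2.1)) := by
    intro p hp hpo
    rw [hmem _ ⟨p, hp, hpo, rfl⟩, edgeForm_sub, edgeForm_sub]
    simp only [cornerIndex, hlin]
    constructor <;> rintro ⟨h1, h2⟩ <;> constructor <;> linarith
  refine ⟨t, mem_corners.2 ht, o, edgeForm v t.1 y - edgeForm v t.1 (v t.1.1),
    edgeForm v t.2 y - edgeForm v t.2 (v t.2.1), hWo.trans (Nat.mul_le_mul_left _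
      (Finset.card_le_card fun p hp => ?_)), fun p hp => ?_⟩
  · obtain ⟨hp, hpo⟩ := Finset.mem_filter.1 hp
    obtain ⟨hp, hpP⟩ := Finset.mem_filter.1 hp
    exact Finset.mem_filter.2 ⟨Finset.mem_range.2 (hN ▸ Finset.mem_range.1 hp), hpo,
      (hiff p (Finset.mem_range.1 hp) hpo).1 hpP⟩
  · obtain ⟨hp, hpo, hp'⟩ := Finset.mem_filter.1 hp
    exact (hiff p (hN ▸ Finset.mem_range.1 hp) hpo).2 hp'

/-- The theorem for a fixed list of vertices, and all sufficiently large integers `α`. -/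
theorem exists_program {n : ℕ} {P : Set EuclideanPlane} {v : Fin n → EuclideanPlane}
    (hP : IsConvexPolygon P) (hv : IsVertexList P v) : ∃ α₀ : ℕ, ∀ α : ℕ, α₀ ≤ α → 1 ≤ α →
      ∃ (prog : Prog) (bound : Polynomial ℕ), ∀ k : ℕ, 1 ≤ k → ∀ (N : ℕ) (x : Fin N → EuclideanPlane),
        ∃ c : Fin N → Fin ⌈(k : ℝ) / (α : ℝ)⌉₊, IsDecomposition P x k c ∧
          ∃ (s : State) (t : ℕ), Exec prog (input v x k) s t ∧ t ≤ bound.eval N ∧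
            ∀ j : Fin N, s.nat 1 j = c j := by
  have hhull := hP.eq_convexHull hv
  obtain ⟨ε, hε, hloc⟩ := exists_local_corner hhull hP.2 hv hP.isCompact
  obtain ⟨M, hMε⟩ := exists_nat_gt (4 / ε)
  have hM : 0 < M := by
    have : (0 : ℝ) < M := (by positivity : (0 : ℝ) < 4 / ε).trans hMε
    exact_mod_cast this
  obtain ⟨R, hR⟩ := hP.isCompact.isBounded.exists_norm_le
  obtain ⟨B, hB⟩ := exists_nat_ge R
  have hB' : ∀ u ∈ P, |u 0| ≤ B ∧ |u 1| ≤ B := fun u hu =>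
    ⟨(PiLp.norm_apply_le u 0).trans ((hR u hu).trans hB),
      (PiLp.norm_apply_le u 1).trans ((hR u hu).trans hB)⟩
  let C := (2 * (M * (B + 1)) + 1) * (2 * (M * (B + 1)) + 1)
  -- wedges are heavy with half of the `k / C` points present initially
  let c₁ := 2 * C
  -- at most `n * n` directions each deprive fewer than `k / c₂` points of support
  let c₂ := (n * n + 1) * c₁ + 1
  let types := corners P v
  refine ⟨2 * types.length * (4 * c₂ + 8 * C), fun α hα hα1 => ?_⟩
  obtain ⟨p₁, T₁, hp₁⟩ := polyComputes_markCentres M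
  obtain ⟨p₂, T₂, hp₂⟩ := polyComputes_roundStep (M := M) (c₁ := c₁) (c₂ := c₂)
    (corner := cornerIndex (n := n)) (dirs := negativeEdges v) types
  obtain ⟨p₃, T₃, hp₃⟩ := polyComputes_finish
  -- `α * r < k` says `r < ⌈k / α⌉`, so that the number of rounds need not be computed
  let b : Test := .natLt ((NatExpr.read 8 (.lit 0)).mulLit α) (.read 0 (.lit 1))
  -- for `k > N` nothing has to be covered; this case is set apart since the number of rounds is not
  -- bounded in terms of `N`
  let b' : Test := .natLt (.read 0 (.lit 0)) (.read 0 (.lit 1))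
  refine ⟨.ite b' .skip (.seq p₁ (.seq (.loop b p₂) p₃)),
    T₁ + (.X * (T₂ + .C (b.cost + 1)) + .C (b.cost + 1)) + T₃ + .C (b'.cost + 2),
    fun k hk N x => ?_⟩
  have hαpos : (0 : ℝ) < α := by exact_mod_cast hα1
  set m := ⌈(k : ℝ) / (α : ℝ)⌉₊ with hm
  have hmpos : 0 < m := Nat.ceil_pos.2 (div_pos (by exact_mod_cast hk) hαpos)
  have hmlt : ∀ r, r < m ↔ α * r < k := by
    intro r
    rw [hm, Nat.lt_ceil, lt_div_iff₀ hαpos, mul_comm]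
    exact_mod_cast Iff.rfl
  set D₀ := input v x k with hD₀
  have hN₀ : D₀.nat 0 0 = N := by simp [D₀, input]
  have hk₀ : D₀.nat 0 1 = k := by simp [D₀, input]
  by_cases hkN : N < k
  · refine ⟨fun _ => ⟨0, hmpos⟩, fun y hy => ?_, D₀, _, .ite_true ?_ (.skip _), ?_, fun j => ?_⟩
    · have := hy.trans (Set.ncard_le_card _)
      simp at this
      omega
    · simpa [b', Test.Holds, NatExpr.eval, hN₀, hk₀] using hkN
    · simp; omega
    · simp [D₀, input]
  · set D := markCentres M D₀ with hD
    have hreal : D.real = D₀.real := assign_real ..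
    have hnat : ∀ a ≠ 3, D.nat a = D₀.nat a := fun a ha => assign_nat_of_ne ha ..
    have hN : D.nat 0 0 = N := by rw [hnat 0 (by decide), hN₀]
    have hkD : D.nat 0 1 = k := by rw [hnat 0 (by decide), hk₀]
    have hcd : CornerData c₁ c₂ cornerIndex (negativeEdges v) D types :=
      cornerData_input hhull hv.1 x hk (Nat.lt_succ_self _) hreal hkD
    let F := roundStep M c₁ c₂ (cornerIndex (n := n)) (negativeEdges v) types
    have hinv : ∀ r ≤ m, RoundInvariant M c₂ (cornerIndex (n := n)) C types D r (F^[r] D) := by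
      intro r
      induction r with
      | zero =>
        have h1 : ∀ p, D.nat 1 p = 0 := fun p => by rw [hnat 1 (by decide)]; simp [D₀, input]
        refine fun _ => ⟨rfl, fun _ _ _ _ => rfl, ?_, fun p _ => by simp [h1], ?_, ?_⟩
        · rw [Function.iterate_zero_apply, hnat 8 (by decide)]; simp [D₀, input]
        · intro t _ o γ δ _
          simp [h1]
        · intro t _ o γ δ _ r' hr'
          exact absurd hr' (Nat.not_lt_zero _)
      | succ r ih =>
        intro hr
        rw [Function.iterate_succ_apply']
        exact (ih (by omega)).step hcd rfl hα (by rw [hkD]; exact (hmlt r).1 hr)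
    have hbh : ∀ r ≤ m, ∀ s', Agree s' (F^[r] D) → (b.Holds s' ↔ r < m) := by
      intro r hr s' hs'
      have h := hinv r hr
      have h8 : s'.nat 8 0 = r := by
        rw [hs'.nat 8 (by decide) (by decide) (by decide), h.round]
      have h0 : s'.nat 0 1 = k := by
        rw [hs'.nat 0 (by decide) (by decide) (by decide), h.nat 0 (by decide) (by decide) (by decide),
          hkD]
      simp only [b, Test.Holds, NatExpr.eval_mulLit, NatExpr.eval, h8, h0, hmlt]
    obtain ⟨s₁, t₁, he₁, ht₁, ha₁⟩ := hp₁ D₀ D₀ (Agree.refl _)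
    obtain ⟨s₂, t₂, he₂, ht₂, ha₂⟩ := exec_loop_iterate (F := F) (b := b) (p := p₂)
      (B := T₂.eval N) (fun D' => D'.nat 0 0 = N)
      (fun s D' hs hD' => by
        obtain ⟨s', t, h1, h2, h3⟩ := hp₂ s D' hs
        exact ⟨s', t, h1, hD' ▸ h2, h3⟩)
      (fun D' hD' => by rw [roundStep_nat_zero]; exact hD') m s₁ D ha₁ hN
      (fun j hj s' hs' => (hbh j hj.le s' hs').2 hj)
      (fun s' hs' h => lt_irrefl _ ((hbh m le_rfl s' hs').1 h))
    obtain ⟨s₃, t₃, he₃, ht₃, ha₃⟩ := hp₃ s₂ _ ha₂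
    have hfin := hinv m le_rfl
    have hNF : (F^[m] D).nat 0 0 = N := by
      rw [hfin.nat 0 (by decide) (by decide) (by decide), hN]
    have hcol : ∀ p < N, s₃.nat 1 p = (F^[m] D).nat 1 p - 1 := by
      intro p hp
      rw [ha₃.nat 1 (by decide) (by decide) (by decide)]
      exact (assign_nat_same (a := 1) (R := fun _ _ => True) (hNF.symm ▸ hp)
        (fun D' _ _ h => ⟨Iff.rfl, by rw [h]⟩)).1 trivial
    have hlt : ∀ j : Fin N, s₃.nat 1 j < m := by
      intro j
      rw [hcol j j.2]
      have := hfin.le j (hN.symm ▸ j.2)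
      omega
    refine ⟨fun j => ⟨s₃.nat 1 j, hlt j⟩, fun y hy i => ?_, s₃, _,
      .ite_false ?_ (.seq he₁ (.seq he₂ he₃)), ?_, fun j => rfl⟩
    · obtain ⟨t, ht, o, γ, δ, hcard, hsub⟩ := exists_cellWedge (v := v) hM hMε hε hB' hloc x hk y hy
      obtain ⟨p, hp, hp1⟩ := hfin.hit t ht o γ δ (by rw [hkD]; exact hcard) i i.2
      have hpN : p < N := hN ▸ Finset.mem_range.1 (Finset.mem_filter.1 hp).1
      refine ⟨⟨p, hpN⟩, Fin.ext ?_, ?_⟩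
      · change s₃.nat 1 p = i
        rw [hcol p hpN, hp1]; rfl
      · have := hsub p hp
        rw [pointAt, dif_pos hpN] at this
        exact this
    · simpa [b', Test.Holds, NatExpr.eval, hN₀, hk₀] using hkN
    · rw [hN₀] at ht₁
      rw [hNF] at ht₃
      have hmN : m ≤ N := by
        have : m ≤ k := by
          rw [hm, Nat.ceil_le, div_le_iff₀ hαpos]
          have : (1 : ℝ) ≤ α := by exact_mod_cast hα1
          have hk0 : (0 : ℝ) ≤ k := Nat.cast_nonneg k
          nlinarith
        omega
      have h2 := Nat.mul_le_mul_right (T₂.eval N + b.cost + 1) hmN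
      simp only [Polynomial.eval_add, Polynomial.eval_mul, Polynomial.eval_X, Polynomial.eval_C]
      have e : N * (T₂.eval N + (b.cost + 1)) = N * (T₂.eval N + b.cost + 1) := by ring
      rw [e]
      omega

end RealRAM

theorem theorem1 (P : Set (EuclideanSpace ℝ (Fin 2))) (hP : IsConvexPolygon P) :
    ∃ α : ℝ, 1 ≤ α ∧
      ∀ (n : ℕ) (v : Fin n → EuclideanSpace ℝ (Fin 2)), IsVertexList P v →
        ∃ (prog : RealRAM.Prog) (bound : Polynomial ℕ),
          ∀ k : ℕ, 1 ≤ k → ∀ (N : ℕ) (x : Fin N → EuclideanSpace ℝ (Fin 2)),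
            ∃ c : Fin N → Fin ⌈(k : ℝ) / α⌉₊, IsDecomposition P x k c ∧
              ∃ (s : RealRAM.State) (t : ℕ), RealRAM.Exec prog (RealRAM.input v x k) s t ∧
                t ≤ bound.eval N ∧ ∀ j : Fin N, s.nat 1 j = c j := by
  -- there are only finitely many lists of the vertices, so that one `α` works for all of them
  have hfin : (P.extremePoints ℝ).Finite := by
    obtain ⟨⟨S, rfl⟩, -⟩ := hP
    exact S.finite_toSet.subset (extremePoints_convexHull_subset)
  have key : ∀ e : ℕ, ∃ A : ℕ, ∀ v : Fin e → EuclideanSpace ℝ (Fin 2), IsVertexList P v →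
      ∀ α : ℕ, A ≤ α → 1 ≤ α → ∃ (prog : RealRAM.Prog) (bound : Polynomial ℕ),
          ∀ k : ℕ, 1 ≤ k → ∀ (N : ℕ) (x : Fin N → EuclideanSpace ℝ (Fin 2)),
            ∃ c : Fin N → Fin ⌈(k : ℝ) / (α : ℝ)⌉₊, IsDecomposition P x k c ∧
              ∃ (s : RealRAM.State) (t : ℕ), RealRAM.Exec prog (RealRAM.input v x k) s t ∧
                t ≤ bound.eval N ∧ ∀ j : Fin N, s.nat 1 j = c j := by
    intro e
    have hfe : {v : Fin e → EuclideanSpace ℝ (Fin 2) | IsVertexList P v}.Finite :=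
      (Set.Finite.pi' fun _ : Fin e => hfin).subset fun v hv i => hv.2 ▸ Set.mem_range_self i
    have hex : ∀ v : Fin e → EuclideanSpace ℝ (Fin 2), ∃ α₀ : ℕ, IsVertexList P v → ∀ α : ℕ, α₀ ≤ α →
        1 ≤ α → ∃ (prog : RealRAM.Prog) (bound : Polynomial ℕ),
          ∀ k : ℕ, 1 ≤ k → ∀ (N : ℕ) (x : Fin N → EuclideanSpace ℝ (Fin 2)),
            ∃ c : Fin N → Fin ⌈(k : ℝ) / (α : ℝ)⌉₊, IsDecomposition P x k c ∧
              ∃ (s : RealRAM.State) (t : ℕ), RealRAM.Exec prog (RealRAM.input v x k) s t ∧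
                t ≤ bound.eval N ∧ ∀ j : Fin N, s.nat 1 j = c j := by
      intro v
      by_cases hv : IsVertexList P v
      · obtain ⟨α₀, h⟩ := RealRAM.exists_program hP hv
        exact ⟨α₀, fun _ => h⟩
      · exact ⟨0, fun h => absurd h hv⟩
    choose A hA using hex
    obtain ⟨A', hA'⟩ := (hfe.image A).bddAbove
    exact ⟨A', fun v hv α hα => hA v hv α ((hA' ⟨v, hv, rfl⟩).trans hα)⟩
  obtain ⟨A, hA⟩ := key (P.extremePoints ℝ).ncard
  refine ⟨((max A 1 : ℕ) : ℝ), by exact_mod_cast le_max_right A 1, fun n v hv => ?_⟩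
  have hn : n = (P.extremePoints ℝ).ncard := by
    rw [← hv.2, ← Set.image_univ, Set.ncard_image_of_injective _ hv.1, Set.ncard_univ]
    simp
  subst hn
  exact hA v hv _ (le_max_left A 1) (le_max_right A 1)
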